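/- Let $K$ be a (non-empty) smooth $7$-manifold with a contact Calabi–Yau structure: a contact form $\eta$ with Reeb field $\xi$; a transverse complex structure $J$ (with $J\xi=0$, $J^2=-1+\eta\otimes\xi$) such that, for $\omega:=d\eta$, $g_V(X,Y)=\omega(X,JY)$ is a $J$-invariant transverse metric (positive definite on $\ker\eta$); and a closed transverse complex $3$-form $\Omega$ of type $(3,0)$ with $\frac{\omega^3}{3!}=\frac14\operatorname{Re}\Omega\wedge\operatorname{Im}\Omega$. (For example, $K$ is the total space of a circle (orbi)bundle over a Calabi–Yau $3$-orbifold $(V,g_V,\omega,\Omega)$ with connection form $\eta$, $d\eta=\omega$.) For $\epsilon>0$ let $\psi_\epsilon=\frac12\omega^2-\epsilon\,\eta\wedge\operatorname{Im}\Omega$. On an open set take a local coframe $e_0=\epsilon\eta$, $e=(e_1,e_2,e_3)^{\rm T}$, $Je=(Je_1,Je_2,Je_3)^{\rm T}$, where $e_i,Je_i$ are horizontal (they vanish on $\xi$), $(J\alpha)(X)=-\alpha(JX)$, and $$\omega=\sum_{i=1}^3 e_i\wedge Je_i,\qquad \Omega=(e_1+iJe_1)\wedge(e_2+iJe_2)\wedge(e_3+iJe_3).$$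 Let $\Gamma$ be the $6\times 6$ matrix of the (pulled-back) Levi-Civita connection of $g_V$ in the coframe $(e,Je)$, i.e. the skew-symmetric matrix of $1$-forms with $d\binom{e}{Je}=-\Gamma\wedge\binom{e}{Je}$. For a vector $a=(a_1,a_2,a_3)^{\rm T}$ put $$[a]=\begin{pmatrix}0&a_3&-a_2\\-a_3&0&a_1\\a_2&-a_1&0\end{pmatrix},$$ let $I$ be the $3\times 3$ identity matrix, and in blocks of size $1+3+3$ (respectively $1+6$ for $A$) put $$A=\begin{pmatrix}0&0\\0&\Gamma\end{pmatrix},\quad B=\begin{pmatrix}0&Je^{\rm T}&-e^{\rm T}\\-Je&0&-e_0I\\e&e_0I&0\end{pmatrix},\quad C=\begin{pmatrix}0&Je^{\rm T}&-e^{\rm T}\\-Je&-[e]&e_0I+[Je]\\e&-e_0I+[Je]&[e]\end{pmatrix},\quad \mathcal I=\begin{pmatrix}0&0&0\\0&0&-I\\0&I&0\end{pmatrix}.$$ For $\delta,k\in\mathbb R$ let $\theta^{\delta,k}_\epsilon$ be the connection on $TK$ given in each such coframe by the matrix $\theta^{\delta,k}_\epsilon=A+\frac{k\epsilon}{2}(B+\delta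 C)$, with curvature $R=d\theta^{\delta,k}_\epsilon+\theta^{\delta,k}_\epsilon\wedge\theta^{\delta,k}_\epsilon$. Then, in every such coframe, $$\begin{aligned}R\wedge\psi_\epsilon={}&\frac{k\epsilon^2(1-\delta)\big(6+k(1+3\delta)\big)}{4}\,\frac{\omega^3}{6}\,\mathcal I\\&+\frac{k^2\epsilon^2}{4}\,e_0\wedge\frac{\omega^2}{2}\wedge\begin{pmatrix}0&(1-5\delta)(1+\delta)e^{\rm T}&(1-5\delta)(1+\delta)Je^{\rm T}\\(5\delta-1)(1+\delta)e&(\delta^2-4\delta-1)[Je]&(\delta^2-4\delta-1)[e]\\(5\delta-1)(1+\delta)Je&(\delta^2-4\delta-1)[e]&-(\delta^2-4\delta-1)[Je]\end{pmatrix}.\end{aligned}$$ Consequently, if $k\neq0$ then $\theta^{\delta,k}_\epsilon$ is not a ${\rm G}_2$-instanton, i.e. it is not the case that $R\wedge\psi_\epsilon=0$ on the domain of every such coframe. In particular neither the Bismut connection $\theta^{1,1}_\epsilon$ nor the Hull connection $\theta^{-1,1}_\epsilon$ is a ${\rm G}_2$-instanton. -/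

import Mathlib

open scoped Manifold ContDiff

noncomputable section

/-! ### Wedge product of alternating forms -/

section Wedge

variable {V A : Type*} [AddCommGroup V] [Module ℝ V] [TopologicalSpace V]
  [NormedCommRing A] [NormedAlgebra ℝ A]

/-- The wedge product of two alternating forms, as an algebraic alternating map:
`(α ∧ β)(v₁, …, v_{m+n}) = ∑ sign(σ) α(v_{σ(1)}, …, v_{σ(m)}) β(v_{σ(m+1)}, …, v_{σ(m+n)})`,
the sum being over all `(m, n)`-shuffles `σ`. -/
def wedgeAlg {m n : ℕ} (α : V [⋀^Fin m]→L[ℝ] A) (β : V [⋀^Fin n]→L[ℝ] A) :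
    V [⋀^Fin (m + n)]→ₗ[ℝ] A :=
  ((LinearMap.mul' ℝ A).compAlternatingMap
    (α.toAlternatingMap.domCoprod β.toAlternatingMap)).domDomCongr finSumFinEquiv

theorem continuous_wedgeAlg {m n : ℕ} (α : V [⋀^Fin m]→L[ℝ] A) (β : V [⋀^Fin n]→L[ℝ] A) :
    Continuous (wedgeAlg α β) := by
  have h : ∀ v, wedgeAlg α β v = ∑ σ : Equiv.Perm.ModSumCongr (Fin m) (Fin n),
      LinearMap.mul' ℝ A (AlternatingMap.domCoprod.summand α.toAlternatingMap β.toAlternatingMap σ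
        (fun i => v (finSumFinEquiv i))) := by
    intro v
    simp [wedgeAlg, AlternatingMap.domCoprod_apply, Function.comp_def]
  have h' : (wedgeAlg α β : (Fin (m + n) → V) → A) = fun v =>
      ∑ σ : Equiv.Perm.ModSumCongr (Fin m) (Fin n),
      LinearMap.mul' ℝ A (AlternatingMap.domCoprod.summand α.toAlternatingMap β.toAlternatingMap σ
        (fun i => v (finSumFinEquiv i))) := funext h
  rw [h']
  refine continuous_finsetSum _ fun σ _ => ?_
  induction σ using Quotient.inductionOn' with
  | h σ =>
    have hs : ∀ v : Fin (m + n) → V, LinearMap.mul' ℝ A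
        (AlternatingMap.domCoprod.summand α.toAlternatingMap β.toAlternatingMap
          (Quotient.mk'' σ) (fun i => v (finSumFinEquiv i))) =
        (Equiv.Perm.sign σ : ℤ) • (α (fun i => v (finSumFinEquiv (σ (Sum.inl i)))) *
          β (fun i => v (finSumFinEquiv (σ (Sum.inr i))))) := by
      intro v
      rw [AlternatingMap.domCoprod.summand_mk'']
      rcases Int.units_eq_one_or (Equiv.Perm.sign σ) with h1 | h1 <;> rw [h1] <;>
        simp [MultilinearMap.domCoprod_apply]
    simp only [hs]
    refine Continuous.fun_const_smul (Continuous.mul ?_ ?_) _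
    · exact α.cont.comp (continuous_pi fun i => continuous_apply _)
    · exact β.cont.comp (continuous_pi fun i => continuous_apply _)

/-- The wedge product of two alternating forms with values in a commutative algebra. -/
def wedge {m n : ℕ} (α : V [⋀^Fin m]→L[ℝ] A) (β : V [⋀^Fin n]→L[ℝ] A) :
    V [⋀^Fin (m + n)]→L[ℝ] A :=
  { wedgeAlg α β with cont := continuous_wedgeAlg α β }

end Wedge

/-! ### Differential forms on a 7-manifold -/

/-- The model space of a 7-manifold. -/
abbrev E7 : Type := EuclideanSpace ℝ (Fin 7)

section Forms

variable (K : Type*) [TopologicalSpace K] [ChartedSpace E7 K]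

/-- (Not necessarily smooth) differential `n`-forms on `K` with values in `A`. -/
abbrev DiffForm (A : Type*) [NormedAddCommGroup A] [NormedSpace ℝ A] (n : ℕ) : Type _ :=
  (x : K) → (TangentSpace (𝓡 7) x) [⋀^Fin n]→L[ℝ] A

variable {K}
variable {A : Type*} [NormedAddCommGroup A] [NormedSpace ℝ A]

/-- The form `α` read in the preferred chart at `x`: its pull-back by the inverse of the chart. -/
def chartRep {n : ℕ} (α : DiffForm K A n) (x : K) (y : E7) : E7 [⋀^Fin n]→L[ℝ] A :=
  (α ((extChartAt (𝓡 7) x).symm y)).compContinuousLinearMap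
    (mfderiv 𝓘(ℝ, E7) (𝓡 7) (extChartAt (𝓡 7) x).symm y : E7 →L[ℝ] _)

/-- Smoothness of a differential form on a set `U` (used for open `U`). -/
def SmoothFormOn {n : ℕ} (α : DiffForm K A n) (U : Set K) : Prop :=
  ∀ x ∈ U, ContDiffAt ℝ ∞ (chartRep α x) (extChartAt (𝓡 7) x x)

/-- The exterior derivative, computed in the preferred chart at each point. -/
def extD {n : ℕ} (α : DiffForm K A n) : DiffForm K A (n + 1) := fun x =>
  (extDeriv (chartRep α x) (extChartAt (𝓡 7) x x)).compContinuousLinearMap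
    (mfderiv (𝓡 7) 𝓘(ℝ, E7) (extChartAt (𝓡 7) x) x : _ →L[ℝ] E7)

/-- The wedge product of differential forms. -/
def wedgeF {B : Type*} [NormedCommRing B] [NormedAlgebra ℝ B] {m n : ℕ}
    (α : DiffForm K B m) (β : DiffForm K B n) : DiffForm K B (m + n) := fun x => wedge (α x) (β x)

/-- A real form regarded as a complex-valued form. -/
def complexify {n : ℕ} (α : DiffForm K ℝ n) : DiffForm K ℂ n := fun x =>
  Complex.ofRealCLM.compContinuousAlternatingMap (α x)

/-- The real part of a complex-valued form. -/
def reForm {n : ℕ} (α : DiffForm K ℂ n) : DiffForm K ℝ n := fun x =>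
  Complex.reCLM.compContinuousAlternatingMap (α x)

/-- The imaginary part of a complex-valued form. -/
def imForm {n : ℕ} (α : DiffForm K ℂ n) : DiffForm K ℝ n := fun x =>
  Complex.imCLM.compContinuousAlternatingMap (α x)

end Forms

/-! ### Contact Calabi–Yau 7-manifolds -/

/-- A contact Calabi–Yau structure on a 7-manifold `K`: a contact form `η` with Reeb field `ξ`, a
transverse complex structure `J` (extended by `J ξ = 0`) compatible with `ω = dη`, so that
`g_V(X, Y) = ω(X, J Y)` is a transverse metric, and a closed transverse form `Ω` of type `(3,0)`
with `ω³/3! = Re Ω ∧ Im Ω / 4`.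
Closedness of `Ω` makes the transverse almost complex structure integrable and `ξ`-invariant, so
that the transverse geometry is that of a Calabi–Yau 3-fold (locally, the leaf space of `ξ`). -/
structure ContactCalabiYau (K : Type*) [TopologicalSpace K] [ChartedSpace E7 K]
    [IsManifold (𝓡 7) ∞ K] where
  η : DiffForm K ℝ 1
  ξ : (x : K) → TangentSpace (𝓡 7) x
  J : (x : K) → TangentSpace (𝓡 7) x →L[ℝ] TangentSpace (𝓡 7) x
  Ω : DiffForm K ℂ 3
  smooth_η : SmoothFormOn η Set.univ
  smooth_ξ : ContMDiff (𝓡 7) (𝓡 7).tangent ∞ (fun x => (⟨x, ξ x⟩ : TangentBundle (𝓡 7) K))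
  smooth_J : ContMDiff (𝓡 7) ((𝓡 7).prod 𝓘(ℝ, E7 →L[ℝ] E7)) ∞
    (fun x => Bundle.TotalSpace.mk' (E7 →L[ℝ] E7)
      (E := fun x : K => TangentSpace (𝓡 7) x →L[ℝ] TangentSpace (𝓡 7) x) x (J x))
  smooth_Ω : SmoothFormOn Ω Set.univ
  η_ξ : ∀ x, η x ![ξ x] = 1
  dη_ξ : ∀ x Y, extD η x ![ξ x, Y] = 0
  J_ξ : ∀ x, J x (ξ x) = 0
  J_J : ∀ x X, J x (J x X) = -X + η x ![X] • ξ x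
  dη_J : ∀ x X Y, extD η x ![J x X, J x Y] = extD η x ![X, Y]
  dη_pos : ∀ x X, η x ![X] = 0 → X ≠ 0 → 0 < extD η x ![X, J x X]
  Ω_J : ∀ x X Y Z, Ω x ![J x X, Y, Z] = Complex.I * Ω x ![X, Y, Z]
  dΩ : extD Ω = 0
  volume_eq : (1 / 6 : ℝ) • wedgeF (wedgeF (extD η) (extD η)) (extD η) =
    (1 / 4 : ℝ) • wedgeF (reForm Ω) (imForm Ω)

namespace ContactCalabiYau

variable {K : Type*} [TopologicalSpace K] [ChartedSpace E7 K] [IsManifold (𝓡 7) ∞ K]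

/-- The transverse Kähler form `ω = dη`. -/
def omega (S : ContactCalabiYau K) : DiffForm K ℝ 2 := extD S.η

/-- The 4-form `ω²/2`. -/
def halfOmegaSq (S : ContactCalabiYau K) : DiffForm K ℝ 4 := (1 / 2 : ℝ) • wedgeF S.omega S.omega

/-- The 6-form `ω³/6`. -/
def sixthOmegaCube (S : ContactCalabiYau K) : DiffForm K ℝ 6 :=
  (1 / 6 : ℝ) • wedgeF (wedgeF S.omega S.omega) S.omega

/-- The 4-form `ψ_ε = ω²/2 - ε η ∧ Im Ω`. -/
def ψ (S : ContactCalabiYau K) (ε : ℝ) : DiffForm K ℝ 4 :=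
  S.halfOmegaSq - ε • wedgeF S.η (imForm S.Ω)

/-- The action of `J` on 1-forms, `(J α)(X) = -α(J X)` (so `J dx = dy` if `J ∂_x = ∂_y`). -/
def actJ (S : ContactCalabiYau K) (α : DiffForm K ℝ 1) : DiffForm K ℝ 1 := fun x =>
  -(α x).compContinuousLinearMap (S.J x)

/-- A local Sasakian coframe on an open set `U`: horizontal 1-forms `e₁, e₂, e₃` such that
`ω = ∑ eᵢ ∧ Jeᵢ` and `Ω = (e₁ + i Je₁) ∧ (e₂ + i Je₂) ∧ (e₃ + i Je₃)` on `U`.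
Together with `e₀ = ε η` this is an orthonormal coframe for `g_ε = ε² η ⊗ η + g_V`. -/
structure Coframe (S : ContactCalabiYau K) where
  U : Set K
  isOpen_U : IsOpen U
  e : Fin 3 → DiffForm K ℝ 1
  smooth_e : ∀ i, SmoothFormOn (e i) U
  smooth_Je : ∀ i, SmoothFormOn (S.actJ (e i)) U
  e_ξ : ∀ i, ∀ x ∈ U, e i x ![S.ξ x] = 0
  omega_eq : ∀ x ∈ U, S.omega x = ∑ i, wedgeF (e i) (S.actJ (e i)) x
  Ω_eq : ∀ x ∈ U, S.Ω x =
    wedgeF (wedgeF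
      (complexify (e 0) + Complex.I • complexify (S.actJ (e 0)))
      (complexify (e 1) + Complex.I • complexify (S.actJ (e 1))))
      (complexify (e 2) + Complex.I • complexify (S.actJ (e 2))) x

end ContactCalabiYau

/-! ### Matrices of differential forms -/

/-- The index set of the blocks `1 + 3 + 3` of a coframe `(e₀, e, Je)`. -/
abbrev Idx7 : Type := Unit ⊕ (Fin 3 ⊕ Fin 3)

section FormMatrices

variable {K : Type*} [TopologicalSpace K] [ChartedSpace E7 K]

/-- The curvature `R = dθ + θ ∧ θ` of a connection matrix `θ`. -/
def curvature {ι : Type*} [Fintype ι] (θ : Matrix ι ι (DiffForm K ℝ 1)) :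
    Matrix ι ι (DiffForm K ℝ 2) :=
  Matrix.of fun i j => extD (θ i j) + ∑ l, wedgeF (θ i l) (θ l j)

/-- The skew-symmetric matrix `[a]` associated with a vector `a` of 1-forms. -/
def box (a : Fin 3 → DiffForm K ℝ 1) : Matrix (Fin 3) (Fin 3) (DiffForm K ℝ 1) :=
  !![0, a 2, -a 1; -a 2, 0, a 0; a 1, -a 0, 0]

/-- The `7 × 7` matrix with blocks `(0, rᵀ, sᵀ; -r, p, q; -s, p', q')`. -/
def blockMatrix {n : ℕ} (r s : Fin 3 → DiffForm K ℝ n)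
    (p q p' q' : Matrix (Fin 3) (Fin 3) (DiffForm K ℝ n)) :
    Matrix Idx7 Idx7 (DiffForm K ℝ n) :=
  Matrix.fromBlocks 0
    (Matrix.of fun _ j => Sum.elim r s j)
    (Matrix.of fun i _ => -Sum.elim r s i)
    (Matrix.fromBlocks p q p' q')

/-- The matrix `α 𝓘 = (0, 0, 0; 0, 0, -α I; 0, α I, 0)`. -/
def smulI {n : ℕ} (α : DiffForm K ℝ n) : Matrix Idx7 Idx7 (DiffForm K ℝ n) :=
  blockMatrix 0 0 0 (-Matrix.diagonal fun _ => α) (Matrix.diagonal fun _ => α) 0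

end FormMatrices

namespace ContactCalabiYau.Coframe

variable {K : Type*} [TopologicalSpace K] [ChartedSpace E7 K] [IsManifold (𝓡 7) ∞ K]
  {S : ContactCalabiYau K}

/-- The 1-forms `Je = (Je₁, Je₂, Je₃)`. -/
def Je (F : S.Coframe) (i : Fin 3) : DiffForm K ℝ 1 := S.actJ (F.e i)

/-- The transverse coframe `(e, Je)`. -/
def tr (F : S.Coframe) : Fin 3 ⊕ Fin 3 → DiffForm K ℝ 1 := Sum.elim F.e F.Je

/-- `Γ` is the matrix, in the orthonormal coframe `(e, Je)`, of the (pull-back to `K` of the)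
Levi-Civita connection of the transverse Calabi–Yau metric `g_V`: it is metric (skew-symmetric)
and torsion free (first structure equation). -/
structure IsTransverseLeviCivita (F : S.Coframe)
    (Γ : Matrix (Fin 3 ⊕ Fin 3) (Fin 3 ⊕ Fin 3) (DiffForm K ℝ 1)) : Prop where
  smooth : ∀ i j, SmoothFormOn (Γ i j) F.U
  skew : ∀ i j, ∀ x ∈ F.U, Γ j i x = -Γ i j x
  torsion_free : ∀ i, ∀ x ∈ F.U, extD (F.tr i) x = -∑ j, wedgeF (Γ i j) (F.tr j) x

/-- The connection matrix `A` on `TK`, trivial along `e₀`. -/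
def matA (Γ : Matrix (Fin 3 ⊕ Fin 3) (Fin 3 ⊕ Fin 3) (DiffForm K ℝ 1)) :
    Matrix Idx7 Idx7 (DiffForm K ℝ 1) := Matrix.fromBlocks 0 0 0 Γ

/-- The matrix `B = (0, Jeᵀ, -eᵀ; -Je, 0, -e₀ I; e, e₀ I, 0)`, with `e₀ = ε η`. -/
def matB (F : S.Coframe) (ε : ℝ) : Matrix Idx7 Idx7 (DiffForm K ℝ 1) :=
  blockMatrix F.Je (-F.e)
    0 (-Matrix.diagonal fun _ => ε • S.η)
    (Matrix.diagonal fun _ => ε • S.η) 0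

/-- The matrix `C = (0, Jeᵀ, -eᵀ; -Je, -[e], e₀ I + [Je]; e, -e₀ I + [Je], [e])`, with
`e₀ = ε η`. -/
def matC (F : S.Coframe) (ε : ℝ) : Matrix Idx7 Idx7 (DiffForm K ℝ 1) :=
  blockMatrix F.Je (-F.e)
    (-box F.e) ((Matrix.diagonal fun _ => ε • S.η) + box F.Je)
    ((-Matrix.diagonal fun _ => ε • S.η) + box F.Je) (box F.e)

/-- The connection matrix `θ_ε^{δ,k} = A + (kε/2) (B + δ C)` on `TK`. -/
def theta (F : S.Coframe) (Γ : Matrix (Fin 3 ⊕ Fin 3) (Fin 3 ⊕ Fin 3) (DiffForm K ℝ 1))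
    (ε δ k : ℝ) : Matrix Idx7 Idx7 (DiffForm K ℝ 1) :=
  matA Γ + (k * ε / 2) • (F.matB ε + δ • F.matC ε)

end ContactCalabiYau.Coframe

namespace ContactCalabiYau

variable {K : Type*} [TopologicalSpace K] [ChartedSpace E7 K] [IsManifold (𝓡 7) ∞ K]

/-- The connection on `TK` given in each local coframe by `θ_ε^{δ,k}` is a `G₂`-instanton:
`R ∧ ψ_ε = 0` for its curvature `R`, over the domain of every local coframe. -/
def IsG2Instanton (S : ContactCalabiYau K) (ε δ k : ℝ) : Prop :=
  ∀ (F : S.Coframe) (Γ : Matrix (Fin 3 ⊕ Fin 3) (Fin 3 ⊕ Fin 3) (DiffForm K ℝ 1)),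
    F.IsTransverseLeviCivita Γ → ∀ x ∈ F.U, ∀ i j,
      wedgeF (curvature (F.theta Γ ε δ k) i j) (S.ψ ε) x = 0

/-- The matrix of 1-forms which is wedged with `e₀ ∧ ω²/2` in `R ∧ ψ_ε`. -/
def Coframe.matN {S : ContactCalabiYau K} (F : S.Coframe) (δ : ℝ) :
    Matrix Idx7 Idx7 (DiffForm K ℝ 1) :=
  blockMatrix (((1 - 5 * δ) * (1 + δ)) • F.e) (((1 - 5 * δ) * (1 + δ)) • F.Je)
    ((δ ^ 2 - 4 * δ - 1) • box F.Je) ((δ ^ 2 - 4 * δ - 1) • box F.e)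
    ((δ ^ 2 - 4 * δ - 1) • box F.e) (-((δ ^ 2 - 4 * δ - 1) • box F.Je))

end ContactCalabiYau

end

/-!
All identities are checked pointwise, in the coframe `E = (ε η, e, Je)` of a neighbourhood and the
frame dual to it, indexed by `Fin 7`.

**Special holonomy.** In such a coframe `ω = dη` and `Ω` have constant coefficients, and both are
closed. A skew-symmetric torsion-free transverse connection matrix `Γ` is therefore forced to take
values in `𝔰𝔲(3)`: the components of `dω = 0` and `dΩ = 0` are linear equations on the part of `Γ`
complementary to `𝔰𝔲(3)`, and have only the zero solution (`isSU3_of_closed`,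
`IsTransverseLeviCivita.isSU3`).

**The curvature of `θ = A + s (B + δ C)`, `s = kε/2`.** The coefficients of `B` and `C` are
`𝔰𝔲(3)`-invariant tensors, hence parallel for `A` (`IsSU3.tensorBC_parallel`). In
`R = dA + A ∧ A + s (d(B + δC) + [A, B + δC]) + s² (B + δC)²` the middle term is then reduced to the
torsion of `A`, that is to `d e₀ = ε ω`, and equals `sε (1 - δ) ω 𝓘`
(`IsTransverseLeviCivita.curvature_apply`).

**Wedging with `ψ`.** On a 2-form `S`, the 6-form `S ∧ ψ` depends only on seven contractions of `S`,
namely those with the pairs of indices `pairFst`, `pairSnd` (`IsDualFrame.wedge_psiOf`); the same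
contractions cut out `𝔰𝔲(3)` among the skew-symmetric transverse matrices. The curvature of `A` is
`𝔰𝔲(3)`-valued, so by pair symmetry, which follows from the first Bianchi identity
(`pair_symmetry`), its 2-form part satisfies the instanton equation too and drops out
(`IsTransverseLeviCivita.sum_connCurv_frame`). The quadratic term is a finite computation with
integer tensors (`contraction_tensor`). Adding the torsion term gives the formula for `R ∧ ψ`.

**No instantons.** The components of `R ∧ ψ` in the first row and in the `[Je]` block would force
`(1 - 5δ)(1 + δ) = 0` and `δ² - 4δ - 1 = 0` when `k ≠ 0`, which is impossible
(`exists_wedge_curvature_psi_ne_zero`). For this to contradict the instanton condition there have to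
be coframes and transverse Levi-Civita connections. Coframes are built by extending two tangent
vectors to smooth vector fields, turning these into a unitary pair `u₁`, `u₂` by the Gram–Schmidt
process, and taking the covectors dual to `u₁` and `u₂` together with `e₃ + i Je₃ = Ω(·, u₁, u₂)`,
which has unit length by the normalization of the volume form
(`IsContactSU3.adapted`, `exists_coframe`). The connection is given by the Koszul formula
(`exists_isTransverseLeviCivita`); its entries in the row and the column of `η` vanish because the
Reeb flow preserves `ω` and `Ω`, hence the transverse metric (`reeb_coeff_skew`).
-/

noncomputable section

/-! ### Decomposable forms and the wedge product -/

section WedgeProd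

variable {V A : Type*} [AddCommGroup V] [Module ℝ V] [TopologicalSpace V]
  [NormedCommRing A] [NormedAlgebra ℝ A]

theorem update_vec_one {V : Type*} (v w : V) : Function.update ![v] 0 w = ![w] := by
  funext i
  fin_cases i
  rfl

/-- A 1-form as a linear map. -/
def oneFormLin (α : V [⋀^Fin 1]→L[ℝ] A) : V →ₗ[ℝ] A where
  toFun v := α ![v]
  map_add' v w := by
    have := α.map_update_add ![v] 0 v w
    rwa [update_vec_one, update_vec_one, update_vec_one] at this
  map_smul' c v := by
    have := α.map_update_smul ![v] 0 c v
    rwa [update_vec_one, update_vec_one] at this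

@[simp] theorem oneFormLin_apply (α : V [⋀^Fin 1]→L[ℝ] A) (v : V) : oneFormLin α v = α ![v] := rfl

theorem oneForm_smul (α : V [⋀^Fin 1]→L[ℝ] A) (c : ℝ) (v : V) : α ![c • v] = c • α ![v] :=
  (oneFormLin α).map_smul c v

theorem oneForm_ext {α β : V [⋀^Fin 1]→L[ℝ] A} (h : ∀ v, α ![v] = β ![v]) : α = β := by
  ext v
  have : v = ![v 0] := by funext i; fin_cases i; rfl
  rw [this]
  exact h _

theorem twoForm_ext {α β : V [⋀^Fin 2]→L[ℝ] A} (h : ∀ v w, α ![v, w] = β ![v, w]) : α = β := by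
  ext v
  have : v = ![v 0, v 1] := by funext i; fin_cases i <;> rfl
  rw [this]
  exact h _ _

theorem threeForm_ext {α β : V [⋀^Fin 3]→L[ℝ] A}
    (h : ∀ u v w, α ![u, v, w] = β ![u, v, w]) : α = β := by
  ext v
  have : v = ![v 0, v 1, v 2] := by funext i; fin_cases i <;> rfl
  rw [this]
  exact h _ _ _

theorem twoForm_add_left (α : V [⋀^Fin 2]→L[ℝ] A) (u v w : V) :
    α ![u + v, w] = α ![u, w] + α ![v, w] := by
  have := α.toMultilinearMap.cons_add ![w] u v
  exact this

theorem twoForm_smul_left (α : V [⋀^Fin 2]→L[ℝ] A) (c : ℝ) (v w : V) :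
    α ![c • v, w] = c • α ![v, w] := by
  have := α.toMultilinearMap.cons_smul ![w] c v
  exact this

theorem twoForm_swap (α : V [⋀^Fin 2]→L[ℝ] A) (v w : V) : α ![v, w] = -α ![w, v] := by
  have := α.toAlternatingMap.map_swap ![w, v] (i := 0) (j := 1) (by decide)
  rw [show (![w, v] ∘ ⇑(Equiv.swap (0 : Fin 2) 1)) = ![v, w] by
    funext i; fin_cases i <;> rfl] at this
  exact this

/-- A 2-form as a bilinear map. -/
def twoFormLin (α : V [⋀^Fin 2]→L[ℝ] A) : V →ₗ[ℝ] V →ₗ[ℝ] A :=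
  LinearMap.mk₂ ℝ (fun v w => α ![v, w]) (twoForm_add_left α) (twoForm_smul_left α)
    (fun u v w => by
      rw [twoForm_swap, twoForm_add_left, twoForm_swap α v, twoForm_swap α w]; abel)
    (fun c v w => by rw [twoForm_swap, twoForm_smul_left, twoForm_swap α w]; simp)

@[simp] theorem twoFormLin_apply (α : V [⋀^Fin 2]→L[ℝ] A) (v w : V) :
    twoFormLin α v w = α ![v, w] := rfl

/-- The decomposable form `α₁ ∧ … ∧ αₙ`, as an algebraic alternating map. -/
def wedgeProd {n : ℕ} (α : Fin n → V [⋀^Fin 1]→L[ℝ] A) : V [⋀^Fin n]→ₗ[ℝ] A :=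
  MultilinearMap.alternatization
    ((MultilinearMap.mkPiAlgebra ℝ (Fin n) A).compLinearMap fun i => oneFormLin (α i))

theorem wedgeProd_apply {n : ℕ} (α : Fin n → V [⋀^Fin 1]→L[ℝ] A) (v : Fin n → V) :
    wedgeProd α v = (Matrix.of fun i j => α i ![v j]).det := by
  rw [← Matrix.det_transpose, Matrix.det_apply]
  simp [wedgeProd, MultilinearMap.alternatization_apply, MultilinearMap.domDomCongr_apply]

/-- The decomposable form `α₁ ∧ … ∧ αₙ`. -/
def decomp {n : ℕ} (α : Fin n → V [⋀^Fin 1]→L[ℝ] A) : V [⋀^Fin n]→L[ℝ] A :=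
  { wedgeProd α with
    cont := by
      change Continuous (wedgeProd α : (Fin n → V) → A)
      rw [funext (wedgeProd_apply α)]
      refine Continuous.matrix_det (continuous_matrix fun i j => ?_)
      exact (α i).cont.comp (continuous_pi fun _ => by
        simpa using! continuous_apply j) }

theorem decomp_apply {n : ℕ} (α : Fin n → V [⋀^Fin 1]→L[ℝ] A) (v : Fin n → V) :
    decomp α v = (Matrix.of fun i j => α i ![v j]).det := wedgeProd_apply α v

/-- The wedge product of decomposable forms is decomposable: both sides are the alternatization of
the product of the `m + n` linear forms. -/
theorem wedge_decomp {m n : ℕ} (α : Fin m → V [⋀^Fin 1]→L[ℝ] A)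
    (β : Fin n → V [⋀^Fin 1]→L[ℝ] A) :
    wedge (decomp α) (decomp β) = decomp (Fin.append α β) := by
  ext v
  change wedgeAlg (decomp α) (decomp β) v = wedgeProd (Fin.append α β) v
  rw [wedgeAlg, show (decomp α).toAlternatingMap = wedgeProd α from rfl,
    show (decomp β).toAlternatingMap = wedgeProd β from rfl, wedgeProd, wedgeProd,
    ← MultilinearMap.domCoprod_alternization]
  simp only [AlternatingMap.domDomCongr_apply, LinearMap.compAlternatingMap_apply, wedgeProd,
    MultilinearMap.alternatization_apply, map_sum]
  refine (Fintype.sum_equiv finSumFinEquiv.permCongr.symm _ _ fun σ => ?_).symm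
  simp only [MultilinearMap.domDomCongr_apply]
  rw [show Equiv.Perm.sign (finSumFinEquiv.permCongr.symm σ) = Equiv.Perm.sign σ by simp]
  simp [MultilinearMap.domCoprod_apply, Fin.prod_univ_add, Equiv.permCongr_apply]

theorem oneForm_eq_decomp (α : V [⋀^Fin 1]→L[ℝ] A) : α = decomp ![α] := by
  refine oneForm_ext fun v => ?_
  rw [decomp_apply, Matrix.det_fin_one]
  rfl

theorem wedge_one_one (α β : V [⋀^Fin 1]→L[ℝ] A) : wedge α β = decomp ![α, β] := by
  conv_lhs => rw [oneForm_eq_decomp α, oneForm_eq_decomp β, wedge_decomp]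
  congr 1
  funext i
  fin_cases i <;> rfl

theorem wedge_one_one_one (α β γ : V [⋀^Fin 1]→L[ℝ] A) :
    wedge (wedge α β) γ = decomp ![α, β, γ] := by
  conv_lhs => rw [oneForm_eq_decomp γ, wedge_one_one, wedge_decomp]
  congr 1
  funext i
  fin_cases i <;> rfl

theorem wedge_one_one_apply (α β : V [⋀^Fin 1]→L[ℝ] A) (v w : V) :
    wedge α β ![v, w] = α ![v] * β ![w] - α ![w] * β ![v] := by
  rw [wedge_one_one]
  exact (decomp_apply ![α, β] ![v, w]).trans (Matrix.det_fin_two _)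

theorem wedge_one_one_one_apply (α β γ : V [⋀^Fin 1]→L[ℝ] A) (u v w : V) :
    wedge (wedge α β) γ ![u, v, w] =
      α ![u] * β ![v] * γ ![w] - α ![u] * β ![w] * γ ![v] - α ![v] * β ![u] * γ ![w]
        + α ![v] * β ![w] * γ ![u] + α ![w] * β ![u] * γ ![v] - α ![w] * β ![v] * γ ![u] := by
  rw [wedge_one_one_one]
  refine (decomp_apply ![α, β, γ] ![u, v, w]).trans ((Matrix.det_fin_three _).trans ?_)
  simp only [Matrix.of_apply, Matrix.cons_val]

theorem decomp_comp_swap {n : ℕ} (α : Fin n → V [⋀^Fin 1]→L[ℝ] A) {i j : Fin n} (h : i ≠ j) :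
    decomp (α ∘ Equiv.swap i j) = -decomp α := by
  ext v
  have := Matrix.det_permute (Equiv.swap i j) (Matrix.of fun i j => α i ![v j])
  rw [Equiv.Perm.sign_swap h] at this
  simp only [decomp_apply, ContinuousAlternatingMap.neg_apply]
  refine Eq.trans ?_ (this.trans (by simp))
  rfl

theorem decomp_eq_zero {n : ℕ} (α : Fin n → V [⋀^Fin 1]→L[ℝ] A) {i j : Fin n} (h : i ≠ j)
    (hij : α i = α j) : decomp α = 0 := by
  ext v
  rw [decomp_apply]
  refine Matrix.det_zero_of_row_eq h ?_
  funext k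
  simp [hij]

/-! #### Bilinearity and naturality of the wedge product -/

theorem wedge_add_left {m n : ℕ} (x x' : V [⋀^Fin m]→L[ℝ] A) (y : V [⋀^Fin n]→L[ℝ] A) :
    wedge (x + x') y = wedge x y + wedge x' y := by
  ext v
  change wedgeAlg (x + x') y v = wedgeAlg x y v + wedgeAlg x' y v
  simp only [wedgeAlg, ContinuousAlternatingMap.toAlternatingMap_add,
    ← AlternatingMap.domCoprod'_apply, TensorProduct.add_tmul, map_add]
  simp

theorem wedge_smul_left {m n : ℕ} (c : ℝ) (x : V [⋀^Fin m]→L[ℝ] A) (y : V [⋀^Fin n]→L[ℝ] A) :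
    wedge (c • x) y = c • wedge x y := by
  ext v
  change wedgeAlg (c • x) y v = c • wedgeAlg x y v
  simp only [wedgeAlg, ContinuousAlternatingMap.toAlternatingMap_smul,
    ← AlternatingMap.domCoprod'_apply, ← TensorProduct.smul_tmul', map_smul]
  simp

theorem wedge_add_right {m n : ℕ} (x : V [⋀^Fin m]→L[ℝ] A) (y y' : V [⋀^Fin n]→L[ℝ] A) :
    wedge x (y + y') = wedge x y + wedge x y' := by
  ext v
  change wedgeAlg x (y + y') v = wedgeAlg x y v + wedgeAlg x y' v
  simp only [wedgeAlg, ContinuousAlternatingMap.toAlternatingMap_add,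
    ← AlternatingMap.domCoprod'_apply, TensorProduct.tmul_add, map_add]
  simp

theorem wedge_smul_right {m n : ℕ} (c : ℝ) (x : V [⋀^Fin m]→L[ℝ] A) (y : V [⋀^Fin n]→L[ℝ] A) :
    wedge x (c • y) = c • wedge x y := by
  ext v
  change wedgeAlg x (c • y) v = c • wedgeAlg x y v
  simp only [wedgeAlg, ContinuousAlternatingMap.toAlternatingMap_smul,
    ← AlternatingMap.domCoprod'_apply, TensorProduct.tmul_smul, map_smul]
  simp

/-- The wedge product as a bilinear map. -/
def wedgeBilin (V A : Type*) [AddCommGroup V] [Module ℝ V] [TopologicalSpace V]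
    [NormedCommRing A] [NormedAlgebra ℝ A] (m n : ℕ) :
    V [⋀^Fin m]→L[ℝ] A →ₗ[ℝ] V [⋀^Fin n]→L[ℝ] A →ₗ[ℝ] V [⋀^Fin (m + n)]→L[ℝ] A :=
  LinearMap.mk₂ ℝ wedge wedge_add_left wedge_smul_left wedge_add_right wedge_smul_right

theorem wedgeBilin_apply {m n : ℕ} (x : V [⋀^Fin m]→L[ℝ] A) (y : V [⋀^Fin n]→L[ℝ] A) :
    wedgeBilin V A m n x y = wedge x y := rfl

theorem wedge_compContinuousLinearMap {W : Type*} [AddCommGroup W] [Module ℝ W]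
    [TopologicalSpace W] {m n : ℕ} (x : V [⋀^Fin m]→L[ℝ] A) (y : V [⋀^Fin n]→L[ℝ] A)
    (f : W →L[ℝ] V) : (wedge x y).compContinuousLinearMap f =
      wedge (x.compContinuousLinearMap f) (y.compContinuousLinearMap f) := by
  ext v
  change wedgeAlg x y (f ∘ v) = wedgeAlg (x.compContinuousLinearMap f)
    (y.compContinuousLinearMap f) v
  simp only [wedgeAlg, AlternatingMap.domDomCongr_apply, LinearMap.compAlternatingMap_apply,
    AlternatingMap.domCoprod_apply, sum_apply, map_sum]
  refine Finset.sum_congr rfl fun σ _ => ?_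
  induction σ using Quotient.inductionOn' with
  | h σ =>
    rw [AlternatingMap.domCoprod.summand_mk'', AlternatingMap.domCoprod.summand_mk'']
    rfl

end WedgeProd

/-! ### Monomials in a coframe -/

section Monomials

variable {V A : Type*} [AddCommGroup V] [Module ℝ V] [TopologicalSpace V]
  [NormedCommRing A] [NormedAlgebra ℝ A]

/-- The monomial `E_{t 0} ∧ … ∧ E_{t (n-1)}` in a family `E₀, …, E₆` of 1-forms. -/
def mono {n : ℕ} (E : Fin 7 → V [⋀^Fin 1]→L[ℝ] A) (t : Fin n → Fin 7) : V [⋀^Fin n]→L[ℝ] A :=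
  decomp fun i => E (t i)

variable (E : Fin 7 → V [⋀^Fin 1]→L[ℝ] A)

theorem mono_swap {n : ℕ} {t s : Fin n → Fin 7} (i j : Fin n) (h : i ≠ j)
    (hts : t = s ∘ Equiv.swap i j) : mono E t = -mono E s := by
  subst hts
  exact decomp_comp_swap (fun i => E (s i)) h

theorem mono_eq_zero {n : ℕ} {t : Fin n → Fin 7} (i j : Fin n) (h : i ≠ j) (hij : t i = t j) :
    mono E t = 0 :=
  decomp_eq_zero _ h (by simp only [hij])

theorem wedge_mono {m n : ℕ} (t : Fin m → Fin 7) (s : Fin n → Fin 7) :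
    wedge (mono E t) (mono E s) = mono E (Fin.append t s) := by
  rw [mono, mono, wedge_decomp]
  refine congrArg decomp (funext fun i => ?_)
  refine Fin.addCases (fun i => ?_) (fun i => ?_) i <;> simp

theorem wedge_mono_one (a b : Fin 7) :
    wedge (E a) (E b) = (mono E ![a, b] : V [⋀^Fin 2]→L[ℝ] A) := by
  rw [wedge_one_one]
  refine congrArg decomp ?_
  funext i
  fin_cases i <;> rfl

theorem wedge_mono_two_one (a b c : Fin 7) :
    wedge (mono E ![a, b]) (E c) = (mono E ![a, b, c] : V [⋀^Fin 3]→L[ℝ] A) := by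
  rw [← wedge_mono_one, wedge_one_one_one]
  refine congrArg decomp ?_
  funext i
  fin_cases i <;> rfl

theorem wedge_mono_two_two (a b c d : Fin 7) :
    wedge (mono E ![a, b]) (mono E ![c, d]) =
      (mono E ![a, b, c, d] : V [⋀^Fin 4]→L[ℝ] A) :=
  (wedge_mono E _ _).trans (congrArg (mono E) (by funext i; fin_cases i <;> rfl))

theorem wedge_mono_one_three (a b c d : Fin 7) :
    wedge (mono E ![a]) (mono E ![b, c, d]) =
      (mono E ![a, b, c, d] : V [⋀^Fin 4]→L[ℝ] A) :=
  (wedge_mono E _ _).trans (congrArg (mono E) (by funext i; fin_cases i <;> rfl))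

theorem wedge_mono_one_four (a b c d e : Fin 7) :
    wedge (mono E ![a]) (mono E ![b, c, d, e]) =
      (mono E ![a, b, c, d, e] : V [⋀^Fin 5]→L[ℝ] A) :=
  (wedge_mono E _ _).trans (congrArg (mono E) (by funext i; fin_cases i <;> rfl))

theorem wedge_mono_two_four (a b c d e f : Fin 7) :
    wedge (mono E ![a, b]) (mono E ![c, d, e, f]) =
      (mono E ![a, b, c, d, e, f] : V [⋀^Fin 6]→L[ℝ] A) :=
  (wedge_mono E _ _).trans (congrArg (mono E) (by funext i; fin_cases i <;> rfl))

theorem wedge_mono_four_two (a b c d e f : Fin 7) :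
    wedge (mono E ![a, b, c, d]) (mono E ![e, f]) =
      (mono E ![a, b, c, d, e, f] : V [⋀^Fin 6]→L[ℝ] A) :=
  (wedge_mono E _ _).trans (congrArg (mono E) (by funext i; fin_cases i <;> rfl))

theorem wedge_mono_three_three (a b c d e f : Fin 7) :
    wedge (mono E ![a, b, c]) (mono E ![d, e, f]) =
      (mono E ![a, b, c, d, e, f] : V [⋀^Fin 6]→L[ℝ] A) :=
  (wedge_mono E _ _).trans (congrArg (mono E) (by funext i; fin_cases i <;> rfl))

theorem wedge_mono_five_one (a b c d e f : Fin 7) :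
    wedge (mono E ![a, b, c, d, e]) (mono E ![f]) =
      (mono E ![a, b, c, d, e, f] : V [⋀^Fin 6]→L[ℝ] A) :=
  (wedge_mono E _ _).trans (congrArg (mono E) (by funext i; fin_cases i <;> rfl))

theorem wedge_mono_one_four_one (a b c d e f : Fin 7) :
    wedge (wedge (E a) (mono E ![b, c, d, e])) (E f) =
      (mono E ![a, b, c, d, e, f] : V [⋀^Fin 6]→L[ℝ] A) := by
  have h : ∀ a, E a = mono E ![a] := fun a => oneForm_eq_decomp _
  rw [h a, h f, wedge_mono_one_four, wedge_mono_five_one]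

/-- Transpositions are stated with a hypothesis on the order of the two indices, so that `simp`
uses them to sort the indices of a monomial. -/
theorem mono_four_swap01 {a b : Fin 7} (c d : Fin 7) (_ : b < a) :
    mono E ![a, b, c, d] = -mono E ![b, a, c, d] :=
  mono_swap E 0 1 (by decide) (by funext i; fin_cases i <;> rfl)
theorem mono_four_swap12 (a : Fin 7) {b c : Fin 7} (d : Fin 7) (_ : c < b) :
    mono E ![a, b, c, d] = -mono E ![a, c, b, d] :=
  mono_swap E 1 2 (by decide) (by funext i; fin_cases i <;> rfl)
theorem mono_four_swap23 (a b : Fin 7) {c d : Fin 7} (_ : d < c) :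
    mono E ![a, b, c, d] = -mono E ![a, b, d, c] :=
  mono_swap E 2 3 (by decide) (by funext i; fin_cases i <;> rfl)
theorem mono_four_eq01 (a c d : Fin 7) : mono E ![a, a, c, d] = 0 :=
  mono_eq_zero E 0 1 (by decide) rfl
theorem mono_six_swap01 {a b : Fin 7} (c d e f : Fin 7) (_ : b < a) :
    mono E ![a, b, c, d, e, f] = -mono E ![b, a, c, d, e, f] :=
  mono_swap E 0 1 (by decide) (by funext i; fin_cases i <;> rfl)
theorem mono_six_swap12 (a : Fin 7) {b c : Fin 7} (d e f : Fin 7) (_ : c < b) :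
    mono E ![a, b, c, d, e, f] = -mono E ![a, c, b, d, e, f] :=
  mono_swap E 1 2 (by decide) (by funext i; fin_cases i <;> rfl)
theorem mono_six_swap23 (a b : Fin 7) {c d : Fin 7} (e f : Fin 7) (_ : d < c) :
    mono E ![a, b, c, d, e, f] = -mono E ![a, b, d, c, e, f] :=
  mono_swap E 2 3 (by decide) (by funext i; fin_cases i <;> rfl)
theorem mono_six_swap34 (a b c : Fin 7) {d e : Fin 7} (f : Fin 7) (_ : e < d) :
    mono E ![a, b, c, d, e, f] = -mono E ![a, b, c, e, d, f] :=
  mono_swap E 3 4 (by decide) (by funext i; fin_cases i <;> rfl)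
theorem mono_six_swap45 (a b c d : Fin 7) {e f : Fin 7} (_ : f < e) :
    mono E ![a, b, c, d, e, f] = -mono E ![a, b, c, d, f, e] :=
  mono_swap E 4 5 (by decide) (by funext i; fin_cases i <;> rfl)
theorem mono_six_eq01 (a c d e f : Fin 7) : mono E ![a, a, c, d, e, f] = 0 :=
  mono_eq_zero E 0 1 (by decide) rfl
theorem mono_six_eq12 (a b d e f : Fin 7) : mono E ![a, b, b, d, e, f] = 0 :=
  mono_eq_zero E 1 2 (by decide) rfl
theorem mono_six_eq23 (a b c e f : Fin 7) : mono E ![a, b, c, c, e, f] = 0 :=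
  mono_eq_zero E 2 3 (by decide) rfl
theorem mono_six_eq34 (a b c d f : Fin 7) : mono E ![a, b, c, d, d, f] = 0 :=
  mono_eq_zero E 3 4 (by decide) rfl
theorem mono_six_eq45 (a b c d e : Fin 7) : mono E ![a, b, c, d, e, e] = 0 :=
  mono_eq_zero E 4 5 (by decide) rfl

end Monomials

/-! ### The constant-coefficient forms of `SU(3)`-geometry in dimension seven -/

section ModelForms

variable {V : Type*} [AddCommGroup V] [Module ℝ V] [TopologicalSpace V]
variable (E : Fin 7 → V [⋀^Fin 1]→L[ℝ] ℝ)

/-- The 2-form `∑ Eᵢ ∧ E_{i+3}`. -/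
def omegaOf : V [⋀^Fin 2]→L[ℝ] ℝ := mono E ![1, 4] + mono E ![2, 5] + mono E ![3, 6]

/-- The real part of `(E₁ + i E₄) ∧ (E₂ + i E₅) ∧ (E₃ + i E₆)`. -/
def reOmegaOf : V [⋀^Fin 3]→L[ℝ] ℝ :=
  mono E ![1, 2, 3] - mono E ![1, 5, 6] - mono E ![4, 2, 6] - mono E ![4, 5, 3]

/-- The imaginary part of `(E₁ + i E₄) ∧ (E₂ + i E₅) ∧ (E₃ + i E₆)`. -/
def imOmegaOf : V [⋀^Fin 3]→L[ℝ] ℝ :=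
  mono E ![1, 2, 6] + mono E ![1, 5, 3] + mono E ![4, 2, 3] - mono E ![4, 5, 6]

/-- The real and imaginary parts of a product of three complex numbers. -/
theorem ofReal_add_I_mul_mul_mul (a₁ b₁ a₂ b₂ a₃ b₃ : ℝ) : ((a₁ : ℂ) + Complex.I * b₁) *
    (((a₂ : ℂ) + Complex.I * b₂) * ((a₃ : ℂ) + Complex.I * b₃)) =
    ((a₁ * (a₂ * a₃) - a₁ * (b₂ * b₃) - b₁ * (a₂ * b₃) - b₁ * (b₂ * a₃) : ℝ) : ℂ) + Complex.I *
    ((a₁ * (a₂ * b₃) + a₁ * (b₂ * a₃) + b₁ * (a₂ * a₃) - b₁ * (b₂ * b₃) : ℝ) : ℂ) := by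
  push_cast
  linear_combination (a₁ * b₂ * b₃ + b₁ * a₂ * b₃ + b₁ * b₂ * a₃
    + Complex.I * b₁ * b₂ * b₃ : ℂ) * Complex.I_mul_I

/-- The value of `f ∧ g ∧ h` on three vectors, for complex-valued functionals `f`, `g`, `h`. -/
def altThree (f g h : V → ℂ) (X Y Z : V) : ℂ :=
  f X * g Y * h Z - f X * g Z * h Y - f Y * g X * h Z + f Y * g Z * h X + f Z * g X * h Y
    - f Z * g Y * h X

/-- `(E₁ + i E₄) ∧ (E₂ + i E₅) ∧ (E₃ + i E₆)` evaluated on three vectors. -/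
theorem reOmegaOf_add_imOmegaOf_apply (E : Fin 7 → V [⋀^Fin 1]→L[ℝ] ℝ) (X Y Z : V) :
    (reOmegaOf E ![X, Y, Z] : ℂ) + Complex.I * imOmegaOf E ![X, Y, Z] =
      altThree (fun X => E 1 ![X] + Complex.I * E 4 ![X]) (fun X => E 2 ![X] + Complex.I * E 5 ![X])
        (fun X => E 3 ![X] + Complex.I * E 6 ![X]) X Y Z := by
  have hm : ∀ a b c, mono E ![a, b, c] ![X, Y, Z] =
      E a ![X] * E b ![Y] * E c ![Z] - E a ![X] * E b ![Z] * E c ![Y]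
      - E a ![Y] * E b ![X] * E c ![Z] + E a ![Y] * E b ![Z] * E c ![X]
      + E a ![Z] * E b ![X] * E c ![Y] - E a ![Z] * E b ![Y] * E c ![X] := fun a b c => by
    rw [← wedge_mono_two_one, ← wedge_mono_one]
    exact wedge_one_one_one_apply _ _ _ X Y Z
  simp only [reOmegaOf, imOmegaOf, ContinuousAlternatingMap.sub_apply,
    ContinuousAlternatingMap.add_apply, hm, altThree]
  simp only [mul_assoc, ofReal_add_I_mul_mul_mul]
  push_cast
  ring

/-- The 4-form `½ ω² - E₀ ∧ Im Ω`. -/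
def psiOf : V [⋀^Fin 4]→L[ℝ] ℝ :=
  (1 / 2 : ℝ) • (wedge (omegaOf E) (omegaOf E) : V [⋀^Fin 4]→L[ℝ] ℝ) -
    (wedge (E 0) (imOmegaOf E) : V [⋀^Fin 4]→L[ℝ] ℝ)

/-- The basis `ω³/6`, `E₀ ∧ ω²/2 ∧ E_c` of the 6-forms in which `R ∧ ψ` is expressed. -/
def sixFormOf (c : Fin 7) : V [⋀^Fin 6]→L[ℝ] ℝ :=
  if c = 0 then
    (1 / 6 : ℝ) • (wedge (wedge (omegaOf E) (omegaOf E)) (omegaOf E) : V [⋀^Fin 6]→L[ℝ] ℝ)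
  else wedge (wedge (E 0) ((1 / 2 : ℝ) • (wedge (omegaOf E) (omegaOf E) : V [⋀^Fin 4]→L[ℝ] ℝ)))
    (E c)

theorem half_omegaOf_sq :
    (1 / 2 : ℝ) • (wedge (omegaOf E) (omegaOf E) : V [⋀^Fin 4]→L[ℝ] ℝ) =
      mono E ![1, 4, 2, 5] + mono E ![1, 4, 3, 6] + mono E ![2, 5, 3, 6] := by
  have : (wedge (omegaOf E) (omegaOf E) : V [⋀^Fin 4]→L[ℝ] ℝ) =
      (2 : ℝ) • (mono E ![1, 4, 2, 5] + mono E ![1, 4, 3, 6] + mono E ![2, 5, 3, 6]) := by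
    simp only [omegaOf, wedge_add_left, wedge_add_right]
    simp only [wedge_mono_two_two]
    simp only [mono_four_swap01, mono_four_swap12, mono_four_swap23, mono_four_eq01,
      Fin.reduceLT, neg_zero, neg_neg]
    module
  rw [this]
  module

theorem wedge_one_mono_three (a b c d : Fin 7) :
    wedge (E a) (mono E ![b, c, d]) = (mono E ![a, b, c, d] : V [⋀^Fin 4]→L[ℝ] ℝ) := by
  rw [← wedge_mono_one_three]
  exact congrArg (fun x => wedge x _) (oneForm_eq_decomp (E a))

theorem psiOf_eq : psiOf E =
    mono E ![1, 4, 2, 5] + mono E ![1, 4, 3, 6] + mono E ![2, 5, 3, 6]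
    - (mono E ![0, 1, 2, 6] + mono E ![0, 1, 5, 3] + mono E ![0, 4, 2, 3]
      - mono E ![0, 4, 5, 6]) := by
  rw [psiOf, half_omegaOf_sq]
  congr 1
  simp only [imOmegaOf, ← wedgeBilin_apply, map_add, map_sub]
  simp only [wedgeBilin_apply, wedge_one_mono_three]

/-- The first indices of the three pairs `(a, b)` with `E_a ∧ E_b ∧ ψ` equal to the 6-form
number `c`. -/
def pairFst : Fin 7 → Fin 3 → Fin 7 :=
  ![![1, 2, 3], ![0, 3, 6], ![0, 1, 4], ![0, 2, 5], ![0, 3, 5], ![0, 1, 6], ![0, 2, 4]]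

/-- The second indices of the pairs whose first indices are listed by `pairFst`. -/
def pairSnd : Fin 7 → Fin 3 → Fin 7 :=
  ![![4, 5, 6], ![1, 5, 2], ![2, 6, 3], ![3, 4, 1], ![4, 2, 6], ![5, 3, 4], ![6, 1, 5]]

theorem sixFormOf_zero : sixFormOf E 0 = mono E ![1, 4, 2, 5, 3, 6] := by
  have h : (wedge (omegaOf E) (omegaOf E) : V [⋀^Fin 4]→L[ℝ] ℝ) =
      (2 : ℝ) • (1 / 2 : ℝ) • (wedge (omegaOf E) (omegaOf E) : V [⋀^Fin 4]→L[ℝ] ℝ) := by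
    rw [smul_smul]; norm_num
  have : (wedge (wedge (omegaOf E) (omegaOf E)) (omegaOf E) : V [⋀^Fin 6]→L[ℝ] ℝ) =
      (6 : ℝ) • mono E ![1, 4, 2, 5, 3, 6] := by
    rw [h, half_omegaOf_sq]
    simp only [omegaOf, wedge_add_left, wedge_smul_left, wedge_add_right]
    simp only [wedge_mono_four_two]
    simp only [mono_six_swap01, mono_six_swap12, mono_six_swap23, mono_six_swap34, mono_six_swap45,
      mono_six_eq01, mono_six_eq12, Fin.reduceLT,
      neg_zero, neg_neg]
    module
  rw [sixFormOf, if_pos rfl, this]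
  module

theorem sixFormOf_of_ne {c : Fin 7} (hc : c ≠ 0) : sixFormOf E c =
    mono E ![0, 1, 4, 2, 5, c] + mono E ![0, 1, 4, 3, 6, c] + mono E ![0, 2, 5, 3, 6, c] := by
  rw [sixFormOf, if_neg hc, half_omegaOf_sq]
  simp only [wedge_add_left, wedge_add_right, wedge_mono_one_four_one]

theorem sixFormOf_eq_ite (c : Fin 7) : sixFormOf E c =
    if c = 0 then mono E ![1, 4, 2, 5, 3, 6]
    else mono E ![0, 1, 4, 2, 5, c] + mono E ![0, 1, 4, 3, 6, c] + mono E ![0, 2, 5, 3, 6, c] := by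
  split_ifs with h
  · rw [h, sixFormOf_zero]
  · exact sixFormOf_of_ne E h

set_option maxHeartbeats 2000000 in
/-- Each of the 21 monomials of degree 2 wedges with `ψ` to a single basis element. -/
theorem wedge_mono_psiOf (c : Fin 7) (k : Fin 3) :
    wedge (mono E ![pairFst c k, pairSnd c k]) (psiOf E) = sixFormOf E c := by
  rw [psiOf_eq]
  simp only [← wedgeBilin_apply, map_add, map_sub]
  simp only [wedgeBilin_apply, wedge_mono_two_four, sixFormOf_eq_ite]
  fin_cases c <;> fin_cases k <;>
    simp only [pairFst, pairSnd, Fin.zero_eta, Fin.mk_one, Fin.reduceFinMk, Matrix.cons_val,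
      Fin.reduceEq, Fin.reduceLT, ↓reduceIte, mono_six_swap01, mono_six_swap12, mono_six_swap23,
      mono_six_swap34, mono_six_swap45, mono_six_eq01, mono_six_eq12, mono_six_eq23,
      mono_six_eq34, mono_six_eq45, neg_neg, neg_zero, add_zero, zero_add, sub_zero, zero_sub,
      sub_self, sub_neg_eq_add]

/-- `Re Ω ∧ Im Ω = 4 ω³/6`. -/
theorem wedge_reOmegaOf_imOmegaOf :
    (wedge (reOmegaOf E) (imOmegaOf E) : V [⋀^Fin 6]→L[ℝ] ℝ) = (4 : ℝ) • sixFormOf E 0 := by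
  rw [sixFormOf_zero]
  simp only [reOmegaOf, imOmegaOf, ← wedgeBilin_apply, map_add, map_sub, LinearMap.sub_apply]
  simp only [wedgeBilin_apply, wedge_mono_three_three]
  simp only [mono_six_swap01, mono_six_swap12, mono_six_swap23, mono_six_swap34, mono_six_swap45,
      mono_six_eq01, mono_six_eq12, mono_six_eq23, Fin.reduceLT,
      neg_zero, neg_neg]
  module

end ModelForms

/-! ### Integer structure tensors -/

section Tensors

/-- The integer vector `± δ_c` encoded by `s = ± (c + 1)`; `s = 0` encodes the zero vector. -/
def signedUnit (s : ℤ) (c : Fin 7) : ℤ :=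
  if s = (c.val : ℤ) + 1 then 1 else if s = -((c.val : ℤ) + 1) then -1 else 0

/-- The entries of the matrix `B`, each coded as a signed index. -/
def codeB : Matrix (Fin 7) (Fin 7) ℤ :=
  !![0, 5, 6, 7, -2, -3, -4;
    -5, 0, 0, 0, -1, 0, 0;
    -6, 0, 0, 0, 0, -1, 0;
    -7, 0, 0, 0, 0, 0, -1;
    2, 1, 0, 0, 0, 0, 0;
    3, 0, 1, 0, 0, 0, 0;
    4, 0, 0, 1, 0, 0, 0]

/-- The components of the matrix `B`. -/
def tensorB (i j : Fin 7) : Fin 7 → ℤ := signedUnit (codeB i j)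

/-- The entries of the matrix `C`, each coded as a signed index. -/
def codeC : Matrix (Fin 7) (Fin 7) ℤ :=
  !![0, 5, 6, 7, -2, -3, -4;
    -5, 0, -4, 3, 1, 7, -6;
    -6, 4, 0, -2, -7, 1, 5;
    -7, -3, 2, 0, 6, -5, 1;
    2, -1, 7, -6, 0, 4, -3;
    3, -7, -1, 5, -4, 0, 2;
    4, 6, -5, -1, 3, -2, 0]

/-- The components of the matrix `C`. -/
def tensorC (i j : Fin 7) : Fin 7 → ℤ := signedUnit (codeC i j)

/-- The entries of the matrix with blocks `[Je]`, `[e]`, `[e]`, `-[Je]`, each coded as a signed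
index. -/
def codeBox : Matrix (Fin 7) (Fin 7) ℤ :=
  !![0, 0, 0, 0, 0, 0, 0;
    0, 0, 7, -6, 0, 4, -3;
    0, -7, 0, 5, -4, 0, 2;
    0, 6, -5, 0, 3, -2, 0;
    0, 0, 4, -3, 0, -7, 6;
    0, -4, 0, 2, 7, 0, -5;
    0, 3, -2, 0, -6, 5, 0]

/-- The components of the matrix with blocks `[Je]`, `[e]`, `[e]`, `-[Je]`. -/
def tensorBox (i j : Fin 7) : Fin 7 → ℤ := signedUnit (codeBox i j)

/-- The entries of the matrix with first row `(0, eᵀ, Jeᵀ)`, first column the negative of its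
transpose, and zero elsewhere, each coded as a signed index. -/
def codeRow : Matrix (Fin 7) (Fin 7) ℤ :=
  !![0, 2, 3, 4, 5, 6, 7;
    -2, 0, 0, 0, 0, 0, 0;
    -3, 0, 0, 0, 0, 0, 0;
    -4, 0, 0, 0, 0, 0, 0;
    -5, 0, 0, 0, 0, 0, 0;
    -6, 0, 0, 0, 0, 0, 0;
    -7, 0, 0, 0, 0, 0, 0]

/-- The components of the matrix with first row `(0, eᵀ, Jeᵀ)`, first column the negative of its
transpose, and zero elsewhere. -/
def tensorRow (i j : Fin 7) : Fin 7 → ℤ := signedUnit (codeRow i j)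

/-- The entries of the matrix `𝓘`, placed at the index `0`, each coded as a signed index. -/
def codeI : Matrix (Fin 7) (Fin 7) ℤ :=
  !![0, 0, 0, 0, 0, 0, 0;
    0, 0, 0, 0, -1, 0, 0;
    0, 0, 0, 0, 0, -1, 0;
    0, 0, 0, 0, 0, 0, -1;
    0, 1, 0, 0, 0, 0, 0;
    0, 0, 1, 0, 0, 0, 0;
    0, 0, 0, 1, 0, 0, 0]

/-- The components of the matrix `𝓘`, placed at the index `0`. -/
def tensorI (i j : Fin 7) : Fin 7 → ℤ := signedUnit (codeI i j)

/-- The general element of `𝔰𝔲(3) ⊂ 𝔰𝔬(7)`. -/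
def su3Matrix {R : Type*} [Ring R] (g : Fin 8 → R) : Matrix (Fin 7) (Fin 7) R :=
  !![0, 0, 0, 0, 0, 0, 0;
     0, 0, g 0, g 1, -g 3, -g 4, -g 5;
     0, -g 0, 0, g 2, -g 4, -g 6, -g 7;
     0, -g 1, -g 2, 0, -g 5, -g 7, g 3 + g 6;
     0, g 3, g 4, g 5, 0, g 0, g 1;
     0, g 4, g 6, g 7, -g 0, 0, g 2;
     0, g 5, g 7, -g 3 - g 6, -g 1, -g 2, 0]

/-- The basis of `𝔰𝔲(3)` used in `su3Matrix`. -/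
def su3Basis (m : Fin 8) (i j : Fin 7) : ℤ := su3Matrix (fun n => if n = m then (1 : ℤ) else 0) i j

/-- The tensor `B` is invariant under `𝔰𝔲(3)`. -/
theorem tensorB_su3 : ∀ (m : Fin 8) (i j d : Fin 7),
    ∑ l, (su3Basis m i l * tensorB l j d + su3Basis m j l * tensorB i l d
      + su3Basis m d l * tensorB i j l) = 0 := by
  decide +kernel

/-- The tensor `C` is invariant under `𝔰𝔲(3)`. -/
theorem tensorC_su3 : ∀ (m : Fin 8) (i j d : Fin 7),
    ∑ l, (su3Basis m i l * tensorC l j d + su3Basis m j l * tensorC i l d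
      + su3Basis m d l * tensorC i j l) = 0 := by
  decide +kernel

/-- The coefficient of the 6-form number `c` in `(X ∧ Y)_{ij} ∧ ψ`, for matrices of 1-forms with
constant components `X` and `Y`. -/
def contraction {R : Type*} [Ring R] (X Y : Fin 7 → Fin 7 → Fin 7 → R) (i j c : Fin 7) : R :=
  ∑ k, ∑ l, (X i l (pairFst c k) * Y l j (pairSnd c k) - X i l (pairSnd c k) * Y l j (pairFst c k))

theorem contraction_BB : ∀ i j c : Fin 7, contraction tensorB tensorB i j c =
    tensorI i j c + tensorRow i j c - tensorBox i j c := by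
  decide +kernel

theorem contraction_BC : ∀ i j c : Fin 7,
    contraction tensorB tensorC i j c + contraction tensorC tensorB i j c =
    2 * tensorI i j c - 4 * tensorRow i j c - 4 * tensorBox i j c := by
  decide +kernel

theorem contraction_CC : ∀ i j c : Fin 7, contraction tensorC tensorC i j c =
    -3 * tensorI i j c - 5 * tensorRow i j c + tensorBox i j c := by
  decide +kernel

theorem contraction_tensor (δ : ℝ) (i j c : Fin 7) :
    contraction (fun i j c => (tensorB i j c : ℝ) + δ * tensorC i j c)
      (fun i j c => (tensorB i j c : ℝ) + δ * tensorC i j c) i j c =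
    (1 - δ) * (1 + 3 * δ) * tensorI i j c + (1 - 5 * δ) * (1 + δ) * tensorRow i j c +
      (δ ^ 2 - 4 * δ - 1) * tensorBox i j c := by
  have hB : ((contraction tensorB tensorB i j c : ℤ) : ℝ) = _ :=
    congrArg (Int.cast : ℤ → ℝ) (contraction_BB i j c)
  have hBC := congrArg (Int.cast : ℤ → ℝ) (contraction_BC i j c)
  have hC := congrArg (Int.cast : ℤ → ℝ) (contraction_CC i j c)
  have key : contraction (fun i j c => (tensorB i j c : ℝ) + δ * tensorC i j c)
      (fun i j c => (tensorB i j c : ℝ) + δ * tensorC i j c) i j c =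
      ((contraction tensorB tensorB i j c : ℤ) : ℝ) +
      δ * ((contraction tensorB tensorC i j c + contraction tensorC tensorB i j c : ℤ) : ℝ) +
      δ ^ 2 * ((contraction tensorC tensorC i j c : ℤ) : ℝ) := by
    simp only [contraction, Int.cast_add, Int.cast_sum, Int.cast_sub, Int.cast_mul,
      Finset.mul_sum, ← Finset.sum_add_distrib]
    refine Finset.sum_congr rfl fun k _ => Finset.sum_congr rfl fun l _ => ?_
    ring
  rw [key, hB, hBC, hC]
  push_cast
  ring

/-- A `7 × 7` matrix in `𝔰𝔲(3)`, acting trivially on the index `0`: the last condition says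
that its contraction with `ω` and with `Ω` vanish. -/
structure IsSU3 (a : Fin 7 → Fin 7 → ℝ) : Prop where
  skew : ∀ i j, a j i = -a i j
  zero : ∀ j, a 0 j = 0
  contract : ∀ c, ∑ k, a (pairFst c k) (pairSnd c k) = 0

namespace IsSU3

variable {a b : Fin 7 → Fin 7 → ℝ}

theorem eq_su3Matrix (h : IsSU3 a) (i j : Fin 7) :
    a i j = su3Matrix ![a 1 2, a 1 3, a 2 3, a 4 1, a 4 2, a 4 3, a 5 2, a 5 3] i j := by
  have h0 := h.contract 0
  have h1 := h.contract 1
  have h2 := h.contract 2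
  have h3 := h.contract 3
  have h4 := h.contract 4
  have h5 := h.contract 5
  have h6 := h.contract 6
  have hz := h.zero
  have hs := h.skew
  have hd : ∀ i, a i i = 0 := fun i => by linarith [hs i i]
  simp only [Fin.sum_univ_three, pairFst, pairSnd, Matrix.cons_val, hz] at h0 h1 h2 h3 h4 h5 h6
  fin_cases i <;> fin_cases j <;>
    simp only [Fin.zero_eta, Fin.mk_one, Fin.reduceFinMk, su3Matrix, Matrix.of_apply,
      Matrix.cons_val, hz, hd] <;>
    linarith only [hz 1, hz 2, hz 3, hz 4, hz 5, hz 6, hs 0 1, hs 0 2, hs 0 3, hs 0 4, hs 0 5,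
      hs 0 6, hs 1 2, hs 1 3, hs 1 4, hs 1 5, hs 1 6, hs 2 3, hs 2 4, hs 2 5, hs 2 6, hs 3 4,
      hs 3 5, hs 3 6, hs 4 5, hs 4 6, hs 5 6, h0, h1, h2, h3, h4, h5, h6]

theorem eq_sum_su3Basis (h : IsSU3 a) (i j : Fin 7) : a i j = ∑ m, (su3Basis m i j : ℝ) *
    ![a 1 2, a 1 3, a 2 3, a 4 1, a 4 2, a 4 3, a 5 2, a 5 3] m := by
  rw [h.eq_su3Matrix i j]
  generalize ![a 1 2, a 1 3, a 2 3, a 4 1, a 4 2, a 4 3, a 5 2, a 5 3] = g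
  rw [Fin.sum_univ_eight]
  fin_cases i <;> fin_cases j <;>
    simp only [Fin.zero_eta, Fin.mk_one, Fin.reduceFinMk, su3Basis, su3Matrix, Matrix.of_apply,
      Matrix.cons_val, Fin.reduceEq, ↓reduceIte] <;>
    norm_num
  ring

theorem sum_tensor (h : IsSU3 a) {T : Fin 7 → Fin 7 → Fin 7 → ℤ}
    (hT : ∀ (m : Fin 8) (i j d : Fin 7),
      ∑ l, (su3Basis m i l * T l j d + su3Basis m j l * T i l d + su3Basis m d l * T i j l) = 0)
    (i j d : Fin 7) :
    ∑ l, (a i l * T l j d + a j l * T i l d + a d l * T i j l) = 0 := by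
  set g := ![a 1 2, a 1 3, a 2 3, a 4 1, a 4 2, a 4 3, a 5 2, a 5 3] with hg
  have e : ∀ i j, a i j = ∑ m, (su3Basis m i j : ℝ) * g m := h.eq_sum_su3Basis
  have key : ∑ l, (a i l * T l j d + a j l * T i l d + a d l * T i j l) =
      ∑ m, g m * ((∑ l, (su3Basis m i l * T l j d + su3Basis m j l * T i l d
        + su3Basis m d l * T i j l) : ℤ) : ℝ) := by
    simp only [e, Int.cast_sum, Finset.mul_sum, Finset.sum_mul]
    rw [Finset.sum_comm]
    refine Finset.sum_congr rfl fun l _ => ?_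
    simp only [← Finset.sum_add_distrib]
    refine Finset.sum_congr rfl fun m _ => ?_
    push_cast
    ring
  rw [key]
  simp [hT]

/-- `𝔰𝔲(3)` is closed under commutators. -/
theorem commutator (ha : IsSU3 a) (hb : IsSU3 b) (c : Fin 7) :
    ∑ k, ∑ l, (a (pairFst c k) l * b l (pairSnd c k) -
      b (pairFst c k) l * a l (pairSnd c k)) = 0 := by
  obtain ⟨g, rfl⟩ : ∃ g : Fin 8 → ℝ, a = fun i j => su3Matrix g i j :=
    ⟨_, funext fun i => funext fun j => ha.eq_su3Matrix i j⟩
  obtain ⟨g', rfl⟩ : ∃ g : Fin 8 → ℝ, b = fun i j => su3Matrix g i j :=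
    ⟨_, funext fun i => funext fun j => hb.eq_su3Matrix i j⟩
  simp only [Fin.sum_univ_three, Fin.sum_univ_seven]
  fin_cases c <;> simp [pairFst, pairSnd, su3Matrix] <;> ring

end IsSU3

end Tensors

/-! ### Closed forms and torsion-free connections -/

section Leibniz

variable {ι R : Type*} [CommRing R]

/-- The value of `dα ∧ β - α ∧ dβ` on three vectors, for 1-forms `α`, `β`. -/
def leibnizTwo (α β : ι → R) (dα dβ : ι → ι → R) (a b c : ι) : R :=
  dα a b * β c - dα a c * β b + dα b c * β a - (α a * dβ b c - α b * dβ a c + α c * dβ a b)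

/-- The value of `ρ ∧ β ∧ γ` on four vectors, for a 2-form `ρ` and 1-forms `β`, `γ`. -/
def wedgeTwoOneOne (ρ : ι → ι → R) (β γ : ι → R) (a b c d : ι) : R :=
  ρ a b * (β c * γ d - β d * γ c) - ρ a c * (β b * γ d - β d * γ b)
    + ρ a d * (β b * γ c - β c * γ b) + ρ b c * (β a * γ d - β d * γ a)
    - ρ b d * (β a * γ c - β c * γ a) + ρ c d * (β a * γ b - β b * γ a)

/-- The value of `dα ∧ β ∧ γ - α ∧ dβ ∧ γ + α ∧ β ∧ dγ` on four vectors, for 1-forms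
`α`, `β`, `γ`. -/
def leibnizThree (α β γ : ι → R) (dα dβ dγ : ι → ι → R) (a b c d : ι) : R :=
  wedgeTwoOneOne dα β γ a b c d - wedgeTwoOneOne dβ α γ a b c d + wedgeTwoOneOne dγ α β a b c d

end Leibniz

section Torsion

variable {ι : Type*}

theorem leibnizThree_complex (x₁ y₁ x₂ y₂ x₃ y₃ : ι → ℝ)
    (dx₁ dy₁ dx₂ dy₂ dx₃ dy₃ : ι → ι → ℝ) (a b c d : ι) :
    leibnizThree (fun a => (x₁ a : ℂ) + Complex.I * y₁ a) (fun a => (x₂ a : ℂ) + Complex.I * y₂ a)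
      (fun a => (x₃ a : ℂ) + Complex.I * y₃ a) (fun a b => (dx₁ a b : ℂ) + Complex.I * dy₁ a b)
      (fun a b => (dx₂ a b : ℂ) + Complex.I * dy₂ a b)
      (fun a b => (dx₃ a b : ℂ) + Complex.I * dy₃ a b) a b c d =
    ((leibnizThree x₁ x₂ x₃ dx₁ dx₂ dx₃ a b c d - leibnizThree x₁ y₂ y₃ dx₁ dy₂ dy₃ a b c d
      - leibnizThree y₁ x₂ y₃ dy₁ dx₂ dy₃ a b c d - leibnizThree y₁ y₂ x₃ dy₁ dy₂ dx₃ a b c d : ℝ)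
      : ℂ) + Complex.I *
    ((leibnizThree x₁ x₂ y₃ dx₁ dx₂ dy₃ a b c d + leibnizThree x₁ y₂ x₃ dx₁ dy₂ dx₃ a b c d
      + leibnizThree y₁ x₂ x₃ dy₁ dx₂ dx₃ a b c d - leibnizThree y₁ y₂ y₃ dy₁ dy₂ dy₃ a b c d : ℝ)
      : ℂ) := by
  simp only [leibnizThree, wedgeTwoOneOne, mul_sub, ofReal_add_I_mul_mul_mul]
  push_cast
  ring

/-- The values `dE_i (v_a, v_b)` prescribed by the first structure equation `dE = -Γ ∧ E`, where
`G c i j = Γ_{ij}(v_c)`. -/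
def torsionFree (G : Fin 7 → Fin 7 → Fin 7 → ℝ) (i a b : Fin 7) : ℝ := G b i a - G a i b

/-- The components `E_i (v_a)` of the coframe on the dual frame. -/
def delta (i a : Fin 7) : ℝ := if i = a then 1 else 0

/-- `d(E_i ∧ E_j)` on three frame vectors. -/
def dTwo (G : Fin 7 → Fin 7 → Fin 7 → ℝ) (i j : Fin 7) : Fin 7 → Fin 7 → Fin 7 → ℝ :=
  leibnizTwo (delta i) (delta j) (torsionFree G i) (torsionFree G j)

/-- `d(E_i ∧ E_j ∧ E_k)` on four frame vectors. -/
def dThree (G : Fin 7 → Fin 7 → Fin 7 → ℝ) (i j k : Fin 7) : Fin 7 → Fin 7 → Fin 7 → Fin 7 → ℝ :=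
  leibnizThree (delta i) (delta j) (delta k) (torsionFree G i) (torsionFree G j) (torsionFree G k)

set_option maxHeartbeats 4000000 in
/-- A torsion-free metric connection takes values in `𝔰𝔲(3)` as soon as `dω = 0` and `dΩ = 0`.
The deviation from `𝔰𝔲(3)` in the direction `v_x` is measured by the seven numbers
`τ 0 x, …, τ 6 x`, where `τ c x` is the contraction of `G x` over the pairs
`(pairFst c k, pairSnd c k)`, and the components of `dω` and `dΩ` are signed sums of these
numbers. -/
theorem isSU3_of_closed (G : Fin 7 → Fin 7 → Fin 7 → ℝ)
    (hs : ∀ x i j, G x j i = -G x i j) (hz : ∀ x j, G x 0 j = 0)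
    (hω : ∀ a b c, dTwo G 1 4 a b c + dTwo G 2 5 a b c + dTwo G 3 6 a b c = 0)
    (hR : ∀ a b c d, dThree G 1 2 3 a b c d - dThree G 1 5 6 a b c d
      - dThree G 4 2 6 a b c d - dThree G 4 5 3 a b c d = 0)
    (hI : ∀ a b c d, dThree G 1 2 6 a b c d + dThree G 1 5 3 a b c d
      + dThree G 4 2 3 a b c d - dThree G 4 5 6 a b c d = 0) (x : Fin 7) : IsSU3 (G x) := by
  have hz' : ∀ x j, G x j 0 = 0 := fun x j => by rw [hs, hz, neg_zero]
  have hd : ∀ x j, G x j j = 0 := fun x j => by linarith [hs x j j]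
  have S : ∀ x, G x 2 1 = -G x 1 2 ∧ G x 3 1 = -G x 1 3 ∧ G x 4 1 = -G x 1 4 ∧
      G x 5 1 = -G x 1 5 ∧ G x 6 1 = -G x 1 6 ∧ G x 3 2 = -G x 2 3 ∧ G x 4 2 = -G x 2 4 ∧
      G x 5 2 = -G x 2 5 ∧ G x 6 2 = -G x 2 6 ∧ G x 4 3 = -G x 3 4 ∧ G x 5 3 = -G x 3 5 ∧
      G x 6 3 = -G x 3 6 ∧ G x 5 4 = -G x 4 5 ∧ G x 6 4 = -G x 4 6 ∧ G x 6 5 = -G x 5 6 :=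
    fun x => ⟨hs x 1 2, hs x 1 3, hs x 1 4, hs x 1 5, hs x 1 6, hs x 2 3, hs x 2 4, hs x 2 5,
      hs x 2 6, hs x 3 4, hs x 3 5, hs x 3 6, hs x 4 5, hs x 4 6, hs x 5 6⟩
  set τ : Fin 7 → Fin 7 → ℝ := fun c x => ∑ k, G x (pairFst c k) (pairSnd c k) with hτ
  have τe : ∀ c x, τ c x = ∑ k, G x (pairFst c k) (pairSnd c k) := fun _ _ => rfl
  clear_value τ
  simp only [dTwo, leibnizTwo, torsionFree] at hω
  simp only [dThree, leibnizThree, wedgeTwoOneOne, torsionFree] at hR hI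
  -- The components of `dω` and `dΩ` along `E₀` give `τ c 0 = 0`. In the remaining directions the
  -- linear system splits into eight blocks, each solved on its own by the equations listed.
  obtain ⟨t00, t10, t20, t30, t40, t50, t60⟩ :
      τ 0 0 = 0 ∧ τ 1 0 = 0 ∧ τ 2 0 = 0 ∧ τ 3 0 = 0 ∧ τ 4 0 = 0 ∧ τ 5 0 = 0 ∧ τ 6 0 = 0 := by
    have h0 := hR 0 2 3 4
    have h1 := hω 0 5 6
    have h2 := hω 0 4 6
    have h3 := hω 0 4 5
    have h4 := hω 0 3 5
    have h5 := hω 0 3 4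
    have h6 := hω 0 2 4
    simp only [delta, Fin.reduceEq, ↓reduceIte, mul_zero, mul_one, sub_zero, zero_sub, sub_self,
      add_zero, zero_add, neg_neg, S, hz', hd] at h0 h1 h2 h3 h4 h5 h6
    simp only [τe, pairFst, pairSnd, Fin.sum_univ_three, Matrix.cons_val, S, hz]
    refine ⟨?_, ?_, ?_, ?_, ?_, ?_, ?_⟩ <;> linarith only [h0, h1, h2, h3, h4, h5, h6]
  obtain ⟨t01, t23, t32, t56, t65⟩ :
      τ 0 1 = 0 ∧ τ 2 3 = 0 ∧ τ 3 2 = 0 ∧ τ 5 6 = 0 ∧ τ 6 5 = 0 := by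
    have h0 := hω 2 4 5
    have h1 := hω 3 4 6
    have h2 := hR 1 2 3 4
    have h3 := hR 1 4 5 6
    have h4 := hI 1 2 4 6
    simp only [delta, Fin.reduceEq, ↓reduceIte, mul_zero, mul_one, sub_zero, zero_sub, sub_self,
      add_zero, zero_add, neg_neg, S, hd] at h0 h1 h2 h3 h4
    simp only [τe, pairFst, pairSnd, Fin.sum_univ_three, Matrix.cons_val, S, hz]
    refine ⟨?_, ?_, ?_, ?_, ?_⟩ <;> linarith only [h0, h1, h2, h3, h4]
  obtain ⟨t02, t13, t31, t46, t64⟩ :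
      τ 0 2 = 0 ∧ τ 1 3 = 0 ∧ τ 3 1 = 0 ∧ τ 4 6 = 0 ∧ τ 6 4 = 0 := by
    have h0 := hω 1 4 5
    have h1 := hω 3 5 6
    have h2 := hR 1 2 3 5
    have h3 := hR 2 4 5 6
    have h4 := hI 1 2 5 6
    simp only [delta, Fin.reduceEq, ↓reduceIte, mul_zero, mul_one, sub_zero, zero_sub, sub_self,
      add_zero, zero_add, neg_neg, S, hd] at h0 h1 h2 h3 h4
    simp only [τe, pairFst, pairSnd, Fin.sum_univ_three, Matrix.cons_val, S, hz]
    refine ⟨?_, ?_, ?_, ?_, ?_⟩ <;> linarith only [h0, h1, h2, h3, h4]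
  obtain ⟨t03, t12, t21, t45, t54⟩ :
      τ 0 3 = 0 ∧ τ 1 2 = 0 ∧ τ 2 1 = 0 ∧ τ 4 5 = 0 ∧ τ 5 4 = 0 := by
    have h0 := hω 1 4 6
    have h1 := hω 2 5 6
    have h2 := hR 1 2 3 6
    have h3 := hR 3 4 5 6
    have h4 := hI 2 3 4 6
    simp only [delta, Fin.reduceEq, ↓reduceIte, mul_zero, mul_one, sub_zero, zero_sub, sub_self,
      add_zero, zero_add, neg_neg, S, hd] at h0 h1 h2 h3 h4
    simp only [τe, pairFst, pairSnd, Fin.sum_univ_three, Matrix.cons_val, S, hz]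
    refine ⟨?_, ?_, ?_, ?_, ?_⟩ <;> linarith only [h0, h1, h2, h3, h4]
  obtain ⟨t04, t26, t35, t53, t62⟩ :
      τ 0 4 = 0 ∧ τ 2 6 = 0 ∧ τ 3 5 = 0 ∧ τ 5 3 = 0 ∧ τ 6 2 = 0 := by
    have h0 := hω 1 2 5
    have h1 := hω 1 3 6
    have h2 := hR 1 3 4 5
    have h3 := hR 1 2 4 6
    have h4 := hI 1 4 5 6
    simp only [delta, Fin.reduceEq, ↓reduceIte, mul_zero, mul_one, sub_zero, zero_sub, sub_self,
      add_zero, zero_add, neg_neg, S, hd] at h0 h1 h2 h3 h4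
    simp only [τe, pairFst, pairSnd, Fin.sum_univ_three, Matrix.cons_val, S, hz]
    refine ⟨?_, ?_, ?_, ?_, ?_⟩ <;> linarith only [h0, h1, h2, h3, h4]
  obtain ⟨t05, t16, t34, t43, t61⟩ :
      τ 0 5 = 0 ∧ τ 1 6 = 0 ∧ τ 3 4 = 0 ∧ τ 4 3 = 0 ∧ τ 6 1 = 0 := by
    have h0 := hω 1 2 4
    have h1 := hω 2 3 6
    have h2 := hR 2 3 4 5
    have h3 := hR 1 2 5 6
    have h4 := hI 2 4 5 6
    simp only [delta, Fin.reduceEq, ↓reduceIte, mul_zero, mul_one, sub_zero, zero_sub, sub_self,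
      add_zero, zero_add, neg_neg, S, hd] at h0 h1 h2 h3 h4
    simp only [τe, pairFst, pairSnd, Fin.sum_univ_three, Matrix.cons_val, S, hz]
    refine ⟨?_, ?_, ?_, ?_, ?_⟩ <;> linarith only [h0, h1, h2, h3, h4]
  obtain ⟨t06, t15, t24, t42, t51⟩ :
      τ 0 6 = 0 ∧ τ 1 5 = 0 ∧ τ 2 4 = 0 ∧ τ 4 2 = 0 ∧ τ 5 1 = 0 := by
    have h0 := hω 1 3 4
    have h1 := hω 2 3 5
    have h2 := hR 2 3 4 6
    have h3 := hR 1 3 5 6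
    have h4 := hI 1 2 3 6
    simp only [delta, Fin.reduceEq, ↓reduceIte, mul_zero, mul_one, sub_zero, zero_sub, sub_self,
      add_zero, zero_add, neg_neg, S, hd] at h0 h1 h2 h3 h4
    simp only [τe, pairFst, pairSnd, Fin.sum_univ_three, Matrix.cons_val, S, hz]
    refine ⟨?_, ?_, ?_, ?_, ?_⟩ <;> linarith only [h0, h1, h2, h3, h4]
  obtain ⟨t11, t22, t33, t44, t55, t66⟩ :
      τ 1 1 = 0 ∧ τ 2 2 = 0 ∧ τ 3 3 = 0 ∧ τ 4 4 = 0 ∧ τ 5 5 = 0 ∧ τ 6 6 = 0 := by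
    have h0 := hω 2 4 6
    have h1 := hω 3 4 5
    have h2 := hω 1 2 3
    have h3 := hω 1 5 6
    have h4 := hI 2 3 5 6
    have h5 := hI 1 3 4 6
    simp only [delta, Fin.reduceEq, ↓reduceIte, mul_zero, mul_one, sub_zero, zero_sub, sub_self,
      add_zero, zero_add, S, hd] at h0 h1 h2 h3 h4 h5
    simp only [τe, pairFst, pairSnd, Fin.sum_univ_three, Matrix.cons_val, S, hz]
    refine ⟨?_, ?_, ?_, ?_, ?_, ?_⟩ <;> linarith only [h0, h1, h2, h3, h4, h5]
  obtain ⟨t14, t25, t36, t41, t52, t63⟩ :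
      τ 1 4 = 0 ∧ τ 2 5 = 0 ∧ τ 3 6 = 0 ∧ τ 4 1 = 0 ∧ τ 5 2 = 0 ∧ τ 6 3 = 0 := by
    have h0 := hω 2 3 4
    have h1 := hω 4 5 6
    have h2 := hω 1 2 6
    have h3 := hω 1 3 5
    have h4 := hR 2 3 5 6
    have h5 := hR 1 3 4 6
    simp only [delta, Fin.reduceEq, ↓reduceIte, mul_zero, mul_one, sub_zero, zero_sub, sub_self,
      add_zero, zero_add, S, hd] at h0 h1 h2 h3 h4 h5
    simp only [τe, pairFst, pairSnd, Fin.sum_univ_three, Matrix.cons_val, S, hz]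
    refine ⟨?_, ?_, ?_, ?_, ?_, ?_⟩ <;> linarith only [h0, h1, h2, h3, h4, h5]
  refine ⟨hs x, hz x, fun c => ?_⟩
  rw [← τe]
  fin_cases c <;> fin_cases x <;> assumption

end Torsion

/-! ### Dual frames -/

section DualFrame

variable {V : Type*} [AddCommGroup V] [Module ℝ V] [TopologicalSpace V]

/-- `v` is the frame dual to the family of 1-forms `E`. -/
structure IsDualFrame (E : Fin 7 → V [⋀^Fin 1]→L[ℝ] ℝ) (v : Fin 7 → V) : Prop where
  apply : ∀ a b, E a ![v b] = delta a b
  sum : ∀ X, ∑ a, E a ![X] • v a = X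

variable {E : Fin 7 → V [⋀^Fin 1]→L[ℝ] ℝ} {v : Fin 7 → V}

/-- A family of seven 1-forms with trivial common kernel on a 7-dimensional space has a dual
frame. -/
theorem exists_isDualFrame [FiniteDimensional ℝ V] (hV : Module.finrank ℝ V = 7)
    (hE : ∀ X, (∀ a, E a ![X] = 0) → X = 0) : ∃ v, IsDualFrame E v := by
  let f : V →ₗ[ℝ] (Fin 7 → ℝ) := LinearMap.pi fun a => oneFormLin (E a)
  have hf : Function.Injective f := by
    rw [← LinearMap.ker_eq_bot, LinearMap.ker_eq_bot']
    exact fun X hX => hE X fun a => congrFun hX a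
  let e := LinearEquiv.ofInjectiveOfFinrankEq f hf (by simp [hV])
  have he : ∀ X a, e X a = E a ![X] := fun X a => rfl
  refine ⟨fun b => e.symm (Pi.single b 1), fun a b => ?_, fun X => e.injective ?_⟩
  · rw [← he, LinearEquiv.apply_symm_apply, delta, Pi.single_apply]
  · rw [map_sum]
    simp only [map_smul, LinearEquiv.apply_symm_apply, ← he]
    funext c
    simp [Pi.single_apply]

namespace IsDualFrame

theorem twoForm_apply (h : IsDualFrame E v) (S : V [⋀^Fin 2]→L[ℝ] ℝ) (X Y : V) :
    S ![X, Y] = ∑ a, ∑ b, E a ![X] * E b ![Y] * S ![v a, v b] := by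
  conv_lhs => rw [← twoFormLin_apply, ← h.sum X, ← h.sum Y]
  simp only [map_sum, map_smul, LinearMap.sum_apply, LinearMap.smul_apply, twoFormLin_apply,
    smul_eq_mul, Finset.mul_sum]
  rw [Finset.sum_comm]
  exact Finset.sum_congr rfl fun a _ => Finset.sum_congr rfl fun b _ => by ring

theorem twoForm_eq_sum (h : IsDualFrame E v) (S : V [⋀^Fin 2]→L[ℝ] ℝ) :
    S = ∑ c, ∑ k, S ![v (pairFst c k), v (pairSnd c k)] • mono E ![pairFst c k, pairSnd c k] := by
  refine twoForm_ext fun X Y => ?_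
  rw [h.twoForm_apply S X Y]
  have hm : ∀ a b, (mono E ![a, b] : V [⋀^Fin 2]→L[ℝ] ℝ) ![X, Y] =
      E a ![X] * E b ![Y] - E a ![Y] * E b ![X] := fun a b => by
    rw [← wedge_mono_one]
    exact wedge_one_one_apply _ _ _ _
  simp only [ContinuousAlternatingMap.sum_apply, ContinuousAlternatingMap.smul_apply, hm,
    smul_eq_mul]
  have hs : ∀ a b, S ![v a, v b] = -S ![v b, v a] := fun a b => twoForm_swap S _ _
  have hd : ∀ a, S ![v a, v a] = 0 := fun a => by linarith [hs a a]
  simp only [Fin.sum_univ_seven, Fin.sum_univ_three, pairFst, pairSnd, Matrix.cons_val, hd]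
  rw [hs 1 0, hs 2 0, hs 3 0, hs 4 0, hs 5 0, hs 6 0, hs 2 1, hs 3 1, hs 4 1, hs 5 1, hs 6 1,
    hs 3 2, hs 4 2, hs 5 2, hs 6 2, hs 4 3, hs 5 3, hs 6 3, hs 5 4, hs 6 4, hs 6 5]
  ring

/-- The 6-form `S ∧ ψ` in terms of the components of the 2-form `S`. -/
theorem wedge_psiOf (h : IsDualFrame E v) (S : V [⋀^Fin 2]→L[ℝ] ℝ) :
    wedge S (psiOf E) =
      ∑ c, (∑ k, S ![v (pairFst c k), v (pairSnd c k)]) • sixFormOf E c := by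
  conv_lhs => rw [h.twoForm_eq_sum S, ← wedgeBilin_apply]
  simp only [map_sum, map_smul, LinearMap.sum_apply, LinearMap.smul_apply, wedgeBilin_apply,
    wedge_mono_psiOf, Finset.sum_smul]

theorem mono_apply (h : IsDualFrame E v) {n : ℕ} {t : Fin n → Fin 7} (ht : Function.Injective t) :
    mono E t (fun i => v (t i)) = 1 := by
  rw [mono, decomp_apply]
  have : (Matrix.of fun i j => E (t i) ![v (t j)]) = (1 : Matrix (Fin n) (Fin n) ℝ) := by
    funext i j
    rw [Matrix.of_apply, h.apply, delta, Matrix.one_apply]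
    exact if_congr ht.eq_iff rfl rfl
  rw [this, Matrix.det_one]

theorem mono_ne_zero (h : IsDualFrame E v) {n : ℕ} {t : Fin n → Fin 7}
    (ht : Function.Injective t) : mono E t ≠ 0 := fun h0 => by
  have := h.mono_apply ht
  simp [h0] at this

theorem sixFormOf_ne_zero (h : IsDualFrame E v) (c : Fin 7) : sixFormOf E c ≠ 0 := by
  by_cases hc : c = 0
  · subst hc
    rw [sixFormOf_zero]
    exact h.mono_ne_zero (by decide)
  · have key : ∃ t : Fin 6 → Fin 7, Function.Injective t ∧
        (sixFormOf E c = mono E t ∨ sixFormOf E c = -mono E t) := by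
      rw [sixFormOf_of_ne E hc]
      fin_cases c
      · exact absurd rfl hc
      · refine ⟨![0, 1, 2, 3, 5, 6], by decide, ?_⟩
        simp [mono_six_swap12, mono_six_swap23, mono_six_swap34, mono_six_swap45, mono_six_eq12]
      · refine ⟨![0, 1, 2, 3, 4, 6], by decide, ?_⟩
        simp [mono_six_swap23, mono_six_swap34, mono_six_swap45, mono_six_eq12, mono_six_eq23]
      · refine ⟨![0, 1, 2, 3, 4, 5], by decide, ?_⟩
        simp [mono_six_swap23, mono_six_swap34, mono_six_swap45, mono_six_eq23]
      · refine ⟨![0, 2, 3, 4, 5, 6], by decide, ?_⟩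
        simp [mono_six_swap23, mono_six_swap34, mono_six_swap45, mono_six_eq34]
      · refine ⟨![0, 1, 3, 4, 5, 6], by decide, ?_⟩
        simp [mono_six_swap23, mono_six_swap45, mono_six_eq34, mono_six_eq45]
      · refine ⟨![0, 1, 2, 4, 5, 6], by decide, ?_⟩
        simp [mono_six_swap23, mono_six_eq45]
    obtain ⟨t, ht, h' | h'⟩ := key <;> rw [h']
    · exact h.mono_ne_zero ht
    · exact neg_ne_zero.2 (h.mono_ne_zero ht)

end IsDualFrame

/-- The pair symmetry of a curvature tensor follows from its skew-symmetries and the first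
Bianchi identity. -/
theorem pair_symmetry {ι : Type*} {r : ι → ι → ι → ι → ℝ} (h₁ : ∀ i j a b, r j i a b = -r i j a b)
    (h₂ : ∀ i j a b, r i j b a = -r i j a b)
    (hB : ∀ i a b c, r i a b c + r i b c a + r i c a b = 0) (i j a b : ι) :
    r i j a b = r a b i j := by
  linarith [hB i j a b, hB j a b i, hB a b i j, hB b i j a, h₁ i j a b, h₁ i a b j, h₁ i b j a,
    h₁ j a b i, h₁ j b i a, h₁ a b i j, h₁ a i j b, h₂ i a b j, h₂ i b a j, h₂ j i a b,
    h₂ j a b i, h₂ j b i a, h₂ a b i j, h₂ a i j b, h₂ a j b i, h₂ b i j a, h₂ b j a i,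
    h₂ b a i j, h₁ b i j a, h₁ b j a i, h₁ b a i j]

end DualFrame

/-! ### Differential forms in charts -/

section FormCalculus

open Filter Topology

variable {A : Type*} [NormedAddCommGroup A] [NormedSpace ℝ A] [FiniteDimensional ℝ A]

instance finiteDimensional_forms (n : ℕ) : FiniteDimensional ℝ (E7 [⋀^Fin n]→L[ℝ] A) := by
  let f : E7 [⋀^Fin n]→L[ℝ] A →ₗ[ℝ] MultilinearMap ℝ (fun _ : Fin n => E7) A :=
    { toFun := fun α => α.toMultilinearMap
      map_add' := fun _ _ => rfl
      map_smul' := fun _ _ => rfl }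
  refine FiniteDimensional.of_injective f fun α β h => ?_
  ext v
  exact DFunLike.congr_fun h v

/-- Smoothness of a family of forms can be tested on constant vectors. -/
theorem contDiffAt_form_iff {n : ℕ} {k : WithTop ℕ∞} {α : E7 → E7 [⋀^Fin n]→L[ℝ] A} {y : E7} :
    ContDiffAt ℝ k α y ↔ ∀ v, ContDiffAt ℝ k (fun z => α z v) y := by
  constructor
  · intro h v
    exact (ContinuousAlternatingMap.apply ℝ E7 A v).contDiff.contDiffAt.comp y h
  · intro h
    let b := (EuclideanSpace.basisFun (Fin 7) ℝ).toBasis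
    let f : E7 [⋀^Fin n]→L[ℝ] A →ₗ[ℝ] ((Fin n → Fin 7) → A) :=
      { toFun := fun α t => α fun i => b (t i)
        map_add' := fun _ _ => rfl
        map_smul' := fun _ _ => rfl }
    have hf : Function.Injective f := fun α β hαβ => by
      apply ContinuousAlternatingMap.toAlternatingMap_injective
      refine Module.Basis.ext_alternating b fun t _ => ?_
      exact congrFun hαβ t
    obtain ⟨g, hg⟩ := f.exists_leftInverse_of_injective (LinearMap.ker_eq_bot.2 hf)
    have : α = fun z => LinearMap.toContinuousLinearMap g (f (α z)) := by
      funext z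
      exact (LinearMap.congr_fun hg (α z)).symm
    rw [this]
    refine (LinearMap.toContinuousLinearMap g).contDiff.contDiffAt.comp y ?_
    exact contDiffAt_pi.2 fun t => h _

theorem minSmoothness_two_le : minSmoothness ℝ 2 ≤ (∞ : WithTop ℕ∞) := by
  rw [minSmoothness_of_isRCLikeNormedField]
  decide

/-- A smooth form applied to smooth vector fields is smooth. -/
theorem contDiffAt_form_apply {n : ℕ} {k : WithTop ℕ∞} {α : E7 → E7 [⋀^Fin n]→L[ℝ] A} {y : E7}
    {w : Fin n → E7 → E7} (hα : ContDiffAt ℝ k α y) (hw : ∀ i, ContDiffAt ℝ k (w i) y) :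
    ContDiffAt ℝ k (fun z => α z fun i => w i z) y := by
  let b := (EuclideanSpace.basisFun (Fin 7) ℝ).toBasis
  have e : (fun z => α z fun i => w i z) = fun z =>
      ∑ t : Fin n → Fin 7, (∏ i, (w i z) (t i)) • α z fun i => b (t i) := by
    funext z
    have hsum : ∀ i, w i z = ∑ j, (w i z) j • b j := fun i => by
      conv_lhs => rw [← b.sum_repr (w i z)]
      simp [b]
    conv_lhs => rw [show (fun i => w i z) = fun i => ∑ j, (w i z) j • b j from funext hsum]
    refine ((α z).toMultilinearMap.map_sum _).trans (Finset.sum_congr rfl fun t _ => ?_)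
    exact (α z).toMultilinearMap.map_smul_univ _ _
  rw [e]
  refine ContDiffAt.sum fun t _ => ContDiffAt.smul ?_ (contDiffAt_form_iff.1 hα _)
  refine contDiffAt_prod fun i _ => ?_
  exact (EuclideanSpace.proj (𝕜 := ℝ) (t i)).contDiff.contDiffAt.comp y (hw i)

omit [FiniteDimensional ℝ A] in
theorem contDiffAt_extDeriv {n : ℕ} {α : E7 → E7 [⋀^Fin n]→L[ℝ] A} {y : E7}
    (hα : ContDiffAt ℝ ∞ α y) : ContDiffAt ℝ ∞ (extDeriv α) y :=
  (ContinuousAlternatingMap.alternatizeUncurryFinCLM ℝ E7 A (n := n)).contDiff.contDiffAt.comp y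
    (hα.fderiv_right (by simp))

end FormCalculus

section ManifoldForms

open Filter Topology

variable {K : Type*} [TopologicalSpace K] [ChartedSpace E7 K]
variable {A : Type*} [NormedAddCommGroup A] [NormedSpace ℝ A]

/-- Smoothness of a differential form at a point. -/
def SmoothFormAt {n : ℕ} (α : DiffForm K A n) (x : K) : Prop :=
  ContDiffAt ℝ ∞ (chartRep α x) (extChartAt (𝓡 7) x x)

theorem tendsto_symm_nhds (x : K) :
    Tendsto (extChartAt (𝓡 7) x).symm (𝓝 (extChartAt (𝓡 7) x x)) (𝓝 x) := by
  have := continuousAt_extChartAt_symm (I := 𝓡 7) x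
  rwa [ContinuousAt, extChartAt_to_inv] at this

theorem chartRep_eventuallyEq {n : ℕ} {α β : DiffForm K A n} {x : K} (h : ∀ᶠ z in 𝓝 x, α z = β z) :
    chartRep α x =ᶠ[𝓝 (extChartAt (𝓡 7) x x)] chartRep β x := by
  filter_upwards [(tendsto_symm_nhds x).eventually h] with y hy
  rw [chartRep, chartRep, hy]

theorem SmoothFormAt.congr {n : ℕ} {α β : DiffForm K A n} {x : K} (hα : SmoothFormAt α x)
    (h : ∀ᶠ z in 𝓝 x, β z = α z) : SmoothFormAt β x :=
  ContDiffAt.congr_of_eventuallyEq hα (chartRep_eventuallyEq h)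

theorem extD_congr {n : ℕ} {α β : DiffForm K A n} {x : K} (h : ∀ᶠ z in 𝓝 x, α z = β z) :
    extD α x = extD β x := by
  rw [extD, extD, (chartRep_eventuallyEq h).extDeriv_eq]

variable [IsManifold (𝓡 7) ∞ K]

theorem isManifold_one (K : Type*) [TopologicalSpace K] [ChartedSpace E7 K]
    [IsManifold (𝓡 7) ∞ K] : IsManifold (𝓡 7) 1 K := IsManifold.of_le (n := ∞) (by decide)

theorem mfderiv_symm_comp_extChartAt {x x' : K} (hx : x' ∈ (extChartAt (𝓡 7) x).source) :
    (mfderiv 𝓘(ℝ, E7) (𝓡 7) (extChartAt (𝓡 7) x).symm (extChartAt (𝓡 7) x x')) ∘L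
      (mfderiv (𝓡 7) 𝓘(ℝ, E7) (extChartAt (𝓡 7) x) x') =
      ContinuousLinearMap.id ℝ (TangentSpace (𝓡 7) x') := by
  have := isManifold_one K
  have h := mfderivWithin_extChartAt_symm_comp_mfderiv_extChartAt' (I := 𝓡 7) hx
  rwa [ModelWithCorners.range_eq_univ, mfderivWithin_univ] at h

theorem mfderiv_extChartAt_base (x : K) :
    mfderiv (𝓡 7) 𝓘(ℝ, E7) (extChartAt (𝓡 7) x) x = ContinuousLinearMap.id ℝ E7 := by
  have := isManifold_one K
  exact mfderiv_extChartAt_self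

theorem mfderiv_extChartAt_symm_base (x : K) :
    mfderiv 𝓘(ℝ, E7) (𝓡 7) (extChartAt (𝓡 7) x).symm (extChartAt (𝓡 7) x x) =
      ContinuousLinearMap.id ℝ E7 := by
  have := isManifold_one K
  have h := mfderivWithin_range_extChartAt_symm (I := 𝓡 7) (x := x)
  rwa [ModelWithCorners.range_eq_univ, mfderivWithin_univ] at h

theorem chartRep_base {n : ℕ} (α : DiffForm K A n) (x : K) :
    chartRep α x (extChartAt (𝓡 7) x x) = α x := by
  -- The base points `x` and `φ⁻¹ (φ x)` of the two values of `α` are only propositionally equal.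
  have aux : ∀ (w z : K) (_ : w = z) (L : E7 →L[ℝ] E7), L = ContinuousLinearMap.id ℝ E7 →
      ((α w).compContinuousLinearMap L : E7 [⋀^Fin n]→L[ℝ] A) = α z := by
    rintro w z rfl L rfl
    ext v
    rfl
  exact aux _ _ (extChartAt_to_inv x) _ (mfderiv_extChartAt_symm_base x)

theorem extD_eq_extDeriv {n : ℕ} (α : DiffForm K A n) (x : K) :
    extD α x = extDeriv (chartRep α x) (extChartAt (𝓡 7) x x) := by
  rw [extD, mfderiv_extChartAt_base]
  ext v
  rfl

theorem mdifferentiableAt_symm {x : K} {y : E7} (hy : y ∈ (extChartAt (𝓡 7) x).target) :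
    MDifferentiableAt 𝓘(ℝ, E7) (𝓡 7) (extChartAt (𝓡 7) x).symm y := by
  have := isManifold_one K
  have h := mdifferentiableWithinAt_extChartAt_symm (I := 𝓡 7) hy
  rwa [ModelWithCorners.range_eq_univ, mdifferentiableWithinAt_univ] at h

/-- The transition map between two charts. -/
def transition (x x' : K) : E7 → E7 := extChartAt (𝓡 7) x' ∘ (extChartAt (𝓡 7) x).symm

theorem transition_contDiffAt {x x' : K} {y : E7} (hy : y ∈ (extChartAt (𝓡 7) x).target)
    (hx' : (extChartAt (𝓡 7) x).symm y ∈ (extChartAt (𝓡 7) x').source) :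
    ContDiffAt ℝ ∞ (transition x x') y := by
  have h := contDiffWithinAt_ext_coord_change (I := 𝓡 7) (n := ∞) (M := K) x' x (y := y)
    (by rw [PartialEquiv.trans_source]; exact ⟨hy, hx'⟩)
  rwa [ModelWithCorners.range_eq_univ, contDiffWithinAt_univ] at h

theorem fderiv_transition {x x' : K} {y : E7} (hy : y ∈ (extChartAt (𝓡 7) x).target)
    (hx' : (extChartAt (𝓡 7) x).symm y ∈ (extChartAt (𝓡 7) x').source) :
    fderiv ℝ (transition x x') y =
      (mfderiv (𝓡 7) 𝓘(ℝ, E7) (extChartAt (𝓡 7) x') ((extChartAt (𝓡 7) x).symm y)) ∘L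
      (mfderiv 𝓘(ℝ, E7) (𝓡 7) (extChartAt (𝓡 7) x).symm y) := by
  have := isManifold_one K
  rw [← mfderiv_eq_fderiv, transition]
  refine mfderiv_comp y ?_ (mdifferentiableAt_symm hy)
  exact mdifferentiableAt_extChartAt (by rwa [extChartAt_source] at hx')

/-- Change of charts for the coordinate representation of a form. -/
theorem chartRep_eq_pullback {n : ℕ} (α : DiffForm K A n) {x x' : K} {y : E7}
    (hy : y ∈ (extChartAt (𝓡 7) x).target)
    (hx' : (extChartAt (𝓡 7) x).symm y ∈ (extChartAt (𝓡 7) x').source) :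
    chartRep α x y = (chartRep α x' (transition x x' y)).compContinuousLinearMap
      (fderiv ℝ (transition x x') y) := by
  have aux : ∀ (w z : K) (_ : w = z) (L M N : E7 →L[ℝ] E7),
      L ∘L M = ContinuousLinearMap.id ℝ E7 →
      ((α z).compContinuousLinearMap N : E7 [⋀^Fin n]→L[ℝ] A) =
      ((α w).compContinuousLinearMap L : E7 [⋀^Fin n]→L[ℝ] A).compContinuousLinearMap (M ∘L N) := by
    rintro w z rfl L M N h
    ext v
    simp only [ContinuousAlternatingMap.compContinuousLinearMap_apply]
    refine congrArg (α w) (funext fun i => ?_)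
    exact (DFunLike.congr_fun h (N (v i))).symm
  rw [fderiv_transition hy hx', chartRep, chartRep, transition, Function.comp_apply]
  exact aux _ _ ((extChartAt (𝓡 7) x').left_inv hx') _ _ _ (mfderiv_symm_comp_extChartAt hx')

omit [IsManifold (𝓡 7) ∞ K] in
theorem eventually_mem_source {x x' : K} {y : E7} (hy : y ∈ (extChartAt (𝓡 7) x).target)
    (hx' : (extChartAt (𝓡 7) x).symm y ∈ (extChartAt (𝓡 7) x').source) :
    ∀ᶠ z in 𝓝 y, z ∈ (extChartAt (𝓡 7) x).target ∧
      (extChartAt (𝓡 7) x).symm z ∈ (extChartAt (𝓡 7) x').source := by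
  refine Filter.Eventually.and ((isOpen_extChartAt_target x).mem_nhds hy) ?_
  exact (continuousAt_extChartAt_symm'' hy).eventually
    ((isOpen_extChartAt_source x').mem_nhds hx')

/-- The exterior derivative can be computed in any chart. -/
theorem chartRep_extD {n : ℕ} (α : DiffForm K A n) {x : K} {y : E7}
    (hy : y ∈ (extChartAt (𝓡 7) x).target) (hα : SmoothFormAt α ((extChartAt (𝓡 7) x).symm y)) :
    chartRep (extD α) x y = extDeriv (chartRep α x) y := by
  set x' := (extChartAt (𝓡 7) x).symm y with hx'
  have hs : x' ∈ (extChartAt (𝓡 7) x').source := mem_extChartAt_source x'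
  have e : chartRep α x =ᶠ[𝓝 y] _ :=
    (eventually_mem_source (x' := x') hy hs).mono fun z hz => chartRep_eq_pullback α hz.1 hz.2
  have hd : DifferentiableAt ℝ (chartRep α x') (transition x x' y) :=
    ContDiffAt.differentiableAt hα (by simp)
  have hp := extDeriv_pullback (r := ∞) hd (transition_contDiffAt hy hs) minSmoothness_two_le
  rw [e.extDeriv_eq, hp, fderiv_transition hy hs]
  rfl

theorem chartRep_extD_eventuallyEq {n : ℕ} {α : DiffForm K A n} {x : K}
    (h : ∀ᶠ z in 𝓝 x, SmoothFormAt α z) :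
    chartRep (extD α) x =ᶠ[𝓝 (extChartAt (𝓡 7) x x)] extDeriv (chartRep α x) := by
  filter_upwards [(tendsto_symm_nhds x).eventually h,
    (isOpen_extChartAt_target (I := 𝓡 7) x).mem_nhds (mem_extChartAt_target x)] with y hy hy'
  exact chartRep_extD α hy' hy

theorem smoothFormAt_extD [FiniteDimensional ℝ A] {n : ℕ} {α : DiffForm K A n} {x : K}
    (h : ∀ᶠ z in 𝓝 x, SmoothFormAt α z) : SmoothFormAt (extD α) x :=
  ContDiffAt.congr_of_eventuallyEq (contDiffAt_extDeriv (h.self_of_nhds))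
    (chartRep_extD_eventuallyEq h)

/-- `d² = 0`. -/
theorem extD_extD [FiniteDimensional ℝ A] {n : ℕ} {α : DiffForm K A n} {x : K}
    (h : ∀ᶠ z in 𝓝 x, SmoothFormAt α z) : extD (extD α) x = 0 := by
  rw [extD_eq_extDeriv, (chartRep_extD_eventuallyEq h).extDeriv_eq]
  exact extDeriv_extDeriv_apply (r := ∞) h.self_of_nhds minSmoothness_two_le

end ManifoldForms

/-! ### The Leibniz rule -/

section ExtDerivApply

variable {A : Type*} [NormedAddCommGroup A] [NormedSpace ℝ A]

theorem extDeriv_one_apply {α : E7 → E7 [⋀^Fin 1]→L[ℝ] A} {y : E7} (h : DifferentiableAt ℝ α y)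
    (X Y : E7) : extDeriv α y ![X, Y] =
      fderiv ℝ (fun z => α z ![Y]) y X - fderiv ℝ (fun z => α z ![X]) y Y := by
  have e : ∀ i : Fin 2, (i.removeNth ![X, Y] : Fin 1 → E7) = ![![Y], ![X]] i := fun i => by
    fin_cases i <;> (funext j; fin_cases j; rfl)
  refine (extDeriv_apply h ![X, Y]).trans ((Fin.sum_univ_two _).trans ?_)
  simp only [e]
  simp [sub_eq_add_neg]

theorem extDeriv_two_apply {α : E7 → E7 [⋀^Fin 2]→L[ℝ] A} {y : E7} (h : DifferentiableAt ℝ α y)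
    (X Y Z : E7) : extDeriv α y ![X, Y, Z] = fderiv ℝ (fun z => α z ![Y, Z]) y X
      - fderiv ℝ (fun z => α z ![X, Z]) y Y + fderiv ℝ (fun z => α z ![X, Y]) y Z := by
  have e : ∀ i : Fin 3, (i.removeNth ![X, Y, Z] : Fin 2 → E7) =
      ![![Y, Z], ![X, Z], ![X, Y]] i := fun i => by
    fin_cases i <;> (funext j; fin_cases j <;> rfl)
  refine (extDeriv_apply h ![X, Y, Z]).trans ((Fin.sum_univ_three _).trans ?_)
  simp only [e]
  simp [sub_eq_add_neg]

theorem extDeriv_three_apply {α : E7 → E7 [⋀^Fin 3]→L[ℝ] A} {y : E7}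
    (h : DifferentiableAt ℝ α y) (X Y Z W : E7) :
    extDeriv α y ![X, Y, Z, W] = fderiv ℝ (fun z => α z ![Y, Z, W]) y X
      - fderiv ℝ (fun z => α z ![X, Z, W]) y Y + fderiv ℝ (fun z => α z ![X, Y, W]) y Z
      - fderiv ℝ (fun z => α z ![X, Y, Z]) y W := by
  have e : ∀ i : Fin 4, (i.removeNth ![X, Y, Z, W] : Fin 3 → E7) =
      ![![Y, Z, W], ![X, Z, W], ![X, Y, W], ![X, Y, Z]] i := fun i => by
    fin_cases i <;> (funext j; fin_cases j <;> rfl)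
  refine (extDeriv_apply h ![X, Y, Z, W]).trans ((Fin.sum_univ_four _).trans ?_)
  simp only [e]
  simp [sub_eq_add_neg, pow_succ]

end ExtDerivApply

section Leibniz

variable {A : Type*} [NormedCommRing A] [NormedAlgebra ℝ A] [FiniteDimensional ℝ A]

theorem contDiffAt_wedge_one_one {k : WithTop ℕ∞} {α β : E7 → E7 [⋀^Fin 1]→L[ℝ] A} {y : E7}
    (hα : ContDiffAt ℝ k α y) (hβ : ContDiffAt ℝ k β y) :
    ContDiffAt ℝ k (fun z => (wedge (α z) (β z) : E7 [⋀^Fin 2]→L[ℝ] A)) y := by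
  refine contDiffAt_form_iff.2 fun v => ?_
  have hv : v = ![v 0, v 1] := by funext i; fin_cases i <;> rfl
  rw [hv]
  simp only [wedge_one_one_apply]
  have a := contDiffAt_form_iff.1 hα
  have b := contDiffAt_form_iff.1 hβ
  exact ((a _).mul (b _)).sub ((a _).mul (b _))

theorem contDiffAt_wedge_one_one_one {k : WithTop ℕ∞} {α β γ : E7 → E7 [⋀^Fin 1]→L[ℝ] A} {y : E7}
    (hα : ContDiffAt ℝ k α y) (hβ : ContDiffAt ℝ k β y) (hγ : ContDiffAt ℝ k γ y) :
    ContDiffAt ℝ k (fun z => (wedge (wedge (α z) (β z)) (γ z) : E7 [⋀^Fin 3]→L[ℝ] A)) y := by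
  refine contDiffAt_form_iff.2 fun v => ?_
  have hv : v = ![v 0, v 1, v 2] := by funext i; fin_cases i <;> rfl
  rw [hv]
  simp only [wedge_one_one_one_apply]
  have a := contDiffAt_form_iff.1 hα
  have b := contDiffAt_form_iff.1 hβ
  have c := contDiffAt_form_iff.1 hγ
  have m : ∀ X Y Z : E7, ContDiffAt ℝ k (fun z => α z ![X] * β z ![Y] * γ z ![Z]) y :=
    fun X Y Z => ((a _).mul (b _)).mul (c _)
  exact (((((m _ _ _).sub (m _ _ _)).sub (m _ _ _)).add (m _ _ _)).add (m _ _ _)).sub (m _ _ _)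

omit [FiniteDimensional ℝ A] in
theorem differentiableAt_form_apply {n : ℕ} {α : E7 → E7 [⋀^Fin n]→L[ℝ] A} {y : E7}
    (hα : DifferentiableAt ℝ α y) (v : Fin n → E7) : DifferentiableAt ℝ (fun z => α z v) y :=
  (ContinuousAlternatingMap.apply ℝ E7 A v).differentiableAt.comp y hα

/-- The Leibniz rule for the wedge product of two 1-forms. -/
theorem extDeriv_wedge_one_one {α β : E7 → E7 [⋀^Fin 1]→L[ℝ] A} {y : E7}
    (hα : ContDiffAt ℝ 1 α y) (hβ : ContDiffAt ℝ 1 β y) (X Y Z : E7) :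
    extDeriv (fun z => (wedge (α z) (β z) : E7 [⋀^Fin 2]→L[ℝ] A)) y ![X, Y, Z] =
      leibnizTwo (fun X => α y ![X]) (fun X => β y ![X]) (fun X Y => extDeriv α y ![X, Y])
        (fun X Y => extDeriv β y ![X, Y]) X Y Z := by
  have a := hα.differentiableAt one_ne_zero
  have b := hβ.differentiableAt one_ne_zero
  rw [extDeriv_two_apply ((contDiffAt_wedge_one_one hα hβ).differentiableAt one_ne_zero)]
  simp only [leibnizTwo, extDeriv_one_apply a, extDeriv_one_apply b, wedge_one_one_apply]
  have key : ∀ U V W : E7, fderiv ℝ (fun z => α z ![U] * β z ![V] - α z ![V] * β z ![U]) y W =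
      α y ![U] * fderiv ℝ (fun z => β z ![V]) y W + β y ![V] * fderiv ℝ (fun z => α z ![U]) y W
      - (α y ![V] * fderiv ℝ (fun z => β z ![U]) y W
        + β y ![U] * fderiv ℝ (fun z => α z ![V]) y W) := by
    intro U V W
    have au := (differentiableAt_form_apply a ![U]).hasFDerivAt
    have av := (differentiableAt_form_apply a ![V]).hasFDerivAt
    have bu := (differentiableAt_form_apply b ![U]).hasFDerivAt
    have bv := (differentiableAt_form_apply b ![V]).hasFDerivAt
    exact (DFunLike.congr_fun ((au.mul bv).sub (av.mul bu)).fderiv W).trans (by simp)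
  simp only [key]
  ring

/-- The Leibniz rule for the wedge product of three 1-forms. -/
theorem extDeriv_wedge_one_one_one {α β γ : E7 → E7 [⋀^Fin 1]→L[ℝ] A} {y : E7}
    (hα : ContDiffAt ℝ 1 α y) (hβ : ContDiffAt ℝ 1 β y) (hγ : ContDiffAt ℝ 1 γ y) (X Y Z W : E7) :
    extDeriv (fun z => (wedge (wedge (α z) (β z)) (γ z) : E7 [⋀^Fin 3]→L[ℝ] A)) y ![X, Y, Z, W] =
      leibnizThree (fun X => α y ![X]) (fun X => β y ![X]) (fun X => γ y ![X])
        (fun X Y => extDeriv α y ![X, Y]) (fun X Y => extDeriv β y ![X, Y])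
        (fun X Y => extDeriv γ y ![X, Y]) X Y Z W := by
  have a := hα.differentiableAt one_ne_zero
  have b := hβ.differentiableAt one_ne_zero
  have c := hγ.differentiableAt one_ne_zero
  rw [extDeriv_three_apply ((contDiffAt_wedge_one_one_one hα hβ hγ).differentiableAt one_ne_zero)]
  simp only [leibnizThree, wedgeTwoOneOne, extDeriv_one_apply a, extDeriv_one_apply b,
    extDeriv_one_apply c, wedge_one_one_one_apply]
  obtain ⟨D, m, hD⟩ : ∃ D : E7 → E7 → E7 → (E7 →L[ℝ] A),
      (∀ U V S, HasFDerivAt (fun z => α z ![U] * β z ![V] * γ z ![S]) (D U V S) y) ∧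
      ∀ U V S T, D U V S T = (α y ![U] * β y ![V]) * fderiv ℝ (fun z => γ z ![S]) y T + γ y ![S] *
        (α y ![U] * fderiv ℝ (fun z => β z ![V]) y T
          + β y ![V] * fderiv ℝ (fun z => α z ![U]) y T) :=
    ⟨_, fun U V S => (((differentiableAt_form_apply a ![U]).hasFDerivAt.mul
      (differentiableAt_form_apply b ![V]).hasFDerivAt).mul
      (differentiableAt_form_apply c ![S]).hasFDerivAt), fun U V S T => by simp [mul_add]⟩
  have key : ∀ U V S T : E7, fderiv ℝ (fun z => α z ![U] * β z ![V] * γ z ![S]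
      - α z ![U] * β z ![S] * γ z ![V] - α z ![V] * β z ![U] * γ z ![S]
      + α z ![V] * β z ![S] * γ z ![U] + α z ![S] * β z ![U] * γ z ![V]
      - α z ![S] * β z ![V] * γ z ![U]) y T =
      D U V S T - D U S V T - D V U S T + D V S U T + D S U V T - D S V U T := fun U V S T =>
    DFunLike.congr_fun ((((((m U V S).sub (m U S V)).sub (m V U S)).add (m V S U)).add
      (m S U V)).sub (m S V U)).fderiv T
  simp only [key, hD]
  ring

end Leibniz

section ManifoldCalculus

open Filter Topology

variable {K : Type*} [TopologicalSpace K] [ChartedSpace E7 K]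

section Linear

variable {A : Type*} [NormedAddCommGroup A] [NormedSpace ℝ A] {n : ℕ}

theorem chartRep_add (α β : DiffForm K A n) (x : K) :
    chartRep (α + β) x = chartRep α x + chartRep β x := rfl

theorem chartRep_smul (c : ℝ) (α : DiffForm K A n) (x : K) :
    chartRep (c • α) x = c • chartRep α x := rfl

theorem chartRep_zero (x : K) : chartRep (0 : DiffForm K A n) x = 0 := rfl

theorem SmoothFormAt.add {α β : DiffForm K A n} {x : K} (hα : SmoothFormAt α x)
    (hβ : SmoothFormAt β x) : SmoothFormAt (α + β) x := ContDiffAt.add hα hβ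

theorem SmoothFormAt.const_smul (c : ℝ) {α : DiffForm K A n} {x : K} (hα : SmoothFormAt α x) :
    SmoothFormAt (c • α) x := ContDiffAt.const_smul c hα

theorem SmoothFormAt.neg {α : DiffForm K A n} {x : K} (hα : SmoothFormAt α x) :
    SmoothFormAt (-α) x := ContDiffAt.neg hα

theorem smoothFormAt_zero (x : K) : SmoothFormAt (0 : DiffForm K A n) x := by
  rw [SmoothFormAt, chartRep_zero]
  exact contDiffAt_const (c := 0)

theorem SmoothFormAt.sum {ι : Type*} {s : Finset ι} {α : ι → DiffForm K A n} {x : K}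
    (h : ∀ i ∈ s, SmoothFormAt (α i) x) : SmoothFormAt (∑ i ∈ s, α i) x :=
  Finset.sum_induction _ (fun β => SmoothFormAt β x) (fun _ _ => SmoothFormAt.add)
    (smoothFormAt_zero x) h

theorem SmoothFormAt.differentiableAt {α : DiffForm K A n} {x : K} (hα : SmoothFormAt α x) :
    DifferentiableAt ℝ (chartRep α x) (extChartAt (𝓡 7) x x) :=
  ContDiffAt.differentiableAt hα (by simp)

theorem extD_add {α β : DiffForm K A n} {x : K} (hα : SmoothFormAt α x)
    (hβ : SmoothFormAt β x) : extD (α + β) x = extD α x + extD β x := by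
  rw [extD, chartRep_add, extDeriv_add hα.differentiableAt hβ.differentiableAt]
  rfl

theorem extD_smul (c : ℝ) (α : DiffForm K A n) (x : K) : extD (c • α) x = c • extD α x := by
  rw [extD, chartRep_smul, extDeriv_smul]
  rfl

theorem extD_neg (α : DiffForm K A n) (x : K) : extD (-α) x = -extD α x := by
  have := extD_smul (-1) α x
  simpa using! this

theorem extD_zero (x : K) : extD (0 : DiffForm K A n) x = 0 := by
  have := extD_smul 0 (0 : DiffForm K A n) x
  simpa using! this

theorem extD_sum {ι : Type*} {s : Finset ι} {α : ι → DiffForm K A n} {x : K}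
    (h : ∀ i ∈ s, SmoothFormAt (α i) x) : extD (∑ i ∈ s, α i) x = ∑ i ∈ s, extD (α i) x := by
  classical
  induction s using Finset.induction_on with
  | empty => simp [extD_zero]
  | insert i s hi ih =>
    rw [Finset.sum_insert hi, Finset.sum_insert hi, extD_add (h _ (Finset.mem_insert_self _ _))
      (SmoothFormAt.sum fun j hj => h j (Finset.mem_insert_of_mem hj)),
      ih fun j hj => h j (Finset.mem_insert_of_mem hj)]

end Linear

variable {A : Type*} [NormedCommRing A] [NormedAlgebra ℝ A] [FiniteDimensional ℝ A]

omit [FiniteDimensional ℝ A] in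
theorem chartRep_wedgeF {m n : ℕ} (α : DiffForm K A m) (β : DiffForm K A n) (x : K) :
    chartRep (wedgeF α β) x = fun y => wedge (chartRep α x y) (chartRep β x y) :=
  funext fun _ => wedge_compContinuousLinearMap _ _ _

theorem SmoothFormAt.wedge_one_one {α β : DiffForm K A 1} {x : K} (hα : SmoothFormAt α x)
    (hβ : SmoothFormAt β x) : SmoothFormAt (wedgeF α β : DiffForm K A 2) x := by
  have h := contDiffAt_wedge_one_one hα hβ
  rwa [← chartRep_wedgeF] at h

variable [IsManifold (𝓡 7) ∞ K]

/-- The Leibniz rule for the wedge product of two 1-forms on a manifold. -/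
theorem extD_wedge_one_one {α β : DiffForm K A 1} {x : K} (hα : SmoothFormAt α x)
    (hβ : SmoothFormAt β x) (X Y Z : TangentSpace (𝓡 7) x) :
    extD (wedgeF α β : DiffForm K A 2) x ![X, Y, Z] =
      leibnizTwo (fun X => α x ![X]) (fun X => β x ![X]) (fun X Y => extD α x ![X, Y])
        (fun X Y => extD β x ![X, Y]) X Y Z := by
  have h := extDeriv_wedge_one_one (hα.of_le (by simp)) (hβ.of_le (by simp)) X Y Z
  rw [chartRep_base, chartRep_base] at h
  rw [extD_eq_extDeriv, extD_eq_extDeriv, extD_eq_extDeriv, chartRep_wedgeF]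
  exact h

theorem extD_wedge_one_one_one {α β γ : DiffForm K A 1} {x : K} (hα : SmoothFormAt α x)
    (hβ : SmoothFormAt β x) (hγ : SmoothFormAt γ x) (X Y Z W : TangentSpace (𝓡 7) x) :
    extD (wedgeF (wedgeF α β) γ : DiffForm K A 3) x ![X, Y, Z, W] =
      leibnizThree (fun X => α x ![X]) (fun X => β x ![X]) (fun X => γ x ![X])
        (fun X Y => extD α x ![X, Y]) (fun X Y => extD β x ![X, Y])
        (fun X Y => extD γ x ![X, Y]) X Y Z W := by
  have h := extDeriv_wedge_one_one_one (hα.of_le (by simp)) (hβ.of_le (by simp))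
    (hγ.of_le (by simp)) X Y Z W
  rw [chartRep_base, chartRep_base, chartRep_base] at h
  rw [extD_eq_extDeriv, extD_eq_extDeriv, extD_eq_extDeriv, extD_eq_extDeriv]
  rw [show chartRep (wedgeF (wedgeF α β) γ : DiffForm K A 3) x = fun y =>
    wedge (wedge (chartRep α x y) (chartRep β x y)) (chartRep γ x y) by
      rw [chartRep_wedgeF, chartRep_wedgeF]]
  exact h

end ManifoldCalculus

section ComplexForms

open Filter Topology

variable {K : Type*} [TopologicalSpace K] [ChartedSpace E7 K]

/-- The complex-valued 1-form `a + i b`. -/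
def complexForm (a b : DiffForm K ℝ 1) : DiffForm K ℂ 1 := complexify a + Complex.I • complexify b

theorem complexForm_apply (a b : DiffForm K ℝ 1) (x : K) (v : Fin 1 → TangentSpace (𝓡 7) x) :
    complexForm a b x v = a x v + Complex.I * b x v := rfl

theorem chartRep_complexForm_apply (a b : DiffForm K ℝ 1) (x : K) (y : E7) (v : Fin 1 → E7) :
    chartRep (complexForm a b) x y v = chartRep a x y v + Complex.I * chartRep b x y v := rfl

theorem SmoothFormAt.complexForm {a b : DiffForm K ℝ 1} {x : K} (ha : SmoothFormAt a x)
    (hb : SmoothFormAt b x) : SmoothFormAt (complexForm a b) x := by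
  refine contDiffAt_form_iff.2 fun v => ?_
  simp only [chartRep_complexForm_apply]
  exact (Complex.ofRealCLM.contDiff.contDiffAt.comp _ (contDiffAt_form_iff.1 ha v)).add
    (contDiffAt_const.mul
      (Complex.ofRealCLM.contDiff.contDiffAt.comp _ (contDiffAt_form_iff.1 hb v)))

theorem extD_complexForm [IsManifold (𝓡 7) ∞ K] {a b : DiffForm K ℝ 1} {x : K}
    (ha : SmoothFormAt a x) (hb : SmoothFormAt b x) (X Y : TangentSpace (𝓡 7) x) :
    extD (complexForm a b) x ![X, Y] = extD a x ![X, Y] + Complex.I * extD b x ![X, Y] := by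
  have key : ∀ U W : E7, fderiv ℝ (fun z => chartRep (complexForm a b) x z ![U])
      (extChartAt (𝓡 7) x x) W =
      (fderiv ℝ (fun z => chartRep a x z ![U]) (extChartAt (𝓡 7) x x) W : ℂ) +
      Complex.I * (fderiv ℝ (fun z => chartRep b x z ![U]) (extChartAt (𝓡 7) x x) W : ℂ) := by
    intro U W
    have h1 := Complex.ofRealCLM.hasFDerivAt.comp _
      (differentiableAt_form_apply ha.differentiableAt ![U]).hasFDerivAt
    have h2 := Complex.ofRealCLM.hasFDerivAt.comp _
      (differentiableAt_form_apply hb.differentiableAt ![U]).hasFDerivAt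
    have h3 := h1.add (h2.const_mul Complex.I)
    refine (DFunLike.congr_fun h3.fderiv W).trans ?_
    simp
  have main : ∀ X Y : E7, extDeriv (chartRep (complexForm a b) x) (extChartAt (𝓡 7) x x) ![X, Y] =
      extDeriv (chartRep a x) (extChartAt (𝓡 7) x x) ![X, Y] +
      Complex.I * extDeriv (chartRep b x) (extChartAt (𝓡 7) x x) ![X, Y] := by
    intro X Y
    rw [extDeriv_one_apply (ha.complexForm hb).differentiableAt X Y,
      extDeriv_one_apply ha.differentiableAt X Y, extDeriv_one_apply hb.differentiableAt X Y,
      key, key]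
    push_cast
    ring
  rw [extD_eq_extDeriv, extD_eq_extDeriv, extD_eq_extDeriv]
  exact main X Y

end ComplexForms

/-! ### The connection matrices in components -/

section Indices

/-- The enumeration of the blocks `1 + 3 + 3`. -/
def idx : Fin 7 → Idx7 :=
  ![Sum.inl (), Sum.inr (Sum.inl 0), Sum.inr (Sum.inl 1), Sum.inr (Sum.inl 2),
    Sum.inr (Sum.inr 0), Sum.inr (Sum.inr 1), Sum.inr (Sum.inr 2)]

theorem idx_bijective : Function.Bijective idx := by
  constructor <;> decide

theorem sum_idx {M : Type*} [AddCommMonoid M] (f : Idx7 → M) : ∑ l, f l = ∑ a, f (idx a) :=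
  (Fintype.sum_bijective idx idx_bijective _ _ fun _ => rfl).symm

/-- The element `± E_c` coded by the signed index `s = ± (c + 1)`. -/
def signedForm {M : Type*} [AddCommGroup M] [Module ℝ M] (E : Fin 7 → M) (s : ℤ) : M :=
  ∑ c, (signedUnit s c : ℝ) • E c

theorem signedForm_eq {M : Type*} [AddCommGroup M] [Module ℝ M] (E : Fin 7 → M) :
    signedForm E 0 = 0 ∧ signedForm E 1 = E 0 ∧ signedForm E 2 = E 1 ∧ signedForm E 3 = E 2 ∧
    signedForm E 4 = E 3 ∧ signedForm E 5 = E 4 ∧ signedForm E 6 = E 5 ∧ signedForm E 7 = E 6 ∧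
    signedForm E (-1) = -E 0 ∧ signedForm E (-2) = -E 1 ∧ signedForm E (-3) = -E 2 ∧
    signedForm E (-4) = -E 3 ∧ signedForm E (-5) = -E 4 ∧ signedForm E (-6) = -E 5 ∧
    signedForm E (-7) = -E 6 := by
  refine ⟨?_, ?_, ?_, ?_, ?_, ?_, ?_, ?_, ?_, ?_, ?_, ?_, ?_, ?_, ?_⟩ <;>
    simp [Fin.sum_univ_seven, signedUnit, signedForm]

end Indices

namespace ContactCalabiYau.Coframe

open Filter Topology

variable {K : Type*} [TopologicalSpace K] [ChartedSpace E7 K] [IsManifold (𝓡 7) ∞ K]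
  {S : ContactCalabiYau K} (F : S.Coframe)

/-- The coframe `(e₀, e, Je)` with `e₀ = ε η`. -/
def cof (ε : ℝ) : Fin 7 → DiffForm K ℝ 1 :=
  ![ε • S.η, F.e 0, F.e 1, F.e 2, F.Je 0, F.Je 1, F.Je 2]

/-- The connection matrix `A = (0, 0; 0, Γ)`, indexed by `Fin 7`. -/
def conn (Γ : Matrix (Fin 3 ⊕ Fin 3) (Fin 3 ⊕ Fin 3) (DiffForm K ℝ 1)) (i j : Fin 7) :
    DiffForm K ℝ 1 := matA Γ (idx i) (idx j)

theorem cof_eq (ε : ℝ) : F.cof ε 0 = ε • S.η ∧ F.cof ε 1 = F.e 0 ∧ F.cof ε 2 = F.e 1 ∧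
    F.cof ε 3 = F.e 2 ∧ F.cof ε 4 = F.Je 0 ∧ F.cof ε 5 = F.Je 1 ∧ F.cof ε 6 = F.Je 2 :=
  ⟨rfl, rfl, rfl, rfl, rfl, rfl, rfl⟩

set_option maxHeartbeats 1000000 in
theorem matB_idx (ε : ℝ) (i j : Fin 7) :
    F.matB ε (idx i) (idx j) = ∑ c, (tensorB i j c : ℝ) • F.cof ε c := by
  change _ = signedForm (F.cof ε) (codeB i j)
  have h := signedForm_eq (F.cof ε)
  fin_cases i <;> fin_cases j <;>
    simp only [Fin.zero_eta, Fin.mk_one, Fin.reduceFinMk, idx, matB, blockMatrix, codeB,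
      Matrix.of_apply, Matrix.cons_val, h, F.cof_eq ε, Matrix.fromBlocks_apply₁₁,
      Matrix.fromBlocks_apply₁₂, Matrix.fromBlocks_apply₂₁, Matrix.fromBlocks_apply₂₂,
      Sum.elim_inl, Sum.elim_inr,
      Matrix.zero_apply, Matrix.neg_apply, Pi.neg_apply, Matrix.diagonal_apply, Fin.reduceEq,
      ↓reduceIte, neg_neg, neg_zero]

set_option maxHeartbeats 1000000 in
theorem matC_idx (ε : ℝ) (i j : Fin 7) :
    F.matC ε (idx i) (idx j) = ∑ c, (tensorC i j c : ℝ) • F.cof ε c := by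
  change _ = signedForm (F.cof ε) (codeC i j)
  have h := signedForm_eq (F.cof ε)
  fin_cases i <;> fin_cases j <;>
    simp only [Fin.zero_eta, Fin.mk_one, Fin.reduceFinMk, idx, matC, blockMatrix, codeC, box,
      Matrix.of_apply, Matrix.cons_val, h, F.cof_eq ε, Matrix.fromBlocks_apply₁₁,
      Matrix.fromBlocks_apply₁₂, Matrix.fromBlocks_apply₂₁, Matrix.fromBlocks_apply₂₂,
      Sum.elim_inl, Sum.elim_inr,
      Matrix.zero_apply, Matrix.add_apply, Matrix.neg_apply, Pi.neg_apply,
      Matrix.diagonal_apply, Fin.reduceEq, ↓reduceIte, neg_neg, neg_zero, add_zero,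
      zero_add]

set_option maxHeartbeats 1000000 in
theorem matN_idx (ε δ : ℝ) (i j : Fin 7) :
    F.matN δ (idx i) (idx j) = ∑ c, ((1 - 5 * δ) * (1 + δ) * tensorRow i j c +
      (δ ^ 2 - 4 * δ - 1) * tensorBox i j c : ℝ) • F.cof ε c := by
  rw [matN]
  generalize (1 - 5 * δ) * (1 + δ) = r
  generalize δ ^ 2 - 4 * δ - 1 = s
  have e : ∑ c, (r * tensorRow i j c + s * tensorBox i j c : ℝ) • F.cof ε c =
      r • signedForm (F.cof ε) (codeRow i j) + s • signedForm (F.cof ε) (codeBox i j) := by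
    simp only [add_smul, mul_smul, Finset.sum_add_distrib, signedForm, Finset.smul_sum]
    rfl
  rw [e]
  have h := signedForm_eq (F.cof ε)
  fin_cases i <;> fin_cases j <;>
    simp only [Fin.zero_eta, Fin.mk_one, Fin.reduceFinMk, idx, blockMatrix, codeRow, codeBox, box,
      Matrix.of_apply, Matrix.cons_val, h, F.cof_eq ε, Matrix.fromBlocks_apply₁₁,
      Matrix.fromBlocks_apply₁₂, Matrix.fromBlocks_apply₂₁, Matrix.fromBlocks_apply₂₂,
      Sum.elim_inl, Sum.elim_inr,
      Matrix.zero_apply, Matrix.neg_apply, Matrix.smul_apply, Pi.smul_apply, neg_neg, neg_zero,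
      add_zero, zero_add, smul_zero, smul_neg]

omit [IsManifold (𝓡 7) ∞ K] in
theorem smulI_idx {n : ℕ} (α : DiffForm K ℝ n) (i j : Fin 7) :
    smulI α (idx i) (idx j) = (tensorI i j 0 : ℝ) • α := by
  fin_cases i <;> fin_cases j <;>
    simp only [Fin.zero_eta, Fin.mk_one, Fin.reduceFinMk, idx, smulI, blockMatrix, tensorI, codeI,
      signedUnit, Matrix.of_apply, Matrix.cons_val, Matrix.fromBlocks_apply₁₁,
      Matrix.fromBlocks_apply₁₂, Matrix.fromBlocks_apply₂₁, Matrix.fromBlocks_apply₂₂,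
      Sum.elim_inl, Sum.elim_inr, Pi.zero_apply, Matrix.zero_apply, Matrix.neg_apply,
      Matrix.diagonal_apply, Fin.reduceEq, ↓reduceIte, neg_zero] <;>
    simp

end ContactCalabiYau.Coframe

/-! ### The forms `ω`, `Ω`, `ψ` in a coframe -/

namespace ContactCalabiYau.Coframe

open Filter Topology

variable {K : Type*} [TopologicalSpace K] [ChartedSpace E7 K] [IsManifold (𝓡 7) ∞ K]
  {S : ContactCalabiYau K} (F : S.Coframe)

theorem smoothFormAt_η (S : ContactCalabiYau K) (x : K) : SmoothFormAt S.η x :=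
  S.smooth_η x (Set.mem_univ x)

theorem smoothFormAt_cof (ε : ℝ) (a : Fin 7) {x : K} (hx : x ∈ F.U) :
    SmoothFormAt (F.cof ε a) x := by
  fin_cases a
  · exact (smoothFormAt_η S x).const_smul ε
  · exact F.smooth_e 0 x hx
  · exact F.smooth_e 1 x hx
  · exact F.smooth_e 2 x hx
  · exact F.smooth_Je 0 x hx
  · exact F.smooth_Je 1 x hx
  · exact F.smooth_Je 2 x hx

/-- The coframe at a point. -/
def cofAt (ε : ℝ) (x : K) (a : Fin 7) : TangentSpace (𝓡 7) x [⋀^Fin 1]→L[ℝ] ℝ := F.cof ε a x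

theorem omega_eq_omegaOf (ε : ℝ) {x : K} (hx : x ∈ F.U) : S.omega x = omegaOf (F.cofAt ε x) := by
  rw [F.omega_eq x hx, Fin.sum_univ_three, omegaOf]
  simp only [← wedge_mono_one]
  rfl

theorem halfOmegaSq_eq (ε : ℝ) {x : K} (hx : x ∈ F.U) :
    S.halfOmegaSq x = (1 / 2 : ℝ) • wedge (omegaOf (F.cofAt ε x)) (omegaOf (F.cofAt ε x)) := by
  rw [← F.omega_eq_omegaOf ε hx]
  rfl

theorem Ω_apply {x : K} (hx : x ∈ F.U) (X Y Z : TangentSpace (𝓡 7) x) (ε : ℝ) :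
    S.Ω x ![X, Y, Z] = reOmegaOf (F.cofAt ε x) ![X, Y, Z] +
      Complex.I * imOmegaOf (F.cofAt ε x) ![X, Y, Z] := by
  have h : S.Ω x = wedge (wedge (complexForm (F.e 0) (F.Je 0) x) (complexForm (F.e 1) (F.Je 1) x))
    (complexForm (F.e 2) (F.Je 2) x) := F.Ω_eq x hx
  rw [h]
  exact (wedge_one_one_one_apply _ _ _ X Y Z).trans
    (reOmegaOf_add_imOmegaOf_apply (F.cofAt ε x) X Y Z).symm

theorem imForm_Ω_eq (ε : ℝ) {x : K} (hx : x ∈ F.U) :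
    imForm S.Ω x = imOmegaOf (F.cofAt ε x) := by
  refine threeForm_ext fun X Y Z => ?_
  have h := congrArg Complex.im (F.Ω_apply hx X Y Z ε)
  refine Eq.trans ?_ (h.trans ?_)
  · rfl
  · simp

theorem ψ_eq (ε : ℝ) {x : K} (hx : x ∈ F.U) : S.ψ ε x = psiOf (F.cofAt ε x) := by
  have h : S.ψ ε x = S.halfOmegaSq x - ε • wedge (S.η x) (imForm S.Ω x) := rfl
  rw [h, F.halfOmegaSq_eq ε hx, F.imForm_Ω_eq ε hx,
    ← wedge_smul_left ε (S.η x)]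
  rfl

set_option maxRecDepth 4000 in
theorem sixthOmegaCube_eq (ε : ℝ) {x : K} (hx : x ∈ F.U) :
    S.sixthOmegaCube x = sixFormOf (F.cofAt ε x) 0 := by
  have h : S.sixthOmegaCube x = (1 / 6 : ℝ) • (wedge (wedge (S.omega x) (S.omega x)) (S.omega x) :
    TangentSpace (𝓡 7) x [⋀^Fin 6]→L[ℝ] ℝ) := rfl
  rw [h, sixFormOf, if_pos rfl, F.omega_eq_omegaOf ε hx]

theorem wedge_halfOmegaSq_cof (ε : ℝ) {x : K} (hx : x ∈ F.U) {c : Fin 7} (hc : c ≠ 0) :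
    wedge (wedge ((ε • S.η) x) (S.halfOmegaSq x)) (F.cof ε c x) = sixFormOf (F.cofAt ε x) c := by
  rw [sixFormOf, if_neg hc, F.halfOmegaSq_eq ε hx]
  rfl

/-- The coframe has a dual frame, since `dη` is nondegenerate on `ker η`. -/
theorem exists_dual {ε : ℝ} (hε : ε ≠ 0) {x : K} (hx : x ∈ F.U) :
    ∃ v, IsDualFrame (F.cofAt ε x) v := by
  have : FiniteDimensional ℝ (TangentSpace (𝓡 7) x) := inferInstanceAs (FiniteDimensional ℝ E7)
  refine exists_isDualFrame (V := TangentSpace (𝓡 7) x)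
    ((finrank_euclideanSpace_fin : Module.finrank ℝ E7 = 7)) fun X hX => ?_
  by_contra hX0
  have h0 : ε * S.η x ![X] = 0 := hX 0
  have hp := S.dη_pos x X ((mul_eq_zero.1 h0).resolve_left hε) hX0
  have hω : S.omega x ![X, S.J x X] = 0 := by
    rw [F.omega_eq_omegaOf ε hx, omegaOf]
    simp only [ContinuousAlternatingMap.add_apply, ← wedge_mono_one]
    have w : ∀ a b, wedge (F.cofAt ε x a) (F.cofAt ε x b) ![X, S.J x X] = 0 := fun a b => by
      refine (wedge_one_one_apply _ _ _ _).trans ?_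
      rw [hX a, hX b]
      ring
    have := w 1 4
    have := w 2 5
    have := w 3 6
    simp_all
  exact hp.ne' hω

end ContactCalabiYau.Coframe

/-! ### The transverse connection has values in `𝔰𝔲(3)` -/

theorem wedge_zero_left {V A : Type*} [AddCommGroup V] [Module ℝ V] [TopologicalSpace V]
    [NormedCommRing A] [NormedAlgebra ℝ A] {m n : ℕ} (β : V [⋀^Fin n]→L[ℝ] A) :
    wedge (0 : V [⋀^Fin m]→L[ℝ] A) β = 0 := by
  rw [← wedgeBilin_apply, map_zero]
  rfl

namespace ContactCalabiYau.Coframe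

open Filter Topology

variable {K : Type*} [TopologicalSpace K] [ChartedSpace E7 K] [IsManifold (𝓡 7) ∞ K]
  {S : ContactCalabiYau K} {F : S.Coframe}
  {Γ : Matrix (Fin 3 ⊕ Fin 3) (Fin 3 ⊕ Fin 3) (DiffForm K ℝ 1)}

omit [IsManifold (𝓡 7) ∞ K] in
theorem conn_zero_left (Γ : Matrix (Fin 3 ⊕ Fin 3) (Fin 3 ⊕ Fin 3) (DiffForm K ℝ 1)) (j : Fin 7) :
    conn Γ 0 j = 0 := by
  rw [conn, matA]
  cases idx j <;> rfl

theorem eventually_mem (F : S.Coframe) {x : K} (hx : x ∈ F.U) : ∀ᶠ z in 𝓝 x, z ∈ F.U :=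
  F.isOpen_U.mem_nhds hx

/-- The structure coefficients `dE_a (v_b, v_c)` of the coframe. -/
def structureCoeff (F : S.Coframe) (ε : ℝ) {x : K} (v : Fin 7 → TangentSpace (𝓡 7) x)
    (a b c : Fin 7) : ℝ := extD (F.cof ε a) x ![v b, v c]

/-- The equations `dω = 0` and `dΩ = 0` in terms of the structure coefficients of the coframe. -/
theorem closed_frame {ε : ℝ} {x : K} (hx : x ∈ F.U) {v : Fin 7 → TangentSpace (𝓡 7) x}
    (hv : IsDualFrame (F.cofAt ε x) v) :
    letI d := F.structureCoeff ε v
    (∀ a b c, leibnizTwo (delta 1) (delta 4) (d 1) (d 4) a b c +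
      leibnizTwo (delta 2) (delta 5) (d 2) (d 5) a b c +
      leibnizTwo (delta 3) (delta 6) (d 3) (d 6) a b c = 0) ∧
    (∀ a b c e, leibnizThree (delta 1) (delta 2) (delta 3) (d 1) (d 2) (d 3) a b c e -
      leibnizThree (delta 1) (delta 5) (delta 6) (d 1) (d 5) (d 6) a b c e -
      leibnizThree (delta 4) (delta 2) (delta 6) (d 4) (d 2) (d 6) a b c e -
      leibnizThree (delta 4) (delta 5) (delta 3) (d 4) (d 5) (d 3) a b c e = 0) ∧
    (∀ a b c e, leibnizThree (delta 1) (delta 2) (delta 6) (d 1) (d 2) (d 6) a b c e +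
      leibnizThree (delta 1) (delta 5) (delta 3) (d 1) (d 5) (d 3) a b c e +
      leibnizThree (delta 4) (delta 2) (delta 3) (d 4) (d 2) (d 3) a b c e -
      leibnizThree (delta 4) (delta 5) (delta 6) (d 4) (d 5) (d 6) a b c e = 0) := by
  have hd : ∀ a b, F.cof ε a x ![v b] = delta a b := hv.apply
  have sm : ∀ a, SmoothFormAt (F.cof ε a) x := fun a => F.smoothFormAt_cof ε a hx
  have hω : extD (∑ i, wedgeF (F.e i) (S.actJ (F.e i)) : DiffForm K ℝ 2) x = 0 := by
    rw [← extD_extD (α := S.η) (Eventually.of_forall fun z => smoothFormAt_η S z)]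
    refine (extD_congr ?_).symm
    filter_upwards [F.eventually_mem hx] with z hz
    refine (F.omega_eq z hz).trans ?_
    rw [Finset.sum_apply]
  have hΩ : extD (wedgeF (wedgeF (complexForm (F.e 0) (F.Je 0)) (complexForm (F.e 1) (F.Je 1)))
      (complexForm (F.e 2) (F.Je 2)) : DiffForm K ℂ 3) x = 0 := by
    refine Eq.trans (extD_congr ?_).symm (congrFun S.dΩ x)
    filter_upwards [F.eventually_mem hx] with z hz using F.Ω_eq z hz
  set d := F.structureCoeff ε v with hdd
  have htwo : ∀ i j a b c,
      extD (wedgeF (F.cof ε i) (F.cof ε j) : DiffForm K ℝ 2) x ![v a, v b, v c] =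
      leibnizTwo (delta i) (delta j) (d i) (d j) a b c := fun i j a b c => by
    refine (extD_wedge_one_one (sm i) (sm j) (v a) (v b) (v c)).trans ?_
    simp only [leibnizTwo, hd, hdd, structureCoeff]
  have hform : ∀ i j, (fun a => complexForm (F.cof ε i) (F.cof ε j) x ![v a]) =
      fun a => (delta i a : ℂ) + Complex.I * delta j a := fun i j => by
    funext a
    rw [complexForm_apply, hd, hd]
  have hdform : ∀ i j,
      (fun a b => extD (complexForm (F.cof ε i) (F.cof ε j)) x ![v a, v b]) =
      fun a b => (d i a b : ℂ) + Complex.I * d j a b := fun i j =>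
    funext fun a => funext fun b => extD_complexForm (sm i) (sm j) _ _
  have hthree : ∀ a b c e, _ := fun a b c e => by
    have E := (extD_wedge_one_one_one ((sm 1).complexForm (sm 4)) ((sm 2).complexForm (sm 5))
      ((sm 3).complexForm (sm 6)) (v a) (v b) (v c) (v e)).symm.trans
      (DFunLike.congr_fun hΩ ![v a, v b, v c, v e])
    replace E : leibnizThree (fun a => complexForm (F.cof ε 1) (F.cof ε 4) x ![v a])
      (fun a => complexForm (F.cof ε 2) (F.cof ε 5) x ![v a])
      (fun a => complexForm (F.cof ε 3) (F.cof ε 6) x ![v a])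
      (fun a b => extD (complexForm (F.cof ε 1) (F.cof ε 4)) x ![v a, v b])
      (fun a b => extD (complexForm (F.cof ε 2) (F.cof ε 5)) x ![v a, v b])
      (fun a b => extD (complexForm (F.cof ε 3) (F.cof ε 6)) x ![v a, v b]) a b c e = 0 := E
    rw [hform, hform, hform, hdform, hdform, hdform, leibnizThree_complex] at E
    exact E
  refine ⟨fun a b c => ?_, fun a b c e => ?_, fun a b c e => ?_⟩
  · rw [extD_sum fun i _ => SmoothFormAt.wedge_one_one (F.smooth_e i x hx) (F.smooth_Je i x hx),
      Fin.sum_univ_three] at hω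
    rw [← htwo, ← htwo, ← htwo]
    exact DFunLike.congr_fun hω ![v a, v b, v c]
  · have := congrArg Complex.re (hthree a b c e)
    rw [Complex.add_re, Complex.I_mul_re, Complex.ofReal_re, Complex.ofReal_im, neg_zero,
      add_zero] at this
    exact this
  · have := congrArg Complex.im (hthree a b c e)
    rw [Complex.add_im, Complex.I_mul_im, Complex.ofReal_re, Complex.ofReal_im, zero_add] at this
    exact this

namespace IsTransverseLeviCivita

variable (h : F.IsTransverseLeviCivita Γ)
include h

theorem smoothFormAt_conn (i j : Fin 7) {x : K} (hx : x ∈ F.U) : SmoothFormAt (conn Γ i j) x := by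
  rw [conn, matA]
  cases idx i <;> cases idx j <;>
    first | exact smoothFormAt_zero x | exact h.smooth _ _ x hx

theorem conn_skew (i j : Fin 7) {x : K} (hx : x ∈ F.U) : conn Γ j i x = -conn Γ i j x := by
  rw [conn, conn, matA]
  cases idx i <;> cases idx j <;>
    first | exact neg_zero.symm | exact h.skew _ _ x hx

/-- The first structure equation of the coframe `(e₀, e, Je)`. -/
theorem extD_cof (ε : ℝ) (a : Fin 7) {x : K} (hx : x ∈ F.U) :
    extD (F.cof ε a) x = (if a = 0 then ε else 0) • S.omega x
      - ∑ b, wedgeF (conn Γ a b) (F.cof ε b) x := by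
  let cofI : Idx7 → DiffForm K ℝ 1 := Sum.elim (fun _ => ε • S.η) F.tr
  have hc : ∀ b, F.cof ε b = cofI (idx b) := fun b => by fin_cases b <;> rfl
  have h0 : ∀ b, idx b = Sum.inl () ↔ b = 0 := by decide
  have key : ∀ i : Idx7, extD (cofI i) x = (if i = Sum.inl () then ε else 0) • S.omega x
      - ∑ l, wedgeF (matA Γ i l) (cofI l) x := by
    rintro (i | i)
    · have hz : ∀ l, wedgeF (matA Γ (Sum.inl i) l) (cofI l) x = 0 := fun l => by
        have : matA Γ (Sum.inl i) l = 0 := by cases l <;> rfl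
        rw [this]
        exact wedge_zero_left _
      simp only [hz, Finset.sum_const_zero, sub_zero]
      exact extD_smul ε S.η x
    · rw [Fintype.sum_sum_type]
      have hz : wedgeF (matA Γ (Sum.inr i) (Sum.inl ())) (cofI (Sum.inl ())) x = 0 :=
        wedge_zero_left _
      simp only [Finset.univ_unique, Finset.sum_singleton, PUnit.default_eq_unit, hz, zero_add,
        reduceCtorEq, if_false, zero_smul, zero_sub]
      exact h.torsion_free i x hx
  rw [hc, key, sum_idx]
  simp only [h0, hc, conn]

theorem extD_cof_apply (ε : ℝ) (a : Fin 7) {x : K} (hx : x ∈ F.U) (X Y : TangentSpace (𝓡 7) x) :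
    extD (F.cof ε a) x ![X, Y] = (if a = 0 then ε else 0) * S.omega x ![X, Y]
      - ∑ b, (conn Γ a b x ![X] * F.cof ε b x ![Y] - conn Γ a b x ![Y] * F.cof ε b x ![X]) := by
  rw [h.extD_cof ε a hx]
  simp only [ContinuousAlternatingMap.sub_apply, ContinuousAlternatingMap.smul_apply,
    ContinuousAlternatingMap.sum_apply, smul_eq_mul]
  congr 1
  exact Finset.sum_congr rfl fun b _ => wedge_one_one_apply _ _ _ _

theorem extD_cof_frame {ε : ℝ} {x : K} (hx : x ∈ F.U) {v : Fin 7 → TangentSpace (𝓡 7) x}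
    (hv : IsDualFrame (F.cofAt ε x) v) {a : Fin 7} (ha : a ≠ 0) (b c : Fin 7) :
    extD (F.cof ε a) x ![v b, v c] = torsionFree (fun c i j => conn Γ i j x ![v c]) a b c := by
  have hd : ∀ a b, F.cof ε a x ![v b] = delta a b := hv.apply
  rw [h.extD_cof_apply ε a hx, if_neg ha, zero_mul, zero_sub, torsionFree]
  simp [hd, delta, Finset.sum_sub_distrib]

/-- The transverse Levi-Civita connection has values in `𝔰𝔲(3)`. -/
theorem isSU3_frame {ε : ℝ} {x : K} (hx : x ∈ F.U) {v : Fin 7 → TangentSpace (𝓡 7) x}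
    (hv : IsDualFrame (F.cofAt ε x) v) (c : Fin 7) :
    IsSU3 (fun i j => conn Γ i j x ![v c]) := by
  have hde : ∀ a ≠ 0, F.structureCoeff ε v a =
      torsionFree (fun c i j => conn Γ i j x ![v c]) a := fun a ha =>
    funext fun b => funext fun c => h.extD_cof_frame hx hv ha b c
  obtain ⟨hω, hR, hI⟩ := closed_frame hx hv
  rw [hde 1 (by decide), hde 2 (by decide), hde 3 (by decide), hde 4 (by decide),
    hde 5 (by decide), hde 6 (by decide)] at hω hR hI
  exact isSU3_of_closed (fun c i j => conn Γ i j x ![v c])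
    (fun c i j => congrArg (fun α => α ![v c]) (h.conn_skew i j hx))
    (fun c j => DFunLike.congr_fun (congrFun (conn_zero_left Γ j) x) ![v c]) hω hR hI c

theorem isSU3 {ε : ℝ} (hε : ε ≠ 0) {x : K} (hx : x ∈ F.U) (X : TangentSpace (𝓡 7) x) :
    IsSU3 (fun i j => conn Γ i j x ![X]) := by
  obtain ⟨v, hv⟩ := F.exists_dual hε hx
  have hX : ∀ i j, conn Γ i j x ![X] = ∑ c, F.cof ε c x ![X] * conn Γ i j x ![v c] :=
    fun i j => by
      have e := hv.sum X
      conv_lhs => rw [← e]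
      change oneFormLin (conn Γ i j x) _ = _
      rw [map_sum]
      simp only [map_smul, smul_eq_mul]
      rfl
  have hc := fun c => h.isSU3_frame hx hv c
  refine ⟨fun i j => congrArg (fun α => α ![X]) (h.conn_skew i j hx), fun j => ?_, fun d => ?_⟩
  · rw [conn_zero_left]
    rfl
  · simp only [hX]
    rw [Finset.sum_comm]
    refine Finset.sum_eq_zero fun c _ => ?_
    rw [← Finset.mul_sum, (hc c).contract d, mul_zero]

end IsTransverseLeviCivita
end ContactCalabiYau.Coframe

/-! ### Parallel tensors and the transverse curvature -/

section Invariance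

/-- The coefficients of the matrix `B + δ C` of 1-forms with respect to the coframe. -/
def tensorBC (δ : ℝ) (i j c : Fin 7) : ℝ := tensorB i j c + δ * tensorC i j c

theorem tensorBC_zero (δ : ℝ) (i j : Fin 7) : tensorBC δ i j 0 = (1 - δ) * tensorI i j 0 := by
  have hB : ∀ i j, tensorB i j 0 = tensorI i j 0 := by decide +kernel
  have hC : ∀ i j, tensorC i j 0 = -tensorI i j 0 := by decide +kernel
  rw [tensorBC, hB, hC]
  push_cast
  ring

theorem tensorI_of_ne : ∀ i j c : Fin 7, c ≠ 0 → tensorI i j c = 0 := by decide +kernel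

theorem tensorRow_zero : ∀ i j : Fin 7, tensorRow i j 0 = 0 := by decide +kernel

theorem tensorBox_zero : ∀ i j : Fin 7, tensorBox i j 0 = 0 := by decide +kernel

theorem IsSU3.tensorBC_invariant {a : Fin 7 → Fin 7 → ℝ} (ha : IsSU3 a) (δ : ℝ) (i j d : Fin 7) :
    ∑ l, (a i l * tensorBC δ l j d + a j l * tensorBC δ i l d + a d l * tensorBC δ i j l) = 0 := by
  have hB := ha.sum_tensor tensorB_su3 i j d
  have hC := ha.sum_tensor tensorC_su3 i j d
  refine Eq.trans ?_ ((congrArg₂ (fun a b => a + δ * b) hB hC).trans (by simp))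
  rw [Finset.mul_sum, ← Finset.sum_add_distrib]
  refine Finset.sum_congr rfl fun l _ => ?_
  simp only [tensorBC]
  ring

/-- The vanishing of the covariant derivative of the matrix `B + δ C`, in the direction where the
connection matrix is `a`, evaluated on a vector with components `q`. -/
theorem IsSU3.tensorBC_parallel {a : Fin 7 → Fin 7 → ℝ} (ha : IsSU3 a) (δ : ℝ) (q : Fin 7 → ℝ)
    (i j : Fin 7) :
    ∑ l, a i l * ∑ d, tensorBC δ l j d * q d - ∑ l, (∑ d, tensorBC δ i l d * q d) * a l j
      - ∑ c, tensorBC δ i j c * ∑ b, a c b * q b = 0 := by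
  have e1 : ∑ l, a i l * ∑ d, tensorBC δ l j d * q d =
      ∑ d, q d * ∑ l, a i l * tensorBC δ l j d := by
    simp only [Finset.mul_sum]
    rw [Finset.sum_comm]
    exact Finset.sum_congr rfl fun _ _ => Finset.sum_congr rfl fun _ _ => by ring
  have e2 : ∑ l, (∑ d, tensorBC δ i l d * q d) * a l j =
      -∑ d, q d * ∑ l, a j l * tensorBC δ i l d := by
    simp only [Finset.mul_sum, Finset.sum_mul]
    rw [Finset.sum_comm, ← Finset.sum_neg_distrib]
    refine Finset.sum_congr rfl fun d _ => ?_
    rw [← Finset.sum_neg_distrib]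
    exact Finset.sum_congr rfl fun l _ => by rw [ha.skew j l]; ring
  have e3 : ∑ c, tensorBC δ i j c * ∑ b, a c b * q b =
      -∑ d, q d * ∑ l, a d l * tensorBC δ i j l := by
    simp only [Finset.mul_sum]
    rw [Finset.sum_comm, ← Finset.sum_neg_distrib]
    refine Finset.sum_congr rfl fun d _ => ?_
    rw [← Finset.sum_neg_distrib]
    exact Finset.sum_congr rfl fun l _ => by rw [ha.skew d l]; ring
  rw [e1, e2, e3, sub_neg_eq_add, sub_neg_eq_add, ← Finset.sum_add_distrib,
    ← Finset.sum_add_distrib]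
  refine Finset.sum_eq_zero fun d _ => ?_
  rw [← mul_add, ← mul_add, ← Finset.sum_add_distrib, ← Finset.sum_add_distrib,
    ha.tensorBC_invariant δ i j d, mul_zero]

/-- The quadratic part of the curvature of `a + s m`. -/
theorem sum_commutator_add_smul {ι : Type*} [Fintype ι] (a b m n : ι → ι → ℝ) (s : ℝ) (i j : ι) :
    ∑ l, ((a i l + s * m i l) * (b l j + s * n l j) - (b i l + s * n i l) * (a l j + s * m l j)) =
      ∑ l, (a i l * b l j - b i l * a l j)
      + s * ((∑ l, a i l * n l j - ∑ l, n i l * a l j) - (∑ l, b i l * m l j - ∑ l, m i l * b l j))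
      + s ^ 2 * ∑ l, (m i l * n l j - n i l * m l j) := by
  simp only [← Finset.sum_sub_distrib, Finset.mul_sum, ← Finset.sum_add_distrib]
  exact Finset.sum_congr rfl fun l _ => by ring

end Invariance

namespace ContactCalabiYau.Coframe

open Filter Topology

variable {K : Type*} [TopologicalSpace K] [ChartedSpace E7 K] [IsManifold (𝓡 7) ∞ K]
  {S : ContactCalabiYau K} {F : S.Coframe}
  {Γ : Matrix (Fin 3 ⊕ Fin 3) (Fin 3 ⊕ Fin 3) (DiffForm K ℝ 1)}

/-- The curvature `dΓ + Γ ∧ Γ` of the transverse connection, evaluated on two tangent vectors. -/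
def connCurv (Γ : Matrix (Fin 3 ⊕ Fin 3) (Fin 3 ⊕ Fin 3) (DiffForm K ℝ 1)) (i j : Fin 7) (x : K)
    (X Y : TangentSpace (𝓡 7) x) : ℝ :=
  extD (conn Γ i j) x ![X, Y] +
    ∑ l, (conn Γ i l x ![X] * conn Γ l j x ![Y] - conn Γ i l x ![Y] * conn Γ l j x ![X])

omit [IsManifold (𝓡 7) ∞ K] in
theorem connCurv_swap (i j : Fin 7) (x : K) (X Y : TangentSpace (𝓡 7) x) :
    connCurv Γ i j x Y X = -connCurv Γ i j x X Y := by
  rw [connCurv, connCurv, twoForm_swap, neg_add, ← Finset.sum_neg_distrib]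
  congr 1
  exact Finset.sum_congr rfl fun l _ => by ring

omit [IsManifold (𝓡 7) ∞ K] in
theorem connCurv_zero (j : Fin 7) (x : K) (X Y : TangentSpace (𝓡 7) x) :
    connCurv Γ 0 j x X Y = 0 := by
  simp only [connCurv, conn_zero_left, extD_zero]
  simp

namespace IsTransverseLeviCivita

variable (h : F.IsTransverseLeviCivita Γ)
include h

theorem connCurv_skew (i j : Fin 7) {x : K} (hx : x ∈ F.U) (X Y : TangentSpace (𝓡 7) x) :
    connCurv Γ j i x X Y = -connCurv Γ i j x X Y := by
  have e : extD (conn Γ j i) x = -extD (conn Γ i j) x := by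
    rw [← extD_neg]
    refine extD_congr ?_
    filter_upwards [F.eventually_mem hx] with z hz using h.conn_skew i j hz
  have hs : ∀ i j X, conn Γ j i x ![X] = -conn Γ i j x ![X] := fun i j X =>
    congrArg (fun α => α ![X]) (h.conn_skew i j hx)
  rw [connCurv, connCurv, e, neg_add, ← Finset.sum_neg_distrib]
  congr 1
  refine Finset.sum_congr rfl fun l _ => ?_
  rw [hs l j, hs l j, hs i l, hs i l]
  ring

/-- The first Bianchi identity. -/
theorem connCurv_bianchi {ε : ℝ} {x : K} (hx : x ∈ F.U) {v : Fin 7 → TangentSpace (𝓡 7) x}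
    (hv : IsDualFrame (F.cofAt ε x) v) (i a b c : Fin 7) :
    connCurv Γ i a x (v b) (v c) + connCurv Γ i b x (v c) (v a) + connCurv Γ i c x (v a) (v b)
      = 0 := by
  by_cases hi : i = 0
  · subst hi
    simp only [connCurv_zero, add_zero]
  have hd : ∀ a b, F.cof ε a x ![v b] = delta a b := hv.apply
  have sm : ∀ a, SmoothFormAt (F.cof ε a) x := fun a => F.smoothFormAt_cof ε a hx
  have key : extD (∑ l, wedgeF (conn Γ i l) (F.cof ε l) : DiffForm K ℝ 2) x = 0 := by
    rw [← neg_eq_zero, ← extD_neg]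
    refine Eq.trans (extD_congr ?_).symm (extD_extD (α := F.cof ε i) ?_)
    · filter_upwards [F.eventually_mem hx] with z hz
      rw [h.extD_cof ε i hz, if_neg hi, zero_smul, zero_sub, Pi.neg_apply, Finset.sum_apply]
    · filter_upwards [F.eventually_mem hx] with z hz using F.smoothFormAt_cof ε i hz
  rw [extD_sum fun l _ => (h.smoothFormAt_conn i l hx).wedge_one_one (sm l)] at key
  have e : ∑ l, leibnizTwo (fun a => conn Γ i l x ![v a]) (fun a => F.cof ε l x ![v a])
      (fun a b => extD (conn Γ i l) x ![v a, v b]) (fun a b => extD (F.cof ε l) x ![v a, v b])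
      a b c = 0 := by
    have := DFunLike.congr_fun key ![v a, v b, v c]
    rw [ContinuousAlternatingMap.sum_apply] at this
    refine Eq.trans (Finset.sum_congr rfl fun l _ => ?_) this
    exact (extD_wedge_one_one (h.smoothFormAt_conn i l hx) (sm l) (v a) (v b) (v c)).symm
  have hi0 : ∀ X, conn Γ i 0 x ![X] = 0 := fun X => by
    have := congrArg (fun α => α ![X]) (h.conn_skew 0 i hx)
    refine this.trans ?_
    rw [conn_zero_left]
    exact neg_zero
  have hde : ∀ l X b c, conn Γ i l x ![X] * extD (F.cof ε l) x ![v b, v c] =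
      conn Γ i l x ![X] * (conn Γ l b x ![v c] - conn Γ l c x ![v b]) := fun l X b c => by
    by_cases hl : l = 0
    · subst hl
      rw [hi0, zero_mul, zero_mul]
    · rw [h.extD_cof_frame hx hv hl]
      rfl
  have hs : ∀ a b, extD (conn Γ i a) x ![v b, v c] = -extD (conn Γ i a) x ![v c, v b] :=
    fun a b => twoForm_swap _ _ _
  have hsum : ∀ a (f : Fin 7 → ℝ), ∑ l, f l * delta l a = f a := fun a f => by simp [delta]
  simp only [leibnizTwo, hd, hde, Finset.sum_add_distrib, Finset.sum_sub_distrib, hsum] at e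
  simp only [connCurv, Finset.sum_sub_distrib]
  simp only [mul_sub, Finset.sum_sub_distrib] at e
  have hca := twoForm_swap (extD (conn Γ i b) x) (v c) (v a)
  linarith

/-- The curvature of an `𝔰𝔲(3)`-valued connection is `𝔰𝔲(3)`-valued. -/
theorem sum_connCurv {ε : ℝ} (hε : ε ≠ 0) {x : K} (hx : x ∈ F.U) (X Y : TangentSpace (𝓡 7) x)
    (c : Fin 7) : ∑ k, connCurv Γ (pairFst c k) (pairSnd c k) x X Y = 0 := by
  have e : ∑ k, extD (conn Γ (pairFst c k) (pairSnd c k)) x = 0 := by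
    rw [← extD_sum fun k _ => h.smoothFormAt_conn _ _ hx]
    refine Eq.trans (extD_congr ?_) (extD_zero x)
    filter_upwards [F.eventually_mem hx] with z hz
    refine oneForm_ext fun Z => ?_
    rw [Finset.sum_apply, ContinuousAlternatingMap.sum_apply]
    exact (h.isSU3 hε hz Z).contract c
  have e' := DFunLike.congr_fun e ![X, Y]
  rw [ContinuousAlternatingMap.sum_apply] at e'
  simp only [connCurv, Finset.sum_add_distrib, e']
  rw [(h.isSU3 hε hx X).commutator (h.isSU3 hε hx Y) c]
  simp

/-- The curvature of the transverse Levi-Civita connection satisfies the instanton equation, by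
its pair symmetry. -/
theorem sum_connCurv_frame {ε : ℝ} (hε : ε ≠ 0) {x : K} (hx : x ∈ F.U)
    {v : Fin 7 → TangentSpace (𝓡 7) x} (hv : IsDualFrame (F.cofAt ε x) v) (i j c : Fin 7) :
    ∑ k, connCurv Γ i j x (v (pairFst c k)) (v (pairSnd c k)) = 0 := by
  rw [← h.sum_connCurv hε hx (v i) (v j) c]
  exact Finset.sum_congr rfl fun k _ =>
    pair_symmetry (r := fun i j a b => connCurv Γ i j x (v a) (v b))
      (fun i j a b => h.connCurv_skew i j hx _ _) (fun i j a b => connCurv_swap i j x _ _)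
      (fun i a b c => h.connCurv_bianchi hx hv i a b c) i j _ _

end IsTransverseLeviCivita
end ContactCalabiYau.Coframe

/-! ### The curvature of `θ` -/

namespace ContactCalabiYau.Coframe

open Filter Topology

variable {K : Type*} [TopologicalSpace K] [ChartedSpace E7 K] [IsManifold (𝓡 7) ∞ K]
  {S : ContactCalabiYau K} {F : S.Coframe}
  {Γ : Matrix (Fin 3 ⊕ Fin 3) (Fin 3 ⊕ Fin 3) (DiffForm K ℝ 1)}

theorem theta_idx (F : S.Coframe) (Γ : Matrix (Fin 3 ⊕ Fin 3) (Fin 3 ⊕ Fin 3) (DiffForm K ℝ 1))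
    (ε δ k : ℝ) (i j : Fin 7) : F.theta Γ ε δ k (idx i) (idx j) =
      conn Γ i j + (k * ε / 2) • ∑ c, tensorBC δ i j c • F.cof ε c := by
  have e : ∑ c, tensorBC δ i j c • F.cof ε c =
      F.matB ε (idx i) (idx j) + δ • F.matC ε (idx i) (idx j) := by
    rw [matB_idx, matC_idx, Finset.smul_sum, ← Finset.sum_add_distrib]
    refine Finset.sum_congr rfl fun c _ => ?_
    rw [tensorBC, add_smul, mul_smul]
  rw [e]
  rfl

/-- `ω` contracted with the pairs of index pairs that define the 6-forms. -/
theorem sum_omega_frame {ε : ℝ} {x : K} (hx : x ∈ F.U) {v : Fin 7 → TangentSpace (𝓡 7) x}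
    (hv : IsDualFrame (F.cofAt ε x) v) (c : Fin 7) :
    ∑ k, S.omega x ![v (pairFst c k), v (pairSnd c k)] = if c = 0 then 3 else 0 := by
  have hm : ∀ a b p q, (mono (F.cofAt ε x) ![a, b]) ![v p, v q] =
      delta a p * delta b q - delta a q * delta b p := fun a b p q => by
    rw [← wedge_mono_one]
    refine (wedge_one_one_apply _ _ _ _).trans ?_
    rw [hv.apply, hv.apply, hv.apply, hv.apply]
  have hω : ∀ p q, S.omega x ![v p, v q] = delta 1 p * delta 4 q - delta 1 q * delta 4 p +
      (delta 2 p * delta 5 q - delta 2 q * delta 5 p) +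
      (delta 3 p * delta 6 q - delta 3 q * delta 6 p) := fun p q => by
    rw [F.omega_eq_omegaOf ε hx, omegaOf]
    simp only [ContinuousAlternatingMap.add_apply, hm]
  simp only [hω]
  fin_cases c <;> simp [Fin.sum_univ_three, pairFst, pairSnd, delta]
  norm_num

namespace IsTransverseLeviCivita

variable (h : F.IsTransverseLeviCivita Γ)
include h

/-- The curvature of `θ = A + s (B + δ C)`, where `s = kε/2`: as `B + δ C` has parallel
coefficients, its covariant derivative only involves the torsion `dη = ω` of the coframe. -/
theorem curvature_apply {ε : ℝ} (hε : ε ≠ 0) (δ k : ℝ) {x : K} (hx : x ∈ F.U) (i j : Fin 7)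
    (X Y : TangentSpace (𝓡 7) x) :
    curvature (F.theta Γ ε δ k) (idx i) (idx j) x ![X, Y] = connCurv Γ i j x X Y +
      k * ε / 2 * (tensorBC δ i j 0 * (ε * S.omega x ![X, Y])) +
      (k * ε / 2) ^ 2 * ∑ l, ((∑ d, tensorBC δ i l d * F.cof ε d x ![X]) *
        (∑ d, tensorBC δ l j d * F.cof ε d x ![Y]) -
        (∑ d, tensorBC δ i l d * F.cof ε d x ![Y]) *
        (∑ d, tensorBC δ l j d * F.cof ε d x ![X])) := by
  set s := k * ε / 2 with hs
  have sm : ∀ a, SmoothFormAt (F.cof ε a) x := fun a => F.smoothFormAt_cof ε a hx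
  have hθ : ∀ i j Z, F.theta Γ ε δ k (idx i) (idx j) x ![Z] =
      conn Γ i j x ![Z] + s * ∑ d, tensorBC δ i j d * F.cof ε d x ![Z] := fun i j Z => by
    rw [theta_idx]
    have : ∑ d, tensorBC δ i j d * F.cof ε d x ![Z] =
        (∑ d, tensorBC δ i j d • F.cof ε d) x ![Z] := by
      rw [Finset.sum_apply, ContinuousAlternatingMap.sum_apply]
      rfl
    rw [this]
    rfl
  have hdθ : extD (F.theta Γ ε δ k (idx i) (idx j)) x ![X, Y] = extD (conn Γ i j) x ![X, Y] +
      s * ∑ d, tensorBC δ i j d * extD (F.cof ε d) x ![X, Y] := by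
    rw [theta_idx, extD_add (h.smoothFormAt_conn i j hx)
      ((SmoothFormAt.sum fun d _ => (sm d).const_smul _).const_smul _), extD_smul,
      extD_sum fun d _ => (sm d).const_smul _]
    simp only [extD_smul, ContinuousAlternatingMap.add_apply, ContinuousAlternatingMap.smul_apply,
      ContinuousAlternatingMap.sum_apply, smul_eq_mul]
    rw [hs]
  have hR : curvature (F.theta Γ ε δ k) (idx i) (idx j) x ![X, Y] =
      extD (F.theta Γ ε δ k (idx i) (idx j)) x ![X, Y] +
      ∑ l, (F.theta Γ ε δ k (idx i) (idx l) x ![X] * F.theta Γ ε δ k (idx l) (idx j) x ![Y] -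
        F.theta Γ ε δ k (idx i) (idx l) x ![Y] * F.theta Γ ε δ k (idx l) (idx j) x ![X]) := by
    have : curvature (F.theta Γ ε δ k) (idx i) (idx j) =
        extD (F.theta Γ ε δ k (idx i) (idx j)) +
        ∑ l, wedgeF (F.theta Γ ε δ k (idx i) l) (F.theta Γ ε δ k l (idx j)) := rfl
    rw [this, sum_idx, Pi.add_apply, Finset.sum_apply, ContinuousAlternatingMap.add_apply,
      ContinuousAlternatingMap.sum_apply]
    congr 1
    exact Finset.sum_congr rfl fun l _ => wedge_one_one_apply _ _ _ _
  have pX := (h.isSU3 hε hx X).tensorBC_parallel δ (fun d => F.cof ε d x ![Y]) i j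
  have pY := (h.isSU3 hε hx Y).tensorBC_parallel δ (fun d => F.cof ε d x ![X]) i j
  have hcof : ∑ d, tensorBC δ i j d * extD (F.cof ε d) x ![X, Y] =
      tensorBC δ i j 0 * (ε * S.omega x ![X, Y])
      - (∑ d, tensorBC δ i j d * ∑ b, conn Γ d b x ![X] * F.cof ε b x ![Y])
      + ∑ d, tensorBC δ i j d * ∑ b, conn Γ d b x ![Y] * F.cof ε b x ![X] := by
    simp only [h.extD_cof_apply ε _ hx, mul_sub, Finset.sum_sub_distrib]
    simp
    ring
  rw [hR, hdθ, hcof, connCurv]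
  simp only [hθ]
  rw [sum_commutator_add_smul (fun i j => conn Γ i j x ![X]) (fun i j => conn Γ i j x ![Y])
    (fun i j => ∑ d, tensorBC δ i j d * F.cof ε d x ![X])
    (fun i j => ∑ d, tensorBC δ i j d * F.cof ε d x ![Y])]
  linear_combination s * pX - s * pY

/-- The coefficient of the 6-form number `c` in `R ∧ ψ`. The curvature of `A` contributes nothing;
the torsion term contributes `(3 k ε² / 2) (1 - δ) 𝓘`, and the quadratic term is given by
`contraction_tensor`. -/
theorem sum_curvature_frame {ε : ℝ} (hε : ε ≠ 0) (δ k : ℝ) {x : K} (hx : x ∈ F.U)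
    {v : Fin 7 → TangentSpace (𝓡 7) x} (hv : IsDualFrame (F.cofAt ε x) v) (i j c : Fin 7) :
    ∑ l, curvature (F.theta Γ ε δ k) (idx i) (idx j) x ![v (pairFst c l), v (pairSnd c l)] =
      k * ε ^ 2 * (1 - δ) * (6 + k * (1 + 3 * δ)) / 4 * tensorI i j c +
      k ^ 2 * ε ^ 2 / 4 * ((1 - 5 * δ) * (1 + δ) * tensorRow i j c +
        (δ ^ 2 - 4 * δ - 1) * tensorBox i j c) := by
  have hd : ∀ a b, F.cof ε a x ![v b] = delta a b := hv.apply
  have hsum : ∀ a (f : Fin 7 → ℝ), ∑ l, f l * delta l a = f a := fun a f => by simp [delta]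
  have hc := contraction_tensor δ i j c
  rw [contraction] at hc
  simp only [h.curvature_apply hε δ k hx, Finset.sum_add_distrib, h.sum_connCurv_frame hε hx hv,
    hd, hsum, ← Finset.mul_sum, sum_omega_frame hx hv]
  simp only [tensorBC] at hc ⊢
  rw [hc, ← tensorBC, tensorBC_zero]
  by_cases h0 : c = 0
  · subst h0
    rw [if_pos rfl]
    ring
  · rw [if_neg h0, tensorI_of_ne i j c h0]
    push_cast
    ring

/-- The formula for `R ∧ ψ`. -/
theorem wedge_curvature_psi {ε : ℝ} (hε : ε ≠ 0) (δ k : ℝ) {x : K} (hx : x ∈ F.U) (i j : Idx7) :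
    wedgeF (curvature (F.theta Γ ε δ k) i j) (S.ψ ε) x =
      (k * ε ^ 2 * (1 - δ) * (6 + k * (1 + 3 * δ)) / 4) • smulI S.sixthOmegaCube i j x +
      (k ^ 2 * ε ^ 2 / 4) • wedgeF (wedgeF (ε • S.η) S.halfOmegaSq) (F.matN δ i j) x := by
  obtain ⟨i, rfl⟩ := idx_bijective.surjective i
  obtain ⟨j, rfl⟩ := idx_bijective.surjective j
  obtain ⟨v, hv⟩ := F.exists_dual hε hx
  have hL : wedgeF (curvature (F.theta Γ ε δ k) (idx i) (idx j)) (S.ψ ε) x =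
      wedge (curvature (F.theta Γ ε δ k) (idx i) (idx j) x) (psiOf (F.cofAt ε x)) := by
    rw [← F.ψ_eq ε hx]
    rfl
  have hN : wedgeF (wedgeF (ε • S.η) S.halfOmegaSq) (F.matN δ (idx i) (idx j)) x =
      ∑ c, ((1 - 5 * δ) * (1 + δ) * tensorRow i j c + (δ ^ 2 - 4 * δ - 1) * tensorBox i j c) •
        sixFormOf (F.cofAt ε x) c := by
    rw [matN_idx F ε δ]
    have e : ∀ f : Fin 7 → ℝ, wedgeF (wedgeF (ε • S.η) S.halfOmegaSq)
        (∑ c, f c • F.cof ε c : DiffForm K ℝ 1) x =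
        ∑ c, f c • wedge (wedge ((ε • S.η) x) (S.halfOmegaSq x)) (F.cof ε c x) := fun f => by
      change wedge (wedge ((ε • S.η) x) (S.halfOmegaSq x)) ((∑ c, f c • F.cof ε c) x) = _
      rw [Finset.sum_apply, ← wedgeBilin_apply, map_sum]
      exact Finset.sum_congr rfl fun c _ => wedge_smul_right _ _ _
    rw [e]
    refine Finset.sum_congr rfl fun c _ => ?_
    by_cases hc : c = 0
    · subst hc
      rw [tensorRow_zero, tensorBox_zero]
      simp
    · rw [wedge_halfOmegaSq_cof F ε hx hc]
  have hI : smulI S.sixthOmegaCube (idx i) (idx j) x =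
      ∑ c, (tensorI i j c : ℝ) • sixFormOf (F.cofAt ε x) c := by
    rw [smulI_idx, Pi.smul_apply, sixthOmegaCube_eq F ε hx, Finset.sum_eq_single 0]
    · intro c _ hc
      rw [tensorI_of_ne i j c hc]
      simp
    · simp
  rw [hL, hv.wedge_psiOf, hN, hI, Finset.smul_sum, Finset.smul_sum]
  refine Eq.trans ?_ Finset.sum_add_distrib
  refine Finset.sum_congr rfl fun c _ => ?_
  rw [h.sum_curvature_frame hε δ k hx hv, smul_smul, smul_smul, ← add_smul]

/-- Wherever there is a coframe, the instanton equation fails: otherwise the components of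
`R ∧ ψ` along `e₀ ∧ ω²/2 ∧ e₁` and `e₀ ∧ ω²/2 ∧ Je₃` give two incompatible equations for `δ`. -/
theorem exists_wedge_curvature_psi_ne_zero {ε : ℝ} (hε : ε ≠ 0) (δ : ℝ) {k : ℝ} (hk : k ≠ 0) {x : K}
    (hx : x ∈ F.U) : ∃ i j, wedgeF (curvature (F.theta Γ ε δ k) i j) (S.ψ ε) x ≠ 0 := by
  by_contra! H
  obtain ⟨v, hv⟩ := F.exists_dual hε hx
  have key : ∀ i j c, (∀ d, d ≠ c → tensorI i j d = 0 ∧ tensorRow i j d = 0 ∧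
      tensorBox i j d = 0) → k * ε ^ 2 * (1 - δ) * (6 + k * (1 + 3 * δ)) / 4 * tensorI i j c +
      k ^ 2 * ε ^ 2 / 4 * ((1 - 5 * δ) * (1 + δ) * tensorRow i j c +
        (δ ^ 2 - 4 * δ - 1) * tensorBox i j c) = 0 := fun i j c hc => by
    have e : wedge (curvature (F.theta Γ ε δ k) (idx i) (idx j) x) (psiOf (F.cofAt ε x)) = 0 := by
      rw [← F.ψ_eq ε hx]
      exact H (idx i) (idx j)
    rw [hv.wedge_psiOf, Finset.sum_eq_single c] at e
    · rw [← h.sum_curvature_frame hε δ k hx hv i j c]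
      exact (smul_eq_zero.1 e).resolve_right (hv.sixFormOf_ne_zero c)
    · intro d _ hd
      obtain ⟨e1, e2, e3⟩ := hc d hd
      rw [h.sum_curvature_frame hε δ k hx hv i j d, e1, e2, e3]
      simp
    · simp
  -- the `e₁`-entry of the first row, and the `Je₃`-entry of `[Je]`
  have h1 := key 0 1 1 (by decide)
  have h2 := key 1 2 6 (by decide)
  rw [show tensorI 0 1 1 = 0 by decide, show tensorRow 0 1 1 = 1 by decide,
    show tensorBox 0 1 1 = 0 by decide] at h1
  rw [show tensorI 1 2 6 = 0 by decide, show tensorRow 1 2 6 = 0 by decide,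
    show tensorBox 1 2 6 = 1 by decide] at h2
  have hne : k ^ 2 * ε ^ 2 / 4 ≠ 0 := by positivity
  have h1' : (1 - 5 * δ) * (1 + δ) = 0 := by
    refine (mul_eq_zero.1 (Eq.trans ?_ h1)).resolve_left hne
    push_cast
    ring
  have h2' : δ ^ 2 - 4 * δ - 1 = 0 := by
    refine (mul_eq_zero.1 (Eq.trans ?_ h2)).resolve_left hne
    push_cast
    ring
  rcases mul_eq_zero.1 h1' with e | e
  · have : δ = 1 / 5 := by linarith
    subst this
    norm_num at h2'
  · have : δ = -1 := by linarith
    subst this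
    norm_num at h2'

end IsTransverseLeviCivita
end ContactCalabiYau.Coframe

/-! ### Invariance of the transverse metric under the Reeb flow -/

section Reeb

set_option maxHeartbeats 1000000 in
/-- The Reeb flow preserves `ω` and `Ω`, hence the transverse metric: the coefficients of
`L_ξ E_a` with respect to the coframe are skew-symmetric, since `𝔰𝔭(6) ∩ 𝔰𝔩(3, ℂ) ⊆ 𝔰𝔬(6)`. -/
theorem reeb_coeff_skew (d : Fin 7 → Fin 7 → Fin 7 → ℝ)
    (hω : ∀ a b c, leibnizTwo (delta 1) (delta 4) (d 1) (d 4) a b c +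
      leibnizTwo (delta 2) (delta 5) (d 2) (d 5) a b c +
      leibnizTwo (delta 3) (delta 6) (d 3) (d 6) a b c = 0)
    (hR : ∀ a b c e, leibnizThree (delta 1) (delta 2) (delta 3) (d 1) (d 2) (d 3) a b c e -
      leibnizThree (delta 1) (delta 5) (delta 6) (d 1) (d 5) (d 6) a b c e -
      leibnizThree (delta 4) (delta 2) (delta 6) (d 4) (d 2) (d 6) a b c e -
      leibnizThree (delta 4) (delta 5) (delta 3) (d 4) (d 5) (d 3) a b c e = 0)
    (hI : ∀ a b c e, leibnizThree (delta 1) (delta 2) (delta 6) (d 1) (d 2) (d 6) a b c e +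
      leibnizThree (delta 1) (delta 5) (delta 3) (d 1) (d 5) (d 3) a b c e +
      leibnizThree (delta 4) (delta 2) (delta 3) (d 4) (d 2) (d 3) a b c e -
      leibnizThree (delta 4) (delta 5) (delta 6) (d 4) (d 5) (d 6) a b c e = 0)
    {a c : Fin 7} (ha : a ≠ 0) (hc : c ≠ 0) : d a 0 c + d c 0 a = 0 := by
  have w12 := hω 0 1 2
  have w13 := hω 0 1 3
  have w14 := hω 0 1 4
  have w23 := hω 0 2 3
  have w24 := hω 0 2 4
  have w25 := hω 0 2 5
  have w34 := hω 0 3 4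
  have w35 := hω 0 3 5
  have w36 := hω 0 3 6
  have r123 := hR 0 1 2 3
  have r124 := hR 0 1 2 4
  have r125 := hR 0 1 2 5
  have r126 := hR 0 1 2 6
  have r134 := hR 0 1 3 4
  have r135 := hR 0 1 3 5
  have r136 := hR 0 1 3 6
  have r234 := hR 0 2 3 4
  have r235 := hR 0 2 3 5
  have r236 := hR 0 2 3 6
  have i123 := hI 0 1 2 3
  have i124 := hI 0 1 2 4
  have i125 := hI 0 1 2 5
  have i126 := hI 0 1 2 6
  have i134 := hI 0 1 3 4
  have i135 := hI 0 1 3 5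
  have i136 := hI 0 1 3 6
  have i234 := hI 0 2 3 4
  have i235 := hI 0 2 3 5
  have i236 := hI 0 2 3 6
  simp [leibnizTwo, delta] at w12 w13 w14 w23 w24 w25 w34 w35 w36
  simp [leibnizThree, wedgeTwoOneOne, delta] at r123 r124 r125 r126 r134 r135 r136 r234 r235 r236
  simp [leibnizThree, wedgeTwoOneOne, delta] at i123 i124 i125 i126 i134 i135 i136 i234 i235 i236
  fin_cases a <;> fin_cases c <;> simp at ha hc ⊢ <;> linarith

end Reeb

/-! ### Smoothness of the dual frame -/

section DualFrameSmooth

open Filter Topology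

/-- The linear map of `E7` with components the given 1-forms. -/
def coframeCLM : (Fin 7 → E7 [⋀^Fin 1]→L[ℝ] ℝ) →ₗ[ℝ] E7 →L[ℝ] E7 where
  toFun α := (EuclideanSpace.equiv (Fin 7) ℝ).symm.toContinuousLinearMap ∘L
    ContinuousLinearMap.pi fun a => LinearMap.toContinuousLinearMap (oneFormLin (α a))
  map_add' α β := by
    ext X a
    rfl
  map_smul' c α := by
    ext X a
    rfl

/-- The frame dual to a smooth coframe is smooth. -/
theorem contDiffAt_dualFrame {E : Fin 7 → E7 → E7 [⋀^Fin 1]→L[ℝ] ℝ} {w : Fin 7 → E7 → E7} {y : E7}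
    (hE : ∀ a, ContDiffAt ℝ ∞ (E a) y) (hw : ∀ᶠ z in 𝓝 y, ∀ a b, E a z ![w b z] = delta a b)
    (b : Fin 7) : ContDiffAt ℝ ∞ (w b) y := by
  -- The dual frame is obtained by inverting the smooth matrix `L` of the coframe.
  let L : E7 → E7 →L[ℝ] E7 := fun z => coframeCLM fun a => E a z
  have hLa : ∀ z X a, L z X a = E a z ![X] := fun z X a => rfl
  have hL : ContDiffAt ℝ ∞ L y := by
    exact (LinearMap.toContinuousLinearMap coframeCLM).contDiff.contDiffAt.comp y
      (contDiffAt_pi.2 hE)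
  have hLw : ∀ᶠ z in 𝓝 y, ∀ b, L z (w b z) = EuclideanSpace.single b 1 := by
    filter_upwards [hw] with z hz b
    ext a
    rw [hLa, hz, delta]
    simp
  have hbij : ∀ z, (∀ b, L z (w b z) = EuclideanSpace.single b 1) →
      ∃ e : E7 ≃L[ℝ] E7, (e : E7 →L[ℝ] E7) = L z := fun z hz => by
    have hs : Function.Surjective (L z).toLinearMap := fun Y => by
      refine ⟨∑ b, Y b • w b z, ?_⟩
      rw [map_sum]
      simp only [map_smul, ContinuousLinearMap.coe_coe, hz]
      ext a
      simp [Pi.single_apply]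
    have hi := LinearMap.injective_iff_surjective.2 hs
    refine ⟨(LinearEquiv.ofBijective (L z).toLinearMap ⟨hi, hs⟩).toContinuousLinearEquiv, ?_⟩
    ext X : 1
    rfl
  obtain ⟨e, he⟩ := hbij y hLw.self_of_nhds
  have hinv : ContDiffAt ℝ ∞ (fun z => (L z).inverse (EuclideanSpace.single b (1 : ℝ))) y := by
    have := contDiffAt_map_inverse (𝕜 := ℝ) (n := ∞) e
    rw [he] at this
    exact (this.comp y hL).clm_apply contDiffAt_const
  refine hinv.congr_of_eventuallyEq ?_
  filter_upwards [hLw] with z hz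
  obtain ⟨e, he⟩ := hbij z hz
  rw [← hz b, ← he, ContinuousLinearMap.inverse_equiv]
  exact (e.symm_apply_apply _).symm

end DualFrameSmooth

section FormsOnVectorFields

open Filter Topology

variable {K : Type*} [TopologicalSpace K] [ChartedSpace E7 K] [IsManifold (𝓡 7) ∞ K]
variable {A : Type*} [NormedAddCommGroup A] [NormedSpace ℝ A]

/-- In a chart, a form takes on the coordinate expressions of tangent vectors the value that it
takes on these vectors. -/
theorem chartRep_apply_mfderiv {n : ℕ} (α : DiffForm K A n) {x x' : K}
    (hx : x' ∈ (extChartAt (𝓡 7) x).source) (w : Fin n → TangentSpace (𝓡 7) x') :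
    chartRep α x (extChartAt (𝓡 7) x x')
      (fun i => mfderiv (𝓡 7) 𝓘(ℝ, E7) (extChartAt (𝓡 7) x) x' (w i)) = α x' w := by
  have aux : ∀ (z z' : K) (_ : z = z') (L : E7 →L[ℝ] E7) (w w' : Fin n → E7),
      (∀ i, L (w' i) = w i) →
      ((α z).compContinuousLinearMap L : E7 [⋀^Fin n]→L[ℝ] A) w' = (α z' : E7 [⋀^Fin n]→L[ℝ] A) w
      := by
    rintro z _ rfl L w w' hw
    exact congrArg (α z) (funext hw)
  refine aux _ _ ((extChartAt (𝓡 7) x).left_inv hx) _ w _ fun i => ?_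
  exact DFunLike.congr_fun (mfderiv_symm_comp_extChartAt hx) (w i)

theorem chartRep_apply_symm {n : ℕ} {A : Type*} [NormedAddCommGroup A] [NormedSpace ℝ A]
    (α : DiffForm K A n) {z : K} {y : E7}
    (hy : y ∈ (extChartAt (𝓡 7) z).target) (w : Fin n → (x : K) → TangentSpace (𝓡 7) x) :
    chartRep α z y (fun i => mfderiv (𝓡 7) 𝓘(ℝ, E7) (extChartAt (𝓡 7) z)
      ((extChartAt (𝓡 7) z).symm y) (w i ((extChartAt (𝓡 7) z).symm y))) =
      α ((extChartAt (𝓡 7) z).symm y) fun i => w i ((extChartAt (𝓡 7) z).symm y) := by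
  have := chartRep_apply_mfderiv α ((extChartAt (𝓡 7) z).map_target hy)
    fun i => w i ((extChartAt (𝓡 7) z).symm y)
  rwa [(extChartAt (𝓡 7) z).right_inv hy] at this

end FormsOnVectorFields

namespace ContactCalabiYau.Coframe

open Filter Topology

variable {K : Type*} [TopologicalSpace K] [ChartedSpace E7 K] [IsManifold (𝓡 7) ∞ K]
  {S : ContactCalabiYau K} (F : S.Coframe)

open Classical in
/-- The frame dual to the coframe `(η, e, Je)` on `U`. -/
def dualFrame (x : K) : Fin 7 → TangentSpace (𝓡 7) x :=
  if hx : x ∈ F.U then (F.exists_dual one_ne_zero hx).choose else 0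

theorem isDualFrame {x : K} (hx : x ∈ F.U) : IsDualFrame (F.cofAt 1 x) (F.dualFrame x) := by
  rw [dualFrame, dif_pos hx]
  exact (F.exists_dual one_ne_zero hx).choose_spec

/-- The values of a smooth form on the dual frame are smooth functions. -/
theorem contDiffAt_form_dualFrame {n : ℕ} {α : DiffForm K ℝ n} {x : K} (hx : x ∈ F.U)
    (hα : SmoothFormAt α x) (t : Fin n → Fin 7) :
    ContDiffAt ℝ ∞ (fun y => α ((extChartAt (𝓡 7) x).symm y)
      fun i => F.dualFrame ((extChartAt (𝓡 7) x).symm y) (t i)) (extChartAt (𝓡 7) x x) := by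
  let w : Fin 7 → E7 → E7 := fun b y =>
    mfderiv (𝓡 7) 𝓘(ℝ, E7) (extChartAt (𝓡 7) x) ((extChartAt (𝓡 7) x).symm y)
      (F.dualFrame ((extChartAt (𝓡 7) x).symm y) b)
  have key : ∀ {m : ℕ} (β : DiffForm K ℝ m) {y : E7} (_ : y ∈ (extChartAt (𝓡 7) x).target)
      (t : Fin m → Fin 7), chartRep β x y (fun i => w (t i) y) =
      β ((extChartAt (𝓡 7) x).symm y) fun i => F.dualFrame ((extChartAt (𝓡 7) x).symm y) (t i) :=
    fun β _ hy t => chartRep_apply_symm β hy fun i x => F.dualFrame x (t i)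
  have htgt := (isOpen_extChartAt_target (I := 𝓡 7) x).mem_nhds (mem_extChartAt_target x)
  have hw : ∀ b, ContDiffAt ℝ ∞ (w b) (extChartAt (𝓡 7) x x) := fun b => by
    refine contDiffAt_dualFrame (E := fun a => chartRep (F.cof 1 a) x)
      (fun a => F.smoothFormAt_cof 1 a hx) ?_ b
    filter_upwards [htgt, (tendsto_symm_nhds x).eventually (F.eventually_mem hx)] with y hy hyU a b
    rw [← (F.isDualFrame hyU).apply a b]
    refine Eq.trans ?_ ((key (F.cof 1 a) hy ![b]).trans ?_)
    · congr 1
      funext i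
      rw [Matrix.cons_val_fin_one, Matrix.cons_val_fin_one]
    · refine congrArg _ ?_
      funext i
      rw [Matrix.cons_val_fin_one, Matrix.cons_val_fin_one]
  refine (contDiffAt_form_apply hα fun i => hw (t i)).congr_of_eventuallyEq ?_
  filter_upwards [htgt] with y hy using (key α hy t).symm

end ContactCalabiYau.Coframe

/-! ### Existence of the transverse Levi-Civita connection -/

namespace ContactCalabiYau.Coframe

open Filter Topology

variable {K : Type*} [TopologicalSpace K] [ChartedSpace E7 K] [IsManifold (𝓡 7) ∞ K]
  {S : ContactCalabiYau K} (F : S.Coframe)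

/-- The structure coefficients of the transverse coframe, extended by zero to the index of `η`. -/
def transverseCoeff (x : K) (a b c : Fin 7) : ℝ :=
  if a = 0 then 0 else F.structureCoeff 1 (F.dualFrame x) a b c

/-- The coefficient `Γ_ab (v_c)` given by the Koszul formula. -/
def koszulCoeff (x : K) (a b c : Fin 7) : ℝ :=
  1 / 2 * (F.transverseCoeff x a b c - F.transverseCoeff x b a c - F.transverseCoeff x c a b)

theorem transverseCoeff_swap (x : K) (a b c : Fin 7) :
    F.transverseCoeff x a c b = -F.transverseCoeff x a b c := by
  rw [transverseCoeff, transverseCoeff]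
  split_ifs
  · simp
  · exact twoForm_swap _ _ _

/-- The invariance of the transverse metric under the Reeb flow makes the structure coefficients
with one index along `ξ` skew-symmetric in the other two. -/
theorem transverseCoeff_zero {x : K} (hx : x ∈ F.U) (a c : Fin 7) :
    F.transverseCoeff x a 0 c + F.transverseCoeff x c 0 a = 0 := by
  have hd := F.transverseCoeff_swap x
  by_cases ha : a = 0
  · subst ha
    have : F.transverseCoeff x c 0 0 = 0 := by linarith [hd c 0 0]
    rw [this, transverseCoeff, if_pos rfl, add_zero]
  by_cases hc : c = 0
  · subst hc
    have : F.transverseCoeff x a 0 0 = 0 := by linarith [hd a 0 0]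
    rw [this, transverseCoeff, if_pos rfl, add_zero]
  rw [transverseCoeff, transverseCoeff, if_neg ha, if_neg hc]
  obtain ⟨hω, hR, hI⟩ := closed_frame hx (F.isDualFrame hx)
  exact reeb_coeff_skew _ hω hR hI ha hc

theorem koszulCoeff_skew (x : K) (a b c : Fin 7) :
    F.koszulCoeff x b a c = -F.koszulCoeff x a b c := by
  rw [koszulCoeff, koszulCoeff, F.transverseCoeff_swap x c a b]
  ring

theorem koszulCoeff_zero {x : K} (hx : x ∈ F.U) (a c : Fin 7) : F.koszulCoeff x a 0 c = 0 := by
  have h1 := F.transverseCoeff_zero hx a c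
  have h2 := F.transverseCoeff_swap x c 0 a
  have h3 : F.transverseCoeff x 0 a c = 0 := if_pos rfl
  rw [koszulCoeff]
  linarith

/-- The connection given by the Koszul formula is torsion-free. -/
theorem koszulCoeff_sub (x : K) (a b c : Fin 7) :
    F.koszulCoeff x a b c - F.koszulCoeff x a c b = F.transverseCoeff x a b c := by
  have h1 := F.transverseCoeff_swap x a b c
  rw [koszulCoeff, koszulCoeff]
  linarith

/-- The 1-forms of the transverse Levi-Civita connection, indexed by `Fin 7`. -/
def koszulForm (a b : Fin 7) : DiffForm K ℝ 1 := fun x => ∑ c, F.koszulCoeff x a b c • F.cof 1 c x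

theorem koszulForm_frame {x : K} (hx : x ∈ F.U) (a b c : Fin 7) :
    F.koszulForm a b x ![F.dualFrame x c] = F.koszulCoeff x a b c := by
  have hd : ∀ a b, F.cof 1 a x ![F.dualFrame x b] = delta a b := (F.isDualFrame hx).apply
  rw [koszulForm, ContinuousAlternatingMap.sum_apply]
  simp only [ContinuousAlternatingMap.smul_apply, hd, delta]
  simp

theorem smoothFormAt_koszulForm (a b : Fin 7) {x : K} (hx : x ∈ F.U) :
    SmoothFormAt (F.koszulForm a b) x := by
  have hT : ∀ a b c, ContDiffAt ℝ ∞
      (fun y => F.transverseCoeff ((extChartAt (𝓡 7) x).symm y) a b c) (extChartAt (𝓡 7) x x) := by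
    intro a b c
    by_cases ha : a = 0
    · simp only [transverseCoeff, if_pos ha]
      exact contDiffAt_const
    · simp only [transverseCoeff, if_neg ha, structureCoeff]
      have hs : SmoothFormAt (extD (F.cof 1 a)) x := smoothFormAt_extD (by
        filter_upwards [F.eventually_mem hx] with z hz using F.smoothFormAt_cof 1 a hz)
      refine (F.contDiffAt_form_dualFrame hx hs ![b, c]).congr_of_eventuallyEq
        (Eventually.of_forall fun y => congrArg _ ?_)
      funext i
      fin_cases i <;> rfl
  have e : chartRep (F.koszulForm a b) x = fun y => ∑ c,
      F.koszulCoeff ((extChartAt (𝓡 7) x).symm y) a b c • chartRep (F.cof 1 c) x y := by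
    have happ : ∀ (z : K) (w : Fin 1 → TangentSpace (𝓡 7) z), F.koszulForm a b z w =
        ∑ c, F.koszulCoeff z a b c * F.cof 1 c z w := fun z w => by
      rw [koszulForm, ContinuousAlternatingMap.sum_apply]
      rfl
    funext y
    ext v
    rw [ContinuousAlternatingMap.sum_apply]
    exact happ _ _
  rw [SmoothFormAt, e]
  refine ContDiffAt.sum fun c _ => ContDiffAt.fun_smul ?_ (F.smoothFormAt_cof 1 c hx)
  exact contDiffAt_const.mul (((hT a b c).sub (hT b a c)).sub (hT c a b))

/-- The index of a transverse 1-form in the coframe `(η, e, Je)`. -/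
def trIdx : Fin 3 ⊕ Fin 3 → Fin 7 := Sum.elim ![1, 2, 3] ![4, 5, 6]

/-- Every coframe carries a transverse Levi-Civita connection. -/
theorem exists_isTransverseLeviCivita : ∃ Γ, F.IsTransverseLeviCivita Γ := by
  have htr : ∀ i, F.tr i = F.cof 1 (trIdx i) := by
    rintro (i | i) <;> fin_cases i <;> rfl
  have h0 : ∀ i, trIdx i ≠ 0 := by decide
  refine ⟨fun i j => F.koszulForm (trIdx i) (trIdx j),
    fun i j x hx => F.smoothFormAt_koszulForm _ _ hx, fun i j x hx => ?_, fun i x hx => ?_⟩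
  · rw [koszulForm, koszulForm, ← Finset.sum_neg_distrib]
    exact Finset.sum_congr rfl fun c _ => by rw [koszulCoeff_skew, neg_smul]
  · have hv := F.isDualFrame hx
    have hd : ∀ a b, F.cof 1 a x ![F.dualFrame x b] = delta a b := hv.apply
    have key : ∀ b c, extD (F.tr i) x ![F.dualFrame x b, F.dualFrame x c] =
        (-∑ j, wedgeF (F.koszulForm (trIdx i) (trIdx j)) (F.tr j) x)
          ![F.dualFrame x b, F.dualFrame x c] := fun b c => by
      have hw : ∀ j, wedgeF (F.koszulForm (trIdx i) (trIdx j)) (F.tr j) x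
          ![F.dualFrame x b, F.dualFrame x c] =
          F.koszulCoeff x (trIdx i) (trIdx j) b * delta (trIdx j) c -
          F.koszulCoeff x (trIdx i) (trIdx j) c * delta (trIdx j) b := fun j => by
        refine (wedge_one_one_apply _ _ _ _).trans ?_
        rw [koszulForm_frame F hx, koszulForm_frame F hx, htr, hd, hd]
      rw [ContinuousAlternatingMap.neg_apply, ContinuousAlternatingMap.sum_apply]
      simp only [hw]
      have hsum : ∀ f : Fin 7 → ℝ, f 0 = 0 → ∑ j, f (trIdx j) = ∑ a, f a := fun f hf => by
        rw [Fintype.sum_sum_type, Fin.sum_univ_seven, hf]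
        simp [Fin.sum_univ_three, trIdx]
        ring
      rw [hsum fun a => F.koszulCoeff x (trIdx i) a b * delta a c -
          F.koszulCoeff x (trIdx i) a c * delta a b]
      · have := F.koszulCoeff_sub x (trIdx i) b c
        rw [transverseCoeff, if_neg (h0 i), structureCoeff, ← htr] at this
        rw [← this]
        simp [delta]
      · rw [koszulCoeff_zero F hx, koszulCoeff_zero F hx, zero_mul, zero_mul, sub_zero]
    refine twoForm_ext fun X Y => ?_
    rw [hv.twoForm_apply, hv.twoForm_apply]
    exact Finset.sum_congr rfl fun b _ => Finset.sum_congr rfl fun c _ => by rw [key]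

end ContactCalabiYau.Coframe

/-! ### Special unitary coframes at a point -/

section PointwiseCoframe

variable {V : Type*} [AddCommGroup V] [Module ℝ V] [TopologicalSpace V]

theorem threeForm_rotate {A : Type*} [NormedCommRing A] [NormedAlgebra ℝ A]
    (α : V [⋀^Fin 3]→L[ℝ] A) (X Y Z : V) : α ![Y, Z, X] = α ![X, Y, Z] := by
  have := α.toAlternatingMap.map_perm ![X, Y, Z] (finRotate 3)
  rw [show (![X, Y, Z] ∘ ⇑(finRotate 3)) = ![Y, Z, X] by
    funext i; fin_cases i <;> rfl, show Equiv.Perm.sign (finRotate 3) = 1 by decide,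
    one_smul] at this
  exact this

theorem threeForm_swap {A : Type*} [NormedCommRing A] [NormedAlgebra ℝ A]
    (α : V [⋀^Fin 3]→L[ℝ] A) (X Y Z : V) : α ![Y, X, Z] = -α ![X, Y, Z] := by
  have := α.toAlternatingMap.map_swap ![X, Y, Z] (i := 0) (j := 1) (by decide)
  rw [show (![X, Y, Z] ∘ ⇑(Equiv.swap (0 : Fin 3) 1)) = ![Y, X, Z] by
    funext i; fin_cases i <;> rfl] at this
  exact this

theorem twoForm_smul_right (α : V [⋀^Fin 2]→L[ℝ] ℝ) (c : ℝ) (v w : V) :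
    α ![v, c • w] = c * α ![v, w] := by
  rw [twoForm_swap, twoForm_smul_left, twoForm_swap α w, smul_eq_mul, mul_neg, neg_neg]

theorem twoForm_sub_right (α : V [⋀^Fin 2]→L[ℝ] ℝ) (u v w : V) :
    α ![u, v - w] = α ![u, v] - α ![u, w] := (twoFormLin α u).map_sub v w

/-- The contraction `X ↦ α(X, w₁, …, wₙ)` of an `(n+1)`-form with `n` vectors. -/
def contractForm {A : Type*} [NormedCommRing A] [NormedAlgebra ℝ A] {n : ℕ}
    (α : V [⋀^Fin (n + 1)]→L[ℝ] A) (w : Fin n → V) : V [⋀^Fin 1]→L[ℝ] A :=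
  ContinuousAlternatingMap.ofSubsingleton ℝ V A (0 : Fin 1)
    (α.toContinuousMultilinearMap.toContinuousLinearMap (Matrix.vecCons 0 w) 0)

theorem contractForm_apply {A : Type*} [NormedCommRing A] [NormedAlgebra ℝ A] {n : ℕ}
    (α : V [⋀^Fin (n + 1)]→L[ℝ] A) (w : Fin n → V) (X : V) :
    contractForm α w ![X] = α (Matrix.vecCons X w) := by
  change α (Function.update (Matrix.vecCons 0 w) 0 X) = _
  congr 1
  exact Fin.update_cons_zero _ _ _

/-- A family of seven 1-forms with the duality relations is a coframe. -/
theorem isDualFrame_of_apply [FiniteDimensional ℝ V] (hV : Module.finrank ℝ V = 7)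
    {E : Fin 7 → V [⋀^Fin 1]→L[ℝ] ℝ} {v : Fin 7 → V} (h : ∀ a b, E a ![v b] = delta a b) :
    IsDualFrame E v := by
  let f : V →ₗ[ℝ] (Fin 7 → ℝ) := LinearMap.pi fun a => oneFormLin (E a)
  have hf : Function.Surjective f := fun Y => by
    refine ⟨∑ b, Y b • v b, ?_⟩
    rw [map_sum]
    funext a
    have : ∀ b, f (v b) a = delta a b := h a
    simp [this, delta]
  have hi : Function.Injective f :=
    (LinearMap.injective_iff_surjective_of_finrank_eq_finrank (by simp [hV])).2 hf
  refine ⟨h, fun X => hi ?_⟩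
  rw [map_sum]
  funext a
  have h1 : ∀ b, f (v b) a = delta a b := h a
  have h2 : f X a = E a ![X] := rfl
  simp [h1, h2, delta]

/-- Rotating and scaling the last complex covector of a unitary coframe by `a + i b` multiplies
the volume form by `a² + b²`. -/
theorem IsDualFrame.sq_add_sq_of_sixFormOf_eq {E : Fin 7 → V [⋀^Fin 1]→L[ℝ] ℝ} {v : Fin 7 → V}
    (hv : IsDualFrame E v) {a b : ℝ} (hvol : sixFormOf E 0 =
      sixFormOf ![E 0, E 1, E 2, a • E 3 - b • E 6, E 4, E 5, b • E 3 + a • E 6] 0) :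
    a ^ 2 + b ^ 2 = 1 := by
  set E' := ![E 0, E 1, E 2, a • E 3 - b • E 6, E 4, E 5, b • E 3 + a • E 6] with hE'd
  have hd : ∀ a b, E a ![v b] = delta a b := hv.apply
  have hE' : ∀ k l, E' k ![v l] = if k = 3 then a * delta 3 l - b * delta 6 l else
      if k = 6 then b * delta 3 l + a * delta 6 l else delta k l := fun k l => by
    fin_cases k
    · exact hd 0 l
    · exact hd 1 l
    · exact hd 2 l
    · exact congrArg₂ (fun x y => a * x - b * y) (hd 3 l) (hd 6 l)
    · exact hd 4 l
    · exact hd 5 l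
    · exact congrArg₂ (fun x y => b * x + a * y) (hd 3 l) (hd 6 l)
  clear_value E'
  obtain ⟨t, ht⟩ : ∃ t : Fin 6 → Fin 7, t = ![1, 4, 2, 5, 3, 6] := ⟨_, rfl⟩
  have hinj : Function.Injective t := by rw [ht]; decide
  have hsix : ∀ E : Fin 7 → V [⋀^Fin 1]→L[ℝ] ℝ, sixFormOf E 0 = mono E t := fun E => by
    rw [ht]
    exact sixFormOf_zero E
  -- On the frame the left side is `1`, and the right side is the determinant of a rotation block.
  have h0 : mono E' t (fun i => v (t i)) = 1 := by
    rw [← hsix, ← hvol, hsix]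
    exact hv.mono_apply hinj
  rw [mono, decomp_apply] at h0
  have hl : ∀ i, t ((finSumFinEquiv : Fin 4 ⊕ Fin 2 ≃ Fin 6) (Sum.inl i)) =
      (![1, 4, 2, 5] : Fin 4 → Fin 7) i := by
    rw [ht]; decide
  have hr : ∀ i, t ((finSumFinEquiv : Fin 4 ⊕ Fin 2 ≃ Fin 6) (Sum.inr i)) =
      (![3, 6] : Fin 2 → Fin 7) i := by
    rw [ht]; decide
  have hM : (Matrix.of fun i j => E' (t i) ![v (t j)]).submatrix
      (finSumFinEquiv : Fin 4 ⊕ Fin 2 ≃ Fin 6) (finSumFinEquiv : Fin 4 ⊕ Fin 2 ≃ Fin 6) =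
      Matrix.fromBlocks 1 0 0 !![a, -b; b, a] := by
    ext (i | i) (j | j) <;>
      simp only [Matrix.submatrix_apply, Matrix.of_apply, hE', hl, hr, Matrix.fromBlocks_apply₁₁,
        Matrix.fromBlocks_apply₁₂, Matrix.fromBlocks_apply₂₁, Matrix.fromBlocks_apply₂₂,
        Matrix.one_apply, Matrix.zero_apply, delta] <;>
      fin_cases i <;> fin_cases j <;> simp
  rw [← Matrix.det_submatrix_equiv_self (finSumFinEquiv : Fin 4 ⊕ Fin 2 ≃ Fin 6), hM,
    Matrix.det_fromBlocks_zero₂₁, Matrix.det_one, Matrix.det_fin_two_of] at h0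
  linarith

/-- The algebraic relations between the tensors of a contact Calabi–Yau structure at a point. -/
structure IsContactSU3 (η : V [⋀^Fin 1]→L[ℝ] ℝ) (ξ : V) (J : V →L[ℝ] V) (σ : V [⋀^Fin 2]→L[ℝ] ℝ)
    (Ω : V [⋀^Fin 3]→L[ℝ] ℂ) : Prop where
  η_ξ : η ![ξ] = 1
  σ_ξ : ∀ Y, σ ![ξ, Y] = 0
  J_ξ : J ξ = 0
  J_J : ∀ X, J (J X) = -X + η ![X] • ξ
  σ_J : ∀ X Y, σ ![J X, J Y] = σ ![X, Y]
  σ_pos : ∀ X, η ![X] = 0 → X ≠ 0 → 0 < σ ![X, J X]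
  Ω_J : ∀ X Y Z, Ω ![J X, Y, Z] = Complex.I * Ω ![X, Y, Z]
  volume : (1 / 6 : ℝ) • (wedge (wedge σ σ) σ : V [⋀^Fin 6]→L[ℝ] ℝ) =
    (1 / 4 : ℝ) • (wedge (Complex.reCLM.compContinuousAlternatingMap Ω)
      (Complex.imCLM.compContinuousAlternatingMap Ω) : V [⋀^Fin 6]→L[ℝ] ℝ)

namespace IsContactSU3

/-- The vector `X`, scaled to unit length for the metric `σ(·, J ·)`. -/
def unit (J : V →L[ℝ] V) (σ : V [⋀^Fin 2]→L[ℝ] ℝ) (X : V) : V := (√(σ ![X, J X]))⁻¹ • X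

variable {η : V [⋀^Fin 1]→L[ℝ] ℝ} {ξ : V} {J : V →L[ℝ] V} {σ : V [⋀^Fin 2]→L[ℝ] ℝ}
  {Ω : V [⋀^Fin 3]→L[ℝ] ℂ}

theorem unit_of_eq_one {X : V} (hX : σ ![X, J X] = 1) : unit J σ X = X := by
  rw [unit, hX, Real.sqrt_one, inv_one, one_smul]

theorem metric_unit {X : V} (hX : 0 < σ ![X, J X]) : σ ![unit J σ X, J (unit J σ X)] = 1 := by
  have h : √(σ ![X, J X]) ≠ 0 := (Real.sqrt_pos.2 hX).ne'
  rw [unit, map_smul, twoForm_smul_left, twoForm_smul_right, smul_eq_mul, ← mul_assoc, ← mul_inv,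
    Real.mul_self_sqrt hX.le, inv_mul_cancel₀ hX.ne']

theorem η_unit {X : V} (hX : η ![X] = 0) : η ![unit J σ X] = 0 := by
  rw [unit, oneForm_smul, hX, smul_zero]

variable (h : IsContactSU3 η ξ J σ Ω)
include h

theorem η_J (X : V) : η ![J X] = 0 := by
  have h1 := h.J_J (J X)
  rw [h.J_J X, map_add, map_neg, map_smul, h.J_ξ, smul_zero, add_zero] at h1
  have h2 : η ![J X] • ξ = 0 := by simpa using h1.symm
  have h3 : η ![η ![J X] • ξ] = 0 := by
    rw [h2]
    exact (oneFormLin η).map_zero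
  rw [oneForm_smul, h.η_ξ, smul_eq_mul, mul_one] at h3
  exact h3

theorem σ_ξ_right (X : V) : σ ![X, ξ] = 0 := by rw [twoForm_swap, h.σ_ξ, neg_zero]

theorem σ_J_left (X Y : V) : σ ![J X, Y] = -σ ![X, J Y] := by
  have h1 := h.σ_J X (J Y)
  rw [h.J_J, ← twoFormLin_apply, map_add, map_neg, map_smul, twoFormLin_apply, twoFormLin_apply,
    h.σ_ξ_right, smul_zero, add_zero] at h1
  linarith

theorem metric_symm (X Y : V) : σ ![X, J Y] = σ ![Y, J X] := by
  rw [twoForm_swap, h.σ_J_left, neg_neg]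

theorem metric_J_self (X : V) : σ ![X, J (J X)] = 0 := by
  have h1 := h.metric_symm X (J X)
  rw [h.σ_J_left] at h1
  have h2 := h.σ_J X X
  have h3 := twoForm_swap σ X X
  have h4 := h.σ_J_left X (J X)
  linarith

theorem Ω_ξ (Y Z : V) : Ω ![ξ, Y, Z] = 0 := by
  have h1 := h.Ω_J ξ Y Z
  rw [h.J_ξ] at h1
  have h2 : Ω ![0, Y, Z] = 0 := Ω.map_coord_zero (0 : Fin 3) rfl
  rw [h2] at h1
  exact (mul_eq_zero.1 h1.symm).resolve_left Complex.I_ne_zero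

/-- Fewer than six linear conditions are satisfied by some unit vector of the contact
distribution. -/
theorem exists_unit [FiniteDimensional ℝ V] (hV : Module.finrank ℝ V = 7) {n : ℕ} (hn : n < 6)
    (α : Fin n → V [⋀^Fin 1]→L[ℝ] ℝ) :
    ∃ u, η ![u] = 0 ∧ (∀ i, α i ![u] = 0) ∧ σ ![u, J u] = 1 := by
  let f : V →ₗ[ℝ] (Fin (n + 1) → ℝ) :=
    LinearMap.pi (Matrix.vecCons (oneFormLin η) fun i => oneFormLin (α i))
  have hk := LinearMap.ker_ne_bot_of_finrank_lt (f := f) (by simp [hV]; omega)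
  obtain ⟨X, hX, hX0⟩ := (Submodule.ne_bot_iff _).1 hk
  have hη : η ![X] = 0 := congrFun (LinearMap.mem_ker.1 hX) 0
  have hα : ∀ i : Fin n, α i ![X] = 0 := fun i => congrFun (LinearMap.mem_ker.1 hX) i.succ
  have hp := h.σ_pos X hη hX0
  exact ⟨unit J σ X, η_unit hη, fun i => η_unit (hα i), metric_unit hp⟩

/-- The unitary coframe defined by a unitary frame `u` of the contact distribution. -/
theorem isDualFrame [FiniteDimensional ℝ V] (hV : Module.finrank ℝ V = 7) {u : Fin 3 → V}
    (hη : ∀ i, η ![u i] = 0) (hg : ∀ i j, σ ![u i, J (u j)] = if i = j then 1 else 0)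
    (hσ : ∀ i j, σ ![u i, u j] = 0) :
    IsDualFrame ![η, contractForm σ ![J (u 0)], contractForm σ ![J (u 1)],
      contractForm σ ![J (u 2)], -contractForm σ ![u 0], -contractForm σ ![u 1],
      -contractForm σ ![u 2]] ![ξ, u 0, u 1, u 2, J (u 0), J (u 1), J (u 2)] := by
  refine isDualFrame_of_apply hV fun a b => ?_
  have h1 : ∀ w X, contractForm σ ![w] ![X] = σ ![X, w] := fun w X => contractForm_apply σ ![w] X
  fin_cases a <;> fin_cases b <;>
    simp [h1, hη, hg, hσ, h.η_J, h.η_ξ, h.σ_ξ, h.σ_J, h.σ_J_left, delta]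

/-- The expansion of a vector in a unitary frame of the contact distribution. -/
theorem expand [FiniteDimensional ℝ V] (hV : Module.finrank ℝ V = 7) {u : Fin 3 → V}
    (hη : ∀ i, η ![u i] = 0) (hg : ∀ i j, σ ![u i, J (u j)] = if i = j then 1 else 0)
    (hσ : ∀ i j, σ ![u i, u j] = 0) (X : V) :
    X = η ![X] • ξ + ∑ i, (σ ![X, J (u i)] • u i + σ ![u i, X] • J (u i)) := by
  have h1 : ∀ w X, contractForm σ ![w] ![X] = σ ![X, w] := fun w X => contractForm_apply σ ![w] X
  have e := (h.isDualFrame hV hη hg hσ).sum X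
  conv_lhs => rw [← e]
  have h2 : ∀ i, -σ ![X, u i] = σ ![u i, X] := fun i => (twoForm_swap σ _ _).symm
  rw [Fin.sum_univ_seven, Fin.sum_univ_three]
  simp only [Matrix.cons_val, ContinuousAlternatingMap.neg_apply, h1, h2]
  abel

theorem σ_expand [FiniteDimensional ℝ V] (hV : Module.finrank ℝ V = 7) {u : Fin 3 → V}
    (hη : ∀ i, η ![u i] = 0) (hg : ∀ i j, σ ![u i, J (u j)] = if i = j then 1 else 0)
    (hσ : ∀ i j, σ ![u i, u j] = 0) (X Y : V) :
    σ ![X, Y] = ∑ i, (σ ![X, J (u i)] * σ ![u i, Y] - σ ![Y, J (u i)] * σ ![u i, X]) := by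
  conv_lhs => rw [h.expand hV hη hg hσ Y, ← twoFormLin_apply]
  simp only [map_add, map_sum, map_smul, twoFormLin_apply, h.σ_ξ_right, smul_eq_mul, mul_zero,
    zero_add]
  exact Finset.sum_congr rfl fun i _ => by rw [twoForm_swap σ X (u i)]; ring

theorem Ω_expand_left [FiniteDimensional ℝ V] (hV : Module.finrank ℝ V = 7) {u : Fin 3 → V}
    (hη : ∀ i, η ![u i] = 0) (hg : ∀ i j, σ ![u i, J (u j)] = if i = j then 1 else 0)
    (hσ : ∀ i j, σ ![u i, u j] = 0) (X Y Z : V) :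
    Ω ![X, Y, Z] = ∑ i, ((σ ![X, J (u i)] : ℂ) + Complex.I * σ ![u i, X]) * Ω ![u i, Y, Z] := by
  have h1 : ∀ X, Ω ![X, Y, Z] = oneFormLin (contractForm Ω ![Y, Z]) X := fun X =>
    (contractForm_apply Ω ![Y, Z] X).symm
  conv_lhs => rw [h.expand hV hη hg hσ X, h1]
  simp only [map_add, map_sum, map_smul]
  simp only [← h1, h.Ω_ξ, h.Ω_J, smul_zero, zero_add, Complex.real_smul]
  exact Finset.sum_congr rfl fun i _ => by ring

/-- A transverse `(3,0)`-form is a multiple of the standard one. -/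
theorem Ω_expand [FiniteDimensional ℝ V] (hV : Module.finrank ℝ V = 7) {u : Fin 3 → V}
    (hη : ∀ i, η ![u i] = 0) (hg : ∀ i j, σ ![u i, J (u j)] = if i = j then 1 else 0)
    (hσ : ∀ i j, σ ![u i, u j] = 0) (X Y Z : V) :
    Ω ![X, Y, Z] = Ω ![u 0, u 1, u 2] *
      altThree (fun X => (σ ![X, J (u 0)] : ℂ) + Complex.I * σ ![u 0, X])
        (fun X => (σ ![X, J (u 1)] : ℂ) + Complex.I * σ ![u 1, X])
        (fun X => (σ ![X, J (u 2)] : ℂ) + Complex.I * σ ![u 2, X]) X Y Z := by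
  have hd : ∀ X Y, Ω ![X, X, Y] = 0 := fun X Y => Ω.map_eq_zero_of_eq _
    (show (![X, X, Y] : Fin 3 → V) 0 = ![X, X, Y] 1 from rfl) (by decide)
  have hd' : ∀ X Y, Ω ![X, Y, X] = 0 := fun X Y => by rw [threeForm_rotate, hd]
  have hd'' : ∀ X Y, Ω ![X, Y, Y] = 0 := fun X Y => by rw [threeForm_rotate, hd']
  have ex := h.Ω_expand_left hV hη hg hσ
  have e : Ω ![X, Y, Z] = ∑ i, ((σ ![X, J (u i)] : ℂ) + Complex.I * σ ![u i, X]) *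
      ∑ j, ((σ ![Y, J (u j)] : ℂ) + Complex.I * σ ![u j, Y]) *
      ∑ k, ((σ ![Z, J (u k)] : ℂ) + Complex.I * σ ![u k, Z]) * Ω ![u k, u i, u j] := by
    rw [ex X Y Z]
    refine Finset.sum_congr rfl fun i _ => ?_
    rw [← threeForm_rotate Ω (u i) Y Z, ex Y Z (u i)]
    congr 1
    refine Finset.sum_congr rfl fun j _ => ?_
    rw [← threeForm_rotate Ω (u j) Z (u i), ex Z (u i) (u j)]
  have s1 : Ω ![u 1, u 2, u 0] = Ω ![u 0, u 1, u 2] := threeForm_rotate Ω _ _ _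
  have s2 : Ω ![u 2, u 0, u 1] = Ω ![u 0, u 1, u 2] := (threeForm_rotate Ω _ _ _).symm
  have s3 : Ω ![u 1, u 0, u 2] = -Ω ![u 0, u 1, u 2] := threeForm_swap Ω _ _ _
  have s4 : Ω ![u 0, u 2, u 1] = -Ω ![u 0, u 1, u 2] := by rw [← s2]; exact threeForm_swap Ω _ _ _
  have s5 : Ω ![u 2, u 1, u 0] = -Ω ![u 0, u 1, u 2] := by rw [← s1]; exact threeForm_swap Ω _ _ _
  rw [e]
  simp only [Fin.sum_univ_three, hd, hd', hd'', s1, s2, s3, s4, s5, altThree]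
  ring

/-- The normalization `ω³/6 = Re Ω ∧ Im Ω / 4` makes the coefficient of `Ω` a phase. -/
theorem normSq_Ω [FiniteDimensional ℝ V] (hV : Module.finrank ℝ V = 7) {u : Fin 3 → V}
    (hη : ∀ i, η ![u i] = 0) (hg : ∀ i j, σ ![u i, J (u j)] = if i = j then 1 else 0)
    (hσ : ∀ i j, σ ![u i, u j] = 0) :
    (Ω ![u 0, u 1, u 2]).re ^ 2 + (Ω ![u 0, u 1, u 2]).im ^ 2 = 1 := by
  set a := (Ω ![u 0, u 1, u 2]).re with ha
  set b := (Ω ![u 0, u 1, u 2]).im with hb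
  have hv := h.isDualFrame hV hη hg hσ
  set v := ![ξ, u 0, u 1, u 2, J (u 0), J (u 1), J (u 2)] with hvd
  set E : Fin 7 → V [⋀^Fin 1]→L[ℝ] ℝ := ![η, contractForm σ ![J (u 0)], contractForm σ ![J (u 1)],
      contractForm σ ![J (u 2)], -contractForm σ ![u 0], -contractForm σ ![u 1],
      -contractForm σ ![u 2]] with hE
  -- The coframe in which the last complex covector is rotated so that `Ω` becomes standard.
  let E' : Fin 7 → V [⋀^Fin 1]→L[ℝ] ℝ :=
    ![E 0, E 1, E 2, a • E 3 - b • E 6, E 4, E 5, b • E 3 + a • E 6]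
  have h1 : ∀ w X, contractForm σ ![w] ![X] = σ ![X, w] := fun w X => contractForm_apply σ ![w] X
  have h2 : ∀ i X, -contractForm σ ![u i] ![X] = σ ![u i, X] := fun i X => by
    rw [h1, twoForm_swap, neg_neg]
  have hω : σ = omegaOf E := by
    refine twoForm_ext fun X Y => ?_
    rw [h.σ_expand hV hη hg hσ X Y, omegaOf]
    simp only [ContinuousAlternatingMap.add_apply, ← wedge_mono_one]
    have hw : ∀ α β : V [⋀^Fin 1]→L[ℝ] ℝ, wedge α β ![X, Y] = α ![X] * β ![Y] - α ![Y] * β ![X] :=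
      fun α β => wedge_one_one_apply α β X Y
    refine Eq.trans ?_ (congrArg₂ (· + ·) (congrArg₂ (· + ·) (hw (E 1) (E 4)) (hw (E 2) (E 5)))
      (hw (E 3) (E 6))).symm
    simp only [Fin.sum_univ_three, hE, Matrix.cons_val, ContinuousAlternatingMap.neg_apply, h1]
    rw [twoForm_swap σ X (u 0), twoForm_swap σ Y (u 0), twoForm_swap σ X (u 1),
      twoForm_swap σ Y (u 1), twoForm_swap σ X (u 2), twoForm_swap σ Y (u 2)]
    ring
  have hΩ : ∀ X Y Z, Ω ![X, Y, Z] =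
      (reOmegaOf E' ![X, Y, Z] : ℂ) + Complex.I * imOmegaOf E' ![X, Y, Z] := fun X Y Z => by
    rw [h.Ω_expand hV hη hg hσ, reOmegaOf_add_imOmegaOf_apply]
    have hc : Ω ![u 0, u 1, u 2] = (a : ℂ) + Complex.I * b := by
      rw [mul_comm]; exact (Complex.re_add_im _).symm
    rw [hc]
    have key : ∀ x y : ℝ, ((a * x - b * y : ℝ) : ℂ) + Complex.I * ((b * x + a * y : ℝ) : ℂ) =
        ((a : ℂ) + Complex.I * b) * ((x : ℂ) + Complex.I * y) := fun x y => by
      push_cast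
      linear_combination -(b * y : ℂ) * Complex.I_mul_I
    have h3 : ∀ i X, σ ![u i, X] = -σ ![X, u i] := fun i X => twoForm_swap σ _ _
    simp only [E', hE, Matrix.cons_val, altThree, ContinuousAlternatingMap.add_apply,
      ContinuousAlternatingMap.sub_apply, ContinuousAlternatingMap.smul_apply, smul_eq_mul,
      ContinuousAlternatingMap.neg_apply, h1, key, h3]
    ring
  have hre : Complex.reCLM.compContinuousAlternatingMap Ω = reOmegaOf E' := by
    refine threeForm_ext fun X Y Z => ?_
    refine (congrArg Complex.re (hΩ X Y Z)).trans ?_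
    simp
  have him : Complex.imCLM.compContinuousAlternatingMap Ω = imOmegaOf E' := by
    refine threeForm_ext fun X Y Z => ?_
    refine (congrArg Complex.im (hΩ X Y Z)).trans ?_
    simp
  have hvol : sixFormOf E 0 = sixFormOf E' 0 := by
    rw [sixFormOf, if_pos rfl, ← hω]
    refine h.volume.trans ?_
    rw [hre, him, wedge_reOmegaOf_imOmegaOf, smul_smul]
    norm_num
  exact hv.sq_add_sq_of_sixFormOf_eq hvol

/-- Two vectors `u₁`, `u₂` of the contact distribution, orthonormal for the Hermitian metric,
determine a special unitary coframe, whose last complex covector is the contraction of `Ω` with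
`u₁`, `u₂`. -/
theorem adapted [FiniteDimensional ℝ V] (hV : Module.finrank ℝ V = 7) {u₁ u₂ : V}
    (h₁ : η ![u₁] = 0) (h₂ : η ![u₂] = 0) (h₁₁ : σ ![u₁, J u₁] = 1) (h₂₂ : σ ![u₂, J u₂] = 1)
    (h₁₂ : σ ![u₁, J u₂] = 0) (hσ₁₂ : σ ![u₁, u₂] = 0) :
    (∀ X Y, σ ![X, Y] = σ ![X, J u₁] * σ ![u₁, Y] - σ ![Y, J u₁] * σ ![u₁, X] +
      (σ ![X, J u₂] * σ ![u₂, Y] - σ ![Y, J u₂] * σ ![u₂, X]) +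
      ((Ω ![X, u₁, u₂]).re * (Ω ![Y, u₁, u₂]).im - (Ω ![Y, u₁, u₂]).re * (Ω ![X, u₁, u₂]).im)) ∧
    ∀ X Y Z, Ω ![X, Y, Z] = altThree (fun X => (σ ![X, J u₁] : ℂ) + Complex.I * σ ![u₁, X])
      (fun X => (σ ![X, J u₂] : ℂ) + Complex.I * σ ![u₂, X]) (fun X => Ω ![X, u₁, u₂]) X Y Z := by
  obtain ⟨u₃, h₃, hα, h₃₃⟩ := h.exists_unit hV (by norm_num : 4 < 6)
    ![contractForm σ ![J u₁], contractForm σ ![u₁], contractForm σ ![J u₂], contractForm σ ![u₂]]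
  have hc : ∀ w X, contractForm σ ![w] ![X] = σ ![X, w] := fun w X => contractForm_apply σ ![w] X
  have a0 : σ ![u₃, J u₁] = 0 := (hc _ _).symm.trans (hα 0)
  have a1 : σ ![u₃, u₁] = 0 := (hc _ _).symm.trans (hα 1)
  have a2 : σ ![u₃, J u₂] = 0 := (hc _ _).symm.trans (hα 2)
  have a3 : σ ![u₃, u₂] = 0 := (hc _ _).symm.trans (hα 3)
  have hd : ∀ X, σ ![X, X] = 0 := fun X => by linarith [twoForm_swap σ X X]
  have b1 : σ ![u₁, u₃] = 0 := by rw [twoForm_swap, a1, neg_zero]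
  have b3 : σ ![u₂, u₃] = 0 := by rw [twoForm_swap, a3, neg_zero]
  have b4 : σ ![u₂, u₁] = 0 := by rw [twoForm_swap, hσ₁₂, neg_zero]
  have c1 : σ ![u₂, J u₁] = 0 := by rw [h.metric_symm, h₁₂]
  have c2 : σ ![u₁, J u₃] = 0 := by rw [h.metric_symm, a0]
  have c3 : σ ![u₂, J u₃] = 0 := by rw [h.metric_symm, a2]
  have hη : ∀ i, η ![![u₁, u₂, u₃] i] = 0 := fun i => by fin_cases i <;> assumption
  have hg : ∀ i j, σ ![![u₁, u₂, u₃] i, J (![u₁, u₂, u₃] j)] = if i = j then 1 else 0 :=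
    fun i j => by fin_cases i <;> fin_cases j <;> simp [*]
  have hσ : ∀ i j, σ ![![u₁, u₂, u₃] i, ![u₁, u₂, u₃] j] = 0 := fun i j => by
    fin_cases i <;> fin_cases j <;> simp [*]
  have hn := h.normSq_Ω hV hη hg hσ
  have hs := h.σ_expand hV hη hg hσ
  have hΩ := h.Ω_expand hV hη hg hσ
  simp only [Fin.sum_univ_three, Matrix.cons_val] at hn hs hΩ
  set c := Ω ![u₁, u₂, u₃] with hcd
  have hw : ∀ X, Ω ![X, u₁, u₂] = c * ((σ ![X, J u₃] : ℂ) + Complex.I * σ ![u₃, X]) := fun X => by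
    rw [hΩ]
    simp [altThree, h₁₁, h₂₂, h₁₂, hσ₁₂, hd, b4, c1, c2, c3, a1, a3]
  refine ⟨fun X Y => ?_, fun X Y Z => ?_⟩
  · rw [hw X, hw Y, hs X Y]
    simp only [Complex.mul_re, Complex.mul_im, Complex.add_re, Complex.add_im, Complex.ofReal_re,
      Complex.ofReal_im, Complex.I_re, Complex.I_im, zero_mul, one_mul, mul_zero, sub_zero,
      add_zero, zero_add]
    linear_combination -(σ ![X, J u₃] * σ ![u₃, Y] - σ ![Y, J u₃] * σ ![u₃, X]) * hn
  · rw [hΩ X Y Z]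
    simp only [altThree, hw]
    ring

end IsContactSU3
end PointwiseCoframe

/-! ### Smooth vector fields -/

section SmoothVectorFields

open Filter Topology

variable {K : Type*} [TopologicalSpace K] [ChartedSpace E7 K] [IsManifold (𝓡 7) ∞ K]

/-- Smoothness of a vector field at a point. -/
def SmoothVecAt (u : (x : K) → TangentSpace (𝓡 7) x) (z : K) : Prop :=
  ContMDiffAt (𝓡 7) ((𝓡 7).prod 𝓘(ℝ, E7)) ∞
    (fun x => Bundle.TotalSpace.mk' E7 (E := fun x : K => TangentSpace (𝓡 7) x) x (u x)) z

theorem SmoothVecAt.smul {u : (x : K) → TangentSpace (𝓡 7) x} {f : K → ℝ} {z : K}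
    (hf : ContMDiffAt (𝓡 7) 𝓘(ℝ, ℝ) ∞ f z) (hu : SmoothVecAt u z) :
    SmoothVecAt (fun x => f x • u x) z :=
  ContMDiffAt.smul_section hf hu

theorem SmoothVecAt.sub {u v : (x : K) → TangentSpace (𝓡 7) x} {z : K}
    (hu : SmoothVecAt u z) (hv : SmoothVecAt v z) : SmoothVecAt (fun x => u x - v x) z :=
  ContMDiffAt.sub_section hu hv

theorem SmoothVecAt.J (S : ContactCalabiYau K) {u : (x : K) → TangentSpace (𝓡 7) x} {z : K}
    (hu : SmoothVecAt u z) : SmoothVecAt (fun x => S.J x (u x)) z :=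
  ContMDiffAt.clm_bundle_apply (S.smooth_J z) hu

/-- A tangent vector at `p` extends to a vector field that is smooth near `p`. -/
theorem exists_smoothVecAt (p : K) (X : TangentSpace (𝓡 7) p) :
    ∃ u : (x : K) → TangentSpace (𝓡 7) x, u p = X ∧ ∀ᶠ z in 𝓝 p, SmoothVecAt u z := by
  let e := trivializationAt E7 (fun x : K => TangentSpace (𝓡 7) x) p
  have hp : p ∈ e.baseSet := FiberBundle.mem_baseSet_trivializationAt' p
  refine ⟨fun x => e.symm x (e ⟨p, X⟩).2, e.symm_apply_apply_mk hp X, ?_⟩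
  filter_upwards [e.open_baseSet.mem_nhds hp] with z hz
  refine (e.contMDiffAt_section_iff hz).2 ?_
  refine (contMDiffAt_const (c := (e ⟨p, X⟩).2)).congr_of_eventuallyEq ?_
  filter_upwards [e.open_baseSet.mem_nhds hz] with x hx
  rw [e.apply_mk_symm hx]

/-- A smooth vector field, read in the preferred chart. -/
theorem SmoothVecAt.contDiffAt {u : (x : K) → TangentSpace (𝓡 7) x} {z : K}
    (hu : SmoothVecAt u z) : ContDiffAt ℝ ∞
      (fun y => mfderiv (𝓡 7) 𝓘(ℝ, E7) (extChartAt (𝓡 7) z) ((extChartAt (𝓡 7) z).symm y)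
        (u ((extChartAt (𝓡 7) z).symm y)) : E7 → E7) (extChartAt (𝓡 7) z z) := by
  have := isManifold_one K
  let e := trivializationAt E7 (fun x : K => TangentSpace (𝓡 7) x) z
  have h1 : ContMDiffAt (𝓡 7) 𝓘(ℝ, E7) ∞
      (fun x => mfderiv (𝓡 7) 𝓘(ℝ, E7) (extChartAt (𝓡 7) z) x (u x) : K → E7) z := by
    refine ((Bundle.contMDiffAt_section z).1 hu).congr_of_eventuallyEq ?_
    filter_upwards [(chartAt E7 z).open_source.mem_nhds (mem_chart_source E7 z)] with x hx
    have hx' : x ∈ e.baseSet := hx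
    rw [← TangentBundle.continuousLinearMapAt_trivializationAt hx]
    exact congrFun (e.coe_linearMapAt_of_mem (R := ℝ) hx') (u x)
  have h2 : ContMDiffAt 𝓘(ℝ, E7) (𝓡 7) ∞ (extChartAt (𝓡 7) z).symm (extChartAt (𝓡 7) z z) :=
    (contMDiffOn_extChartAt_symm z).contMDiffAt
      ((isOpen_extChartAt_target (I := 𝓡 7) z).mem_nhds (mem_extChartAt_target z))
  exact contMDiffAt_iff_contDiffAt.1 (h1.comp_of_eq h2 (extChartAt_to_inv z))

omit [IsManifold (𝓡 7) ∞ K] in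
theorem contMDiffAt_of_contDiffAt_symm {f : K → ℝ} {z : K}
    (hf : ContDiffAt ℝ ∞ (fun y => f ((extChartAt (𝓡 7) z).symm y)) (extChartAt (𝓡 7) z z)) :
    ContMDiffAt (𝓡 7) 𝓘(ℝ, ℝ) ∞ f z := by
  have h := (contMDiffAt_iff_contDiffAt.2 hf).comp z
    (contMDiffAt_extChartAt (I := 𝓡 7) (n := ∞) (x := z))
  refine h.congr_of_eventuallyEq ?_
  filter_upwards [extChartAt_source_mem_nhds (I := 𝓡 7) z] with x hx
  exact congrArg f ((extChartAt (𝓡 7) z).left_inv hx).symm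

/-- A smooth form applied to smooth vector fields is a smooth function. -/
theorem SmoothFormAt.contMDiffAt_apply {n : ℕ} {α : DiffForm K ℝ n} {z : K} (hα : SmoothFormAt α z)
    {w : Fin n → (x : K) → TangentSpace (𝓡 7) x} (hw : ∀ i, SmoothVecAt (w i) z) :
    ContMDiffAt (𝓡 7) 𝓘(ℝ, ℝ) ∞ (fun x => α x fun i => w i x) z := by
  refine contMDiffAt_of_contDiffAt_symm ?_
  refine (contDiffAt_form_apply hα fun i => (hw i).contDiffAt).congr_of_eventuallyEq ?_
  filter_upwards [(isOpen_extChartAt_target (I := 𝓡 7) z).mem_nhds (mem_extChartAt_target z)]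
    with y hy using (chartRep_apply_symm α hy w).symm

/-- The contraction of a smooth form with smooth vector fields is smooth. -/
theorem SmoothFormAt.contract {n : ℕ} {α : DiffForm K ℝ (n + 1)} {z : K} (hα : SmoothFormAt α z)
    {w : Fin n → (x : K) → TangentSpace (𝓡 7) x} (hw : ∀ i, SmoothVecAt (w i) z) :
    SmoothFormAt (fun x => contractForm (α x) fun i => w i x : DiffForm K ℝ 1) z := by
  refine contDiffAt_form_iff.2 fun v => ?_
  have hv : ∀ i : Fin (n + 1), ContDiffAt ℝ ∞ (Fin.cons (α := fun _ => E7 → E7) (fun _ => v 0)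
      (fun i y => mfderiv (𝓡 7) 𝓘(ℝ, E7) (extChartAt (𝓡 7) z) ((extChartAt (𝓡 7) z).symm y)
        (w i ((extChartAt (𝓡 7) z).symm y))) i) (extChartAt (𝓡 7) z z) := fun i => by
    refine Fin.cases ?_ (fun i => ?_) i
    · exact contDiffAt_const
    · exact (hw i).contDiffAt
  refine (contDiffAt_form_apply hα hv).congr_of_eventuallyEq ?_
  filter_upwards [(isOpen_extChartAt_target (I := 𝓡 7) z).mem_nhds (mem_extChartAt_target z)]
    with y hy
  refine congrArg (α ((extChartAt (𝓡 7) z).symm y)) (funext fun i => ?_)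
  refine Fin.cases ?_ (fun i => ?_) i
  · rfl
  · have h := DFunLike.congr_fun (mfderiv_symm_comp_extChartAt ((extChartAt (𝓡 7) z).map_target hy))
      (w i ((extChartAt (𝓡 7) z).symm y))
    rw [(extChartAt (𝓡 7) z).right_inv hy] at h
    exact h.symm

end SmoothVectorFields

/-! ### Existence of local coframes -/

namespace IsContactSU3

variable {V : Type*} [AddCommGroup V] [Module ℝ V] [TopologicalSpace V]

/-- The component of `X` orthogonal to the complex line spanned by a unit vector `u`. -/
def orthogonalPart (J : V →L[ℝ] V) (σ : V [⋀^Fin 2]→L[ℝ] ℝ) (u X : V) : V :=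
  X - σ ![X, J u] • u - σ ![u, X] • J u

variable {η : V [⋀^Fin 1]→L[ℝ] ℝ} {ξ : V} {J : V →L[ℝ] V} {σ : V [⋀^Fin 2]→L[ℝ] ℝ}
  {Ω : V [⋀^Fin 3]→L[ℝ] ℂ}

theorem σ_orthogonalPart {u : V} (hu : σ ![u, J u] = 1) (X : V) :
    σ ![u, orthogonalPart J σ u X] = 0 := by
  have h0 : σ ![u, u] = 0 := by linarith [twoForm_swap σ u u]
  rw [orthogonalPart, twoForm_sub_right, twoForm_sub_right, twoForm_smul_right, twoForm_smul_right,
    hu, h0]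
  ring

variable (h : IsContactSU3 η ξ J σ Ω)
include h

theorem η_orthogonalPart {u X : V} (hu : η ![u] = 0) (hX : η ![X] = 0) :
    η ![orthogonalPart J σ u X] = 0 := by
  change oneFormLin η (X - σ ![X, J u] • u - σ ![u, X] • J u) = 0
  rw [map_sub, map_sub, map_smul, map_smul]
  change η ![X] - σ ![X, J u] • η ![u] - σ ![u, X] • η ![J u] = 0
  rw [hu, hX, h.η_J]
  simp

theorem metric_orthogonalPart {u : V} (hu : σ ![u, J u] = 1) (X : V) :
    σ ![u, J (orthogonalPart J σ u X)] = 0 := by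
  rw [orthogonalPart, map_sub, map_sub, map_smul, map_smul, twoForm_sub_right, twoForm_sub_right,
    twoForm_smul_right, twoForm_smul_right, hu, h.metric_J_self, h.metric_symm u X]
  ring

end IsContactSU3

section SmoothCoframe

open Filter Topology IsContactSU3

variable {K : Type*} [TopologicalSpace K] [ChartedSpace E7 K] [IsManifold (𝓡 7) ∞ K]

theorem SmoothFormAt.contMDiffAt_apply_two {α : DiffForm K ℝ 2} {z : K} (hα : SmoothFormAt α z)
    {u v : (x : K) → TangentSpace (𝓡 7) x} (hu : SmoothVecAt u z) (hv : SmoothVecAt v z) :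
    ContMDiffAt (𝓡 7) 𝓘(ℝ, ℝ) ∞ (fun x => α x ![u x, v x]) z := by
  have := hα.contMDiffAt_apply (w := ![u, v]) fun i => by
    fin_cases i
    · exact hu
    · exact hv
  refine this.congr_of_eventuallyEq (Eventually.of_forall fun x => congrArg (α x) ?_)
  funext i
  fin_cases i <;> rfl

theorem SmoothFormAt.contract_one {α : DiffForm K ℝ 2} {z : K} (hα : SmoothFormAt α z)
    {u : (x : K) → TangentSpace (𝓡 7) x} (hu : SmoothVecAt u z) :
    SmoothFormAt (fun x => contractForm (α x) ![u x] : DiffForm K ℝ 1) z := by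
  refine (hα.contract (w := ![u]) fun i => ?_).congr (Eventually.of_forall fun x => ?_)
  · fin_cases i
    exact hu
  · refine congrArg (contractForm (α x)) ?_
    funext i
    fin_cases i
    rfl

theorem SmoothFormAt.contract_two {α : DiffForm K ℝ 3} {z : K} (hα : SmoothFormAt α z)
    {u v : (x : K) → TangentSpace (𝓡 7) x} (hu : SmoothVecAt u z) (hv : SmoothVecAt v z) :
    SmoothFormAt (fun x => contractForm (α x) ![u x, v x] : DiffForm K ℝ 1) z := by
  refine (hα.contract (w := ![u, v]) fun i => ?_).congr (Eventually.of_forall fun x => ?_)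
  · fin_cases i
    · exact hu
    · exact hv
  · refine congrArg (contractForm (α x)) ?_
    funext i
    fin_cases i <;> rfl

omit [IsManifold (𝓡 7) ∞ K] in
theorem SmoothFormAt.reForm {n : ℕ} {α : DiffForm K ℂ n} {z : K} (hα : SmoothFormAt α z) :
    SmoothFormAt (reForm α) z :=
  contDiffAt_form_iff.2 fun v => Complex.reCLM.contDiff.contDiffAt.comp _
    (contDiffAt_form_iff.1 hα v)

omit [IsManifold (𝓡 7) ∞ K] in
theorem SmoothFormAt.imForm {n : ℕ} {α : DiffForm K ℂ n} {z : K} (hα : SmoothFormAt α z) :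
    SmoothFormAt (imForm α) z :=
  contDiffAt_form_iff.2 fun v => Complex.imCLM.contDiff.contDiffAt.comp _
    (contDiffAt_form_iff.1 hα v)

namespace ContactCalabiYau

variable (S : ContactCalabiYau K)

set_option maxRecDepth 10000 in
theorem isContactSU3 (x : K) : IsContactSU3 (V := TangentSpace (𝓡 7) x) (S.η x) (S.ξ x) (S.J x)
    (S.omega x) (S.Ω x) where
  η_ξ := S.η_ξ x
  σ_ξ := S.dη_ξ x
  J_ξ := S.J_ξ x
  J_J := S.J_J x
  σ_J := S.dη_J x
  σ_pos := S.dη_pos x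
  Ω_J := S.Ω_J x
  volume := congrFun S.volume_eq x

theorem smoothFormAt_omega (z : K) : SmoothFormAt S.omega z :=
  smoothFormAt_extD (Filter.Eventually.of_forall fun x => S.smooth_η x (Set.mem_univ x))

theorem smoothVecAt_unit {X : (x : K) → TangentSpace (𝓡 7) x} {z : K} (hX : SmoothVecAt X z)
    (hpos : 0 < S.omega z ![X z, S.J z (X z)]) :
    SmoothVecAt (fun x => unit (S.J x) (S.omega x) (X x)) z := by
  refine SmoothVecAt.smul ?_ hX
  have h1 := (S.smoothFormAt_omega z).contMDiffAt_apply_two hX (hX.J S)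
  have h2 : ContDiffAt ℝ ∞ (fun t : ℝ => (√t)⁻¹) (S.omega z ![X z, S.J z (X z)]) :=
    (Real.contDiffAt_sqrt hpos.ne').inv (Real.sqrt_pos.2 hpos).ne'
  exact ContMDiffAt.comp (g := fun t : ℝ => (√t)⁻¹) z (contMDiffAt_iff_contDiffAt.2 h2) h1

theorem smoothVecAt_orthogonalPart {u X : (x : K) → TangentSpace (𝓡 7) x} {z : K}
    (hu : SmoothVecAt u z) (hX : SmoothVecAt X z) :
    SmoothVecAt (fun x => orthogonalPart (S.J x) (S.omega x) (u x) (X x)) z :=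
  (hX.sub (.smul ((S.smoothFormAt_omega z).contMDiffAt_apply_two hX (hu.J S)) hu)).sub
    (.smul ((S.smoothFormAt_omega z).contMDiffAt_apply_two hu hX) (hu.J S))

/-- Near every point there are two smooth horizontal vector fields, orthonormal over `ℂ`. The
fields are obtained by the Gram–Schmidt process from extensions of a frame at the point; applying
`J` to the extensions makes them horizontal. -/
theorem exists_orthonormal_pair (p : K) :
    ∃ u₁ u₂ : (x : K) → TangentSpace (𝓡 7) x, ∀ᶠ z in 𝓝 p, SmoothVecAt u₁ z ∧ SmoothVecAt u₂ z ∧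
      S.η z ![u₁ z] = 0 ∧ S.η z ![u₂ z] = 0 ∧ S.omega z ![u₁ z, S.J z (u₁ z)] = 1 ∧
      S.omega z ![u₂ z, S.J z (u₂ z)] = 1 ∧ S.omega z ![u₁ z, S.J z (u₂ z)] = 0 ∧
      S.omega z ![u₁ z, u₂ z] = 0 := by
  have hfd : FiniteDimensional ℝ (TangentSpace (𝓡 7) p) := inferInstanceAs (FiniteDimensional ℝ E7)
  have hV : Module.finrank ℝ (TangentSpace (𝓡 7) p) = 7 :=
    (finrank_euclideanSpace_fin : Module.finrank ℝ E7 = 7)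
  have hp := S.isContactSU3 p
  obtain ⟨w₁, hη₁, -, hw₁⟩ := hp.exists_unit hV (by norm_num : 0 < 6) ![]
  obtain ⟨w₂, hη₂, hα, hw₂⟩ := hp.exists_unit hV (by norm_num : 2 < 6)
    ![contractForm (S.omega p) ![S.J p w₁], contractForm (S.omega p) ![w₁]]
  have e₁ : S.omega p ![w₂, S.J p w₁] = 0 := (contractForm_apply _ _ _).symm.trans (hα 0)
  have e₂ : S.omega p ![w₁, w₂] = 0 := by
    rw [twoForm_swap, neg_eq_zero]
    exact (contractForm_apply _ _ _).symm.trans (hα 1)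
  obtain ⟨V₁, hV₁, hs₁⟩ := exists_smoothVecAt p (-S.J p w₁)
  obtain ⟨V₂, hV₂, hs₂⟩ := exists_smoothVecAt p (-S.J p w₂)
  have hJJ : ∀ w, S.η p ![w] = 0 → S.J p (-S.J p w) = w := fun w hw => by
    rw [map_neg, S.J_J, hw, zero_smul, add_zero, neg_neg]
  let u₁ : (x : K) → TangentSpace (𝓡 7) x := fun x => unit (S.J x) (S.omega x) (S.J x (V₁ x))
  let b : (x : K) → TangentSpace (𝓡 7) x := fun x =>
    orthogonalPart (S.J x) (S.omega x) (u₁ x) (S.J x (V₂ x))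
  have ha₁ : S.J p (V₁ p) = w₁ := by rw [hV₁, hJJ w₁ hη₁]
  have ha₂ : S.J p (V₂ p) = w₂ := by rw [hV₂, hJJ w₂ hη₂]
  have hpos₁ : 0 < S.omega p ![S.J p (V₁ p), S.J p (S.J p (V₁ p))] := by
    rw [ha₁, hw₁]
    exact one_pos
  have hu₁p : u₁ p = w₁ := by
    change unit (S.J p) (S.omega p) (S.J p (V₁ p)) = w₁
    rw [ha₁, unit_of_eq_one hw₁]
  have hbp : b p = w₂ := by
    change orthogonalPart (S.J p) (S.omega p) (u₁ p) (S.J p (V₂ p)) = w₂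
    rw [ha₂, hu₁p, orthogonalPart, e₁, e₂, zero_smul, zero_smul, sub_zero, sub_zero]
  have hu₁s : ∀ z, SmoothVecAt V₁ z → 0 < S.omega z ![S.J z (V₁ z), S.J z (S.J z (V₁ z))] →
      SmoothVecAt u₁ z := fun z hz hpos => S.smoothVecAt_unit (hz.J S) hpos
  have hbs : ∀ z, SmoothVecAt u₁ z → SmoothVecAt V₂ z → SmoothVecAt b z := fun z hz hz' =>
    S.smoothVecAt_orthogonalPart hz (hz'.J S)
  have hb : SmoothVecAt b p := hbs p (hu₁s p hs₁.self_of_nhds hpos₁) hs₂.self_of_nhds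
  have hpos₂ : 0 < S.omega p ![b p, S.J p (b p)] := by
    rw [hbp, hw₂]
    exact one_pos
  have c₁ := ((S.smoothFormAt_omega p).contMDiffAt_apply_two (hs₁.self_of_nhds.J S)
    ((hs₁.self_of_nhds.J S).J S)).continuousAt.eventually (lt_mem_nhds hpos₁)
  have c₂ := ((S.smoothFormAt_omega p).contMDiffAt_apply_two hb
    (hb.J S)).continuousAt.eventually (lt_mem_nhds hpos₂)
  refine ⟨u₁, fun x => unit (S.J x) (S.omega x) (b x), ?_⟩
  filter_upwards [hs₁, hs₂, c₁, c₂] with z h₁ h₂ h₃ h₄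
  have hz := S.isContactSU3 z
  have hu := hu₁s z h₁ h₃
  have hu1 : S.omega z ![u₁ z, S.J z (u₁ z)] = 1 := metric_unit h₃
  have hη : S.η z ![u₁ z] = 0 := η_unit (hz.η_J _)
  refine ⟨hu, S.smoothVecAt_unit (hbs z hu h₂) h₄, hη,
    η_unit (hz.η_orthogonalPart hη (hz.η_J _)), hu1, metric_unit h₄, ?_, ?_⟩
  · rw [unit, map_smul, twoForm_smul_right]
    exact mul_eq_zero_of_right _ (hz.metric_orthogonalPart hu1 _)
  · rw [unit, twoForm_smul_right]
    exact mul_eq_zero_of_right _ (σ_orthogonalPart hu1 _)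

/-- Every point lies in the domain of an adapted coframe. With a unitary pair of vector fields
`u₁, u₂` it is `e_i = g_V(u_i, ·)` for `i = 1, 2` and `e₃ = Re Ω(u₁, u₂, ·)`; the normalization of
`Ω` makes the third covector a unit one. -/
theorem exists_coframe (p : K) : ∃ F : S.Coframe, p ∈ F.U := by
  obtain ⟨u₁, u₂, hu⟩ := S.exists_orthonormal_pair p
  obtain ⟨U, hU, hUo, hpU⟩ := mem_nhds_iff.1 hu
  let e : Fin 3 → DiffForm K ℝ 1 := ![fun x => contractForm (S.omega x) ![S.J x (u₁ x)],
    fun x => contractForm (S.omega x) ![S.J x (u₂ x)],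
    fun x => contractForm (reForm S.Ω x) ![u₁ x, u₂ x]]
  let f : Fin 3 → DiffForm K ℝ 1 := ![fun x => -contractForm (S.omega x) ![u₁ x],
    fun x => -contractForm (S.omega x) ![u₂ x],
    fun x => contractForm (imForm S.Ω x) ![u₁ x, u₂ x]]
  have e0 : ∀ x X, e 0 x ![X] = S.omega x ![X, S.J x (u₁ x)] := fun x X => contractForm_apply _ _ _
  have e1 : ∀ x X, e 1 x ![X] = S.omega x ![X, S.J x (u₂ x)] := fun x X => contractForm_apply _ _ _
  have e2 : ∀ x X, e 2 x ![X] = (S.Ω x ![X, u₁ x, u₂ x]).re := fun x X => contractForm_apply _ _ _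
  have f0 : ∀ x X, f 0 x ![X] = S.omega x ![u₁ x, X] := fun x X =>
    (congrArg Neg.neg (contractForm_apply (S.omega x) ![u₁ x] X)).trans
      (twoForm_swap (S.omega x) (u₁ x) X).symm
  have f1 : ∀ x X, f 1 x ![X] = S.omega x ![u₂ x, X] := fun x X =>
    (congrArg Neg.neg (contractForm_apply (S.omega x) ![u₂ x] X)).trans
      (twoForm_swap (S.omega x) (u₂ x) X).symm
  have f2 : ∀ x X, f 2 x ![X] = (S.Ω x ![X, u₁ x, u₂ x]).im := fun x X => contractForm_apply _ _ _
  have hact : ∀ α x X, S.actJ α x ![X] = -α x ![S.J x X] := fun α x X => by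
    refine congrArg (fun v => -α x v) ?_
    funext i
    fin_cases i
    rfl
  have hf : ∀ i, S.actJ (e i) = f i := fun i => by
    funext x
    refine oneForm_ext fun X => ?_
    rw [hact]
    fin_cases i
    · change -e 0 x ![S.J x X] = f 0 x ![X]
      rw [e0, f0, (S.isContactSU3 x).σ_J, ← twoForm_swap]
    · change -e 1 x ![S.J x X] = f 1 x ![X]
      rw [e1, f1, (S.isContactSU3 x).σ_J, ← twoForm_swap]
    · change -e 2 x ![S.J x X] = f 2 x ![X]
      rw [e2, f2, S.Ω_J, Complex.I_mul_re, neg_neg]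
  have hadapted : ∀ x ∈ U, _ := fun x hx =>
    have hfd : FiniteDimensional ℝ (TangentSpace (𝓡 7) x) :=
      inferInstanceAs (FiniteDimensional ℝ E7)
    have hx' := (hU hx).2.2
    (S.isContactSU3 x).adapted (finrank_euclideanSpace_fin : Module.finrank ℝ E7 = 7)
      hx'.1 hx'.2.1 hx'.2.2.1 hx'.2.2.2.1 hx'.2.2.2.2.1 hx'.2.2.2.2.2
  refine ⟨⟨U, hUo, e, fun i x hx => ?_, fun i x hx => ?_, fun i x hx => ?_, fun x hx => ?_,
    fun x hx => ?_⟩, hpU⟩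
  · fin_cases i
    · exact (S.smoothFormAt_omega x).contract_one ((hU hx).1.J S)
    · exact (S.smoothFormAt_omega x).contract_one ((hU hx).2.1.J S)
    · exact (SmoothFormAt.reForm (S.smooth_Ω x (Set.mem_univ x))).contract_two (hU hx).1 (hU hx).2.1
  · rw [hf]
    fin_cases i
    · exact ((S.smoothFormAt_omega x).contract_one (hU hx).1).neg
    · exact ((S.smoothFormAt_omega x).contract_one (hU hx).2.1).neg
    · exact (SmoothFormAt.imForm (S.smooth_Ω x (Set.mem_univ x))).contract_two (hU hx).1 (hU hx).2.1
  · fin_cases i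
    · exact (e0 x _).trans ((S.isContactSU3 x).σ_ξ _)
    · exact (e1 x _).trans ((S.isContactSU3 x).σ_ξ _)
    · refine (e2 x _).trans ?_
      rw [(S.isContactSU3 x).Ω_ξ, Complex.zero_re]
  · simp only [hf, Fin.sum_univ_three]
    refine twoForm_ext fun X Y => ?_
    change _ = wedge (e 0 x) (f 0 x) ![X, Y] + wedge (e 1 x) (f 1 x) ![X, Y] +
      wedge (e 2 x) (f 2 x) ![X, Y]
    rw [wedge_one_one_apply, wedge_one_one_apply, wedge_one_one_apply, e0, e0, e1, e1, e2, e2,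
      f0, f0, f1, f1, f2, f2]
    exact (hadapted x hx).1 X Y
  · simp only [hf]
    refine threeForm_ext fun X Y Z => ?_
    refine ((hadapted x hx).2 X Y Z).trans ?_
    refine Eq.trans ?_ (wedge_one_one_one_apply _ _ _ X Y Z).symm
    have hc : ∀ i X, (complexify (e i) + Complex.I • complexify (f i)) x ![X] =
        (e i x ![X] : ℂ) + Complex.I * (f i x ![X] : ℂ) := fun i X => rfl
    simp only [hc, e0, e1, e2, f0, f1, f2, altThree, mul_comm Complex.I, Complex.re_add_im]

end ContactCalabiYau

end SmoothCoframe

end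

theorem mainTheorem3 {K : Type*} [TopologicalSpace K] [ChartedSpace E7 K]
    [IsManifold (𝓡 7) ∞ K] [Nonempty K] (S : ContactCalabiYau K) (ε : ℝ) (hε : 0 < ε) :
    (∀ (δ k : ℝ) (F : S.Coframe)
      (Γ : Matrix (Fin 3 ⊕ Fin 3) (Fin 3 ⊕ Fin 3) (DiffForm K ℝ 1)),
      F.IsTransverseLeviCivita Γ → ∀ x ∈ F.U, ∀ i j,
        wedgeF (curvature (F.theta Γ ε δ k) i j) (S.ψ ε) x =
          (k * ε ^ 2 * (1 - δ) * (6 + k * (1 + 3 * δ)) / 4) • smulI S.sixthOmegaCube i j x +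
          (k ^ 2 * ε ^ 2 / 4) •
            wedgeF (wedgeF (ε • S.η) S.halfOmegaSq) (F.matN δ i j) x) ∧
    (∀ δ k : ℝ, k ≠ 0 → ¬ S.IsG2Instanton ε δ k) ∧
    ¬ S.IsG2Instanton ε 1 1 ∧
    ¬ S.IsG2Instanton ε (-1) 1 := by
  have key : ∀ δ k : ℝ, k ≠ 0 → ¬ S.IsG2Instanton ε δ k := fun δ k hk hinst => by
    obtain ⟨p⟩ := ‹Nonempty K›
    obtain ⟨F, hp⟩ := S.exists_coframe p
    obtain ⟨Γ, hΓ⟩ := F.exists_isTransverseLeviCivita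
    obtain ⟨i, j, hij⟩ := hΓ.exists_wedge_curvature_psi_ne_zero hε.ne' δ hk hp
    exact hij (hinst F Γ hΓ p hp i j)
  exact ⟨fun δ k F Γ hΓ x hx i j => hΓ.wedge_curvature_psi hε.ne' δ k hx i j, key,
    key 1 1 one_ne_zero, key (-1) 1 one_ne_zero⟩
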